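/- **Model.** Fix integers $P\ge 2$, $M\ge 1$, reals $r\in(0,1]$, $\beta>0$, $\theta\in(0,1]$, and numbers $K=K_N$ of archetypes with $K_N/N^{P-1}\to\alpha=\frac{2}{P!}\gamma$ as $N\to\infty$. Put $\beta'=2\beta/P!$, $\rho=\frac{1-r^2}{Mr^2}$, $\mathcal R=r^2+\frac{1-r^2}{M}$. The archetype $\xi=\xi^1\in\{\pm1\}^N$ has i.i.d. uniform entries; given $\xi$, its $M$ examples $\eta^a=\eta^{1,a}$ have independent entries with $\mathbb P(\eta_i^a=\pm\xi_i)=\frac{1\pm r}{2}$; the $\lambda_{i_1\dots i_P}$ ($i_1<\dots<i_P$) are i.i.d. standard Gaussian. For $\sigma\in\{\pm1\}^N$ let $$m_1=\frac1N\sum_i\xi_i\sigma_i,\qquad n_1=\frac{r}{\mathcal R}\frac1{NM}\sum_{i,a}\eta_i^a\sigma_i,\qquad q_{12}=\frac1N\sum_i\sigma_i^{(1)}\sigma_i^{(2)} .$$ The supervised dense associative memory (after the couplings due to the other archetypes have been replaced by Gaussian ones of matching variance) has, in the field $J$, the partition function $$\mathcal Z_N(J)=\sum_\sigma\exp\Big[J\sum_i\xi_i\sigma_i+\tfrac{\beta'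 N}{2}(1+\rho)^{P/2}n_1^P+\tfrac{\beta' P!\sqrt K}{2N^{P-1}}\sum_{i_1<\dots<i_P}\lambda_{i_1\dots i_P}\sigma_{i_1}\cdots\sigma_{i_P}\Big],$$ and the quenched free energy $-\beta'\mathcal F_N(J)=\frac1N\mathbb E_0\ln\mathcal Z_N(J)$, $\mathcal F(J)=\lim_N\mathcal F_N(J)$, where $\mathbb E_0$ averages over $\xi,\eta,\lambda$. **1RSB assumptions at $J$ with values $\bar n,\bar q_1,\bar q_2$.** Let $Y^{(1)},Y^{(2)}$ be independent standard Gaussian vectors in $\mathbb R^N$ and, for $t\in[0,1]$, let $\mathcal Z_2=\sum_\sigma\mathcal B_2(\sigma)$ be the partition function with exponent $$J\sum_i\xi_i\sigma_i+t\tfrac{\beta' N}{2}(1+\rho)^{P/2}n_1^P+\psi(1-t)Nn_1+\sqrt t\,\tfrac{\beta' P!\sqrt K}{2N^{P-1}}\sum_{i_1<\dots<i_P}\lambda_{i_1\dots i_P}\sigma_{i_1}\cdots\sigma_{i_P}+\sqrt{1-t}\sum_{b=1,2}A_b\sum_iY_i^{(b)}\sigma_i,$$ where $\psi=\beta'\frac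 P2(1+\rho)^{P/2}\bar n^{P-1}$, $A_1=\beta'\sqrt{\frac{KP!}{2N^{P-1}}\frac P2\bar q_1^{P-1}}$, $A_2=\beta'\sqrt{\frac{KP!}{2N^{P-1}}\frac P2(\bar q_2^{P-1}-\bar q_1^{P-1})}$. Let $\omega_t$ be the corresponding Gibbs average (applied to $q_{12}$: the average over two independent replicas), $\mathcal W=\mathcal Z_2^\theta/\mathbb E_{Y^{(2)}}\mathcal Z_2^\theta$, and $$\langle\cdot\rangle_t=\mathbb E_0\mathbb E_{Y^{(1)}}\mathbb E_{Y^{(2)}}\mathcal W\omega_t(\cdot),\quad \langle\cdot\rangle_{t,1}=\mathbb E_0\mathbb E_{Y^{(1)}}\big[\mathbb E_{Y^{(2)}}\mathcal W\omega_t\big]^{\otimes2}(\cdot),\quad \langle\cdot\rangle_{t,2}=\mathbb E_0\mathbb E_{Y^{(1)}}\mathbb E_{Y^{(2)}}\mathcal W\,\omega_t^{\otimes 2}(\cdot).$$ The assumptions are: (i) in the model in the field $J$ the law of $q_{12}$ converges weakly to $\theta\delta_{\bar q_1}+(1-\theta)\delta_{\bar q_2}$; (ii) for every $t\in[0,1]$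 the law of $n_1$ under $\langle\cdot\rangle_t$ converges weakly to $\delta_{\bar n}$; (iii) $\langle(q_{12}-\bar q_a)^k\rangle_{t,a}\to0$ for $a=1,2$, every $k\ge2$ and every $t\in[0,1)$. **Notation.** With one-site variables $\xi$, $\eta=(\eta^1,\dots,\eta^M)$ of the above law and standard Gaussian $Y^{(1)},Y^{(2)}$, let $\hat\eta_M=\frac1{rM}\sum_a\eta^a$, $$g_J=J\xi+\beta'\tfrac P2\bar n^{P-1}(1+\rho)^{P/2-1}\hat\eta_M+Y^{(1)}\beta'\sqrt{\gamma\tfrac P2\bar q_1^{P-1}}+Y^{(2)}\beta'\sqrt{\gamma\tfrac P2(\bar q_2^{P-1}-\bar q_1^{P-1})},\qquad T_k=\frac{\mathbb E_{Y^{(2)}}\cosh^\theta g_J\tanh^k g_J}{\mathbb E_{Y^{(2)}}\cosh^\theta g_J},$$ and let $\mathbb E_1=\mathbb E_\xi\mathbb E_{\eta|\xi}\mathbb E_{Y^{(1)}}$. Consider $$\begin{aligned}(\mathrm F)\quad-\beta'\mathcal F(J)=&\ln2+\tfrac1\theta\mathbb E_1\ln\mathbb E_{Y^{(2)}}\cosh^\theta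 g_J+\tfrac{\beta'^2}{4}\gamma\big[1-P\bar q_2^{P-1}+(P-1)\bar q_2^P\big]\\&-\tfrac{\beta'}2(P-1)(1+\rho)^{P/2}\bar n^P-\tfrac{\beta'^2}4\gamma(P-1)\theta(\bar q_2^P-\bar q_1^P),\end{aligned}$$ $$(\mathrm S)\quad\bar n=\tfrac1{1+\rho}\mathbb E_1[T_1\hat\eta_M],\qquad\bar q_1=\mathbb E_1[T_1^2],\qquad\bar q_2=\mathbb E_1[T_2],\qquad\qquad(\mathrm M)\quad\bar m=\mathbb E_1[T_1\xi].$$ **Proposition.** 1. If the 1RSB assumptions hold at $J\in\mathbb R$ with values $\bar n,\bar q_1,\bar q_2$, then $\lim_N\mathcal F_N(J)$ exists and (F) and (S) hold. 2. If they hold at all $J'$ near $J$, with values $\bar n(J'),\bar q_1(J'),\bar q_2(J')$ that are differentiable at $J$, then $-\beta'\mathcal F$ is differentiable at $J$, and its derivative and the limit of the mean Mattis magnetization $\mathbb E_0\langle m_1\rangle$ as $N\to\infty$ both equal $\bar m$ given by (M). 3. If they hold for all sufficiently small $J>0$, with values converging to $\bar n,\bar q_1,\bar q_2$ as $J\downarrow0$,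 then $\lim_N\mathcal F_N(0)$ exists, and (F) and (S) hold at $J=0$ with these limits (so with $g=g_0$). If the values are moreover differentiable in $J$ for all sufficiently small $J>0$, then the right derivative of $-\beta'\mathcal F$ at $J=0$ and $\lim_{J\downarrow0}\lim_{N}\mathbb E_0\langle m_1\rangle$ both equal $\bar m$ given by (M) at $J=0$. -/

import Mathlib

open MeasureTheory ProbabilityTheory Filter Topology
open scoped BoundedContinuousFunction

noncomputable section

namespace SupDAM

/-- The value `±1` of a binary variable. -/
def spin (b : Bool) : ℝ := if b then 1 else -1

/-- The probability that an example entry equals `y` given that the archetype entry is `x`. -/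
def flipProb (r : ℝ) (x y : Bool) : ℝ := if y = x then (1 + r) / 2 else (1 - r) / 2

/-- The law of a family of i.i.d. standard Gaussian variables indexed by `ι`. -/
def stdGaussian (ι : Type) [Fintype ι] : Measure (ι → ℝ) :=
  Measure.pi fun _ => gaussianReal 0 1

/-- Control parameters: interaction order `P`, number `M` of examples per archetype, dataset
quality `r`, inverse noise `β`, and the number `K N` of archetypes at network size `N`. -/
structure Model where
  P : ℕ
  M : ℕ
  r : ℝ
  β : ℝ
  K : ℕ → ℕ

/-- The `P`-node interactions among `N` neurons: index sets `i₁ < ⋯ < i_P`. -/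
abbrev Inter (P N : ℕ) : Type := {s : Finset (Fin N) // s.card = P}

/-- The two-replica overlap `q₁₂`. -/
def overlap {N : ℕ} (σ τ : Fin N → Bool) : ℝ :=
  (1 / (N : ℝ)) * ∑ i, spin (σ i) * spin (τ i)

/-- The Mattis magnetization `m₁` of the archetype `ξ`. -/
def mattis {N : ℕ} (ξ σ : Fin N → Bool) : ℝ :=
  (1 / (N : ℝ)) * ∑ i, spin (ξ i) * spin (σ i)

namespace Model

variable (D : Model)

/-- `β' = 2β / P!`. -/
def β' : ℝ := 2 * D.β / (D.P.factorial : ℝ)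

/-- The dataset entropy. -/
def ρ : ℝ := (1 - D.r ^ 2) / ((D.M : ℝ) * D.r ^ 2)

/-- `R = r² + (1 - r²) / M`. -/
def R : ℝ := D.r ^ 2 + (1 - D.r ^ 2) / (D.M : ℝ)

/-- The magnetization `n₁` of the class of examples `η i a` of the first archetype. -/
def classMag {N : ℕ} (η : Fin N → Fin D.M → Bool) (σ : Fin N → Bool) : ℝ :=
  (D.r / D.R) * (1 / ((N : ℝ) * (D.M : ℝ))) * ∑ i, ∑ a, spin (η i a) * spin (σ i)

/-- The signal term `β' (N / 2) (1 + ρ)^(P/2) n₁^P` of the exponent. -/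
def signal {N : ℕ} (η : Fin N → Fin D.M → Bool) (σ : Fin N → Bool) : ℝ :=
  D.β' * ((N : ℝ) / 2) * (1 + D.ρ) ^ ((D.P : ℝ) / 2) * D.classMag η σ ^ D.P

/-- The noise term `β' P! √K / (2 N^(P-1)) ∑_{i₁ < ⋯ < i_P} l_{i₁…i_P} σ_{i₁} ⋯ σ_{i_P}`. -/
def noise {N : ℕ} (l : Inter D.P N → ℝ) (σ : Fin N → Bool) : ℝ :=
  D.β' * (D.P.factorial : ℝ) * √(D.K N : ℝ) / (2 * (N : ℝ) ^ (D.P - 1)) *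
    ∑ s, l s * ∏ i ∈ s.1, spin (σ i)

/-- The average `𝔼₀` over the quenched disorder: the archetype `ξ`, its examples `η` and the
Gaussian couplings `l`. -/
def E₀ (N : ℕ)
    (f : (Fin N → Bool) → (Fin N → Fin D.M → Bool) → (Inter D.P N → ℝ) → ℝ) : ℝ :=
  ∑ ξ : Fin N → Bool, ∑ η : Fin N → Fin D.M → Bool,
    (∏ i, (1 / 2) * ∏ a, flipProb D.r (ξ i) (η i a)) * ∫ l, f ξ η l ∂stdGaussian (Inter D.P N)

/-! ### The model -/

/-- The Boltzmann factor of the supervised model with field `J`. -/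
def boltz {N : ℕ} (J : ℝ) (ξ : Fin N → Bool) (η : Fin N → Fin D.M → Bool)
    (l : Inter D.P N → ℝ) (σ : Fin N → Bool) : ℝ :=
  Real.exp (J * ∑ i, spin (ξ i) * spin (σ i) + D.signal η σ + D.noise l σ)

/-- The partition function of the supervised model. -/
def Z {N : ℕ} (J : ℝ) (ξ : Fin N → Bool) (η : Fin N → Fin D.M → Bool)
    (l : Inter D.P N → ℝ) : ℝ :=
  ∑ σ : Fin N → Bool, D.boltz J ξ η l σ

/-- The quenched free energy at size `N`, so that `-β' F_N = (1/N) 𝔼₀ log Z`. -/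
def freeEnergyN (N : ℕ) (J : ℝ) : ℝ :=
  -(1 / D.β') * ((1 / (N : ℝ)) * D.E₀ N fun ξ η l => Real.log (D.Z J ξ η l))

/-- The quenched free energy in the thermodynamic limit. -/
def freeEnergy (J : ℝ) : ℝ := limUnder atTop fun N => D.freeEnergyN N J

/-- The mean Mattis magnetization at size `N`. -/
def meanMattis (N : ℕ) (J : ℝ) : ℝ :=
  D.E₀ N fun ξ η l => (∑ σ, mattis ξ σ * D.boltz J ξ η l σ) / D.Z J ξ η l

/-- The mean Mattis magnetization in the thermodynamic limit. -/
def magnetization (J : ℝ) : ℝ := limUnder atTop fun N => D.meanMattis N J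

/-- The mean of `φ q₁₂`, for two replicas that share the disorder. -/
def meanOverlap (N : ℕ) (J : ℝ) (φ : ℝ → ℝ) : ℝ :=
  D.E₀ N fun ξ η l =>
    (∑ σ, ∑ τ, φ (overlap σ τ) * (D.boltz J ξ η l σ * D.boltz J ξ η l τ)) / D.Z J ξ η l ^ 2

/-! ### Guerra's interpolation

`n, q₁, q₂` are the values at which the constants of the one-body model are set. -/

/-- The constant `ψ`. -/
def ψ (n : ℝ) : ℝ := D.β' * ((D.P : ℝ) / 2) * (1 + D.ρ) ^ ((D.P : ℝ) / 2) * n ^ (D.P - 1)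

/-- The load `K P! / (2 N^(P-1))` at size `N`; it converges to `γ`. -/
def loadN (N : ℕ) : ℝ :=
  (D.K N : ℝ) * (D.P.factorial : ℝ) / (2 * (N : ℝ) ^ (D.P - 1))

/-- The constant `A₁`. -/
def A₁ (N : ℕ) (q₁ : ℝ) : ℝ := D.β' * √(D.loadN N * ((D.P : ℝ) / 2) * q₁ ^ (D.P - 1))

/-- The constant `A₂`. -/
def A₂ (N : ℕ) (q₁ q₂ : ℝ) : ℝ :=
  D.β' * √(D.loadN N * ((D.P : ℝ) / 2) * (q₂ ^ (D.P - 1) - q₁ ^ (D.P - 1)))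

/-- The generalised Boltzmann factor at interpolation time `t`. -/
def boltz₂ {N : ℕ} (n q₁ q₂ J t : ℝ) (ξ : Fin N → Bool) (η : Fin N → Fin D.M → Bool)
    (l : Inter D.P N → ℝ) (y₁ y₂ : Fin N → ℝ) (σ : Fin N → Bool) : ℝ :=
  Real.exp (J * ∑ i, spin (ξ i) * spin (σ i) + t * D.signal η σ
    + D.ψ n * (1 - t) * (N : ℝ) * D.classMag η σ + √t * D.noise l σ
    + √(1 - t) * (D.A₁ N q₁ * ∑ i, y₁ i * spin (σ i) + D.A₂ N q₁ q₂ * ∑ i, y₂ i * spin (σ i)))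

/-- The interpolating partition function. -/
def Z₂ {N : ℕ} (n q₁ q₂ J t : ℝ) (ξ : Fin N → Bool) (η : Fin N → Fin D.M → Bool)
    (l : Inter D.P N → ℝ) (y₁ y₂ : Fin N → ℝ) : ℝ :=
  ∑ σ : Fin N → Bool, D.boltz₂ n q₁ q₂ J t ξ η l y₁ y₂ σ

/-- The weight `W₂ = Z₂^θ / 𝔼_{Y₂} Z₂^θ`. -/
def W₂ {N : ℕ} (θ n q₁ q₂ J t : ℝ) (ξ : Fin N → Bool) (η : Fin N → Fin D.M → Bool)
    (l : Inter D.P N → ℝ) (y₁ y₂ : Fin N → ℝ) : ℝ :=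
  D.Z₂ n q₁ q₂ J t ξ η l y₁ y₂ ^ θ /
    ∫ y, D.Z₂ n q₁ q₂ J t ξ η l y₁ y ^ θ ∂stdGaussian (Fin N)

/-- The Gibbs probability of `σ` at interpolation time `t`. -/
def gibbs {N : ℕ} (n q₁ q₂ J t : ℝ) (ξ : Fin N → Bool) (η : Fin N → Fin D.M → Bool)
    (l : Inter D.P N → ℝ) (y₁ y₂ : Fin N → ℝ) (σ : Fin N → Bool) : ℝ :=
  D.boltz₂ n q₁ q₂ J t ξ η l y₁ y₂ σ / D.Z₂ n q₁ q₂ J t ξ η l y₁ y₂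

/-- The average `⟨φ n₁⟩_t = 𝔼₀ 𝔼_{Y₁} 𝔼_{Y₂} W₂ ω_t(φ n₁)`. -/
def avgClassMag (N : ℕ) (θ n q₁ q₂ J t : ℝ) (φ : ℝ → ℝ) : ℝ :=
  D.E₀ N fun ξ η l =>
    ∫ y₁, ∫ y₂, D.W₂ θ n q₁ q₂ J t ξ η l y₁ y₂ *
        ∑ σ, φ (D.classMag η σ) * D.gibbs n q₁ q₂ J t ξ η l y₁ y₂ σ
      ∂stdGaussian (Fin N) ∂stdGaussian (Fin N)

/-- The first-level two-replica average
`⟨φ q₁₂⟩_{t,1} = 𝔼₀ 𝔼_{Y₁} [𝔼_{Y₂} W₂ ω_t]^{⊗2}(φ q₁₂)`. -/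
def avgOverlap₁ (N : ℕ) (θ n q₁ q₂ J t : ℝ) (φ : ℝ → ℝ) : ℝ :=
  D.E₀ N fun ξ η l =>
    ∫ y₁, ∑ σ, ∑ τ, φ (overlap σ τ) *
        ((∫ y₂, D.W₂ θ n q₁ q₂ J t ξ η l y₁ y₂ * D.gibbs n q₁ q₂ J t ξ η l y₁ y₂ σ
            ∂stdGaussian (Fin N)) *
          ∫ y₂, D.W₂ θ n q₁ q₂ J t ξ η l y₁ y₂ * D.gibbs n q₁ q₂ J t ξ η l y₁ y₂ τ
            ∂stdGaussian (Fin N))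
      ∂stdGaussian (Fin N)

/-- The second-level two-replica average
`⟨φ q₁₂⟩_{t,2} = 𝔼₀ 𝔼_{Y₁} 𝔼_{Y₂} W₂ ω_t^{⊗2}(φ q₁₂)`. -/
def avgOverlap₂ (N : ℕ) (θ n q₁ q₂ J t : ℝ) (φ : ℝ → ℝ) : ℝ :=
  D.E₀ N fun ξ η l =>
    ∫ y₁, ∫ y₂, D.W₂ θ n q₁ q₂ J t ξ η l y₁ y₂ *
        ∑ σ, ∑ τ, φ (overlap σ τ) *
          (D.gibbs n q₁ q₂ J t ξ η l y₁ y₂ σ * D.gibbs n q₁ q₂ J t ξ η l y₁ y₂ τ)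
      ∂stdGaussian (Fin N) ∂stdGaussian (Fin N)

/-- The 1RSB assumptions at field `J`, with equilibrium values `n, q₁, q₂`.
In `overlap_level₁` and `overlap_level₂` the time `t = 1` is left out: there the two averages
coincide, and the two conditions would force `q₁ = q₂`. -/
structure OneRSB (θ J n q₁ q₂ : ℝ) : Prop where
  /-- The overlap law converges to `θ δ_{q₁} + (1 - θ) δ_{q₂}`. -/
  overlap_law : ∀ φ : ℝ →ᵇ ℝ,
    Tendsto (fun N => D.meanOverlap N J φ) atTop (𝓝 (θ * φ q₁ + (1 - θ) * φ q₂))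
  /-- The law of `n₁` converges to `δ_n`. -/
  classMag_law : ∀ t ∈ Set.Icc (0 : ℝ) 1, ∀ φ : ℝ →ᵇ ℝ,
    Tendsto (fun N => D.avgClassMag N θ n q₁ q₂ J t φ) atTop (𝓝 (φ n))
  /-- The overlap self-averages at `q₁` at the first level. -/
  overlap_level₁ : ∀ t ∈ Set.Ico (0 : ℝ) 1, ∀ k : ℕ, 2 ≤ k →
    Tendsto (fun N => D.avgOverlap₁ N θ n q₁ q₂ J t fun q => (q - q₁) ^ k) atTop (𝓝 0)
  /-- The overlap self-averages at `q₂` at the second level. -/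
  overlap_level₂ : ∀ t ∈ Set.Ico (0 : ℝ) 1, ∀ k : ℕ, 2 ≤ k →
    Tendsto (fun N => D.avgOverlap₂ N θ n q₁ q₂ J t fun q => (q - q₂) ^ k) atTop (𝓝 0)

/-! ### The one-site expressions -/

/-- The average `𝔼_ξ 𝔼_{η|ξ} 𝔼_{Y₁}` at one site. -/
def E₁ (f : Bool → (Fin D.M → Bool) → ℝ → ℝ) : ℝ :=
  ∑ ξ : Bool, ∑ η : Fin D.M → Bool,
    (1 / 2) * (∏ a, flipProb D.r ξ (η a)) * ∫ y₁, f ξ η y₁ ∂gaussianReal 0 1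

/-- The average `η̂_M = (r M)⁻¹ ∑ₐ η^a` of the examples at one site. -/
def etaHat (η : Fin D.M → Bool) : ℝ := (1 / (D.r * (D.M : ℝ))) * ∑ a, spin (η a)

/-- The effective field `J ξ + g(β, γ, Y, η)`. -/
def g (γ J n q₁ q₂ : ℝ) (ξ : Bool) (η : Fin D.M → Bool) (y₁ y₂ : ℝ) : ℝ :=
  J * spin ξ
    + D.β' * ((D.P : ℝ) / 2) * n ^ (D.P - 1) * (1 + D.ρ) ^ ((D.P : ℝ) / 2 - 1) * D.etaHat η
    + y₁ * (D.β' * √(γ * ((D.P : ℝ) / 2) * q₁ ^ (D.P - 1)))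
    + y₂ * (D.β' * √(γ * ((D.P : ℝ) / 2) * (q₂ ^ (D.P - 1) - q₁ ^ (D.P - 1))))

/-- `𝔼_{Y₂} cosh^θ g`. -/
def coshAvg (θ γ J n q₁ q₂ : ℝ) (ξ : Bool) (η : Fin D.M → Bool) (y₁ : ℝ) : ℝ :=
  ∫ y₂, Real.cosh (D.g γ J n q₁ q₂ ξ η y₁ y₂) ^ θ ∂gaussianReal 0 1

/-- `𝔼_{Y₂} [cosh^θ g · tanh^k g] / 𝔼_{Y₂} [cosh^θ g]`. -/
def tanhAvg (k : ℕ) (θ γ J n q₁ q₂ : ℝ) (ξ : Bool) (η : Fin D.M → Bool) (y₁ : ℝ) : ℝ :=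
  (∫ y₂, Real.cosh (D.g γ J n q₁ q₂ ξ η y₁ y₂) ^ θ *
      Real.tanh (D.g γ J n q₁ q₂ ξ η y₁ y₂) ^ k ∂gaussianReal 0 1) /
    D.coshAvg θ γ J n q₁ q₂ ξ η y₁

/-- The 1RSB expression for `-β' F`. -/
def pressure (θ γ J n q₁ q₂ : ℝ) : ℝ :=
  Real.log 2 + (1 / θ) * D.E₁ (fun ξ η y₁ => Real.log (D.coshAvg θ γ J n q₁ q₂ ξ η y₁))
    + D.β' ^ 2 / 4 * γ * (1 - (D.P : ℝ) * q₂ ^ (D.P - 1) + ((D.P : ℝ) - 1) * q₂ ^ D.P)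
    - D.β' / 2 * ((D.P : ℝ) - 1) * (1 + D.ρ) ^ ((D.P : ℝ) / 2) * n ^ D.P
    - D.β' ^ 2 / 4 * γ * ((D.P : ℝ) - 1) * θ * (q₂ ^ D.P - q₁ ^ D.P)

/-- The self-consistency equations. -/
structure SelfConsistent (θ γ J n q₁ q₂ : ℝ) : Prop where
  n_eq : n = 1 / (1 + D.ρ) *
    D.E₁ fun ξ η y₁ => D.tanhAvg 1 θ γ J n q₁ q₂ ξ η y₁ * D.etaHat η
  q₁_eq : q₁ = D.E₁ fun ξ η y₁ => D.tanhAvg 1 θ γ J n q₁ q₂ ξ η y₁ ^ 2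
  q₂_eq : q₂ = D.E₁ fun ξ η y₁ => D.tanhAvg 2 θ γ J n q₁ q₂ ξ η y₁

/-- The expression for the Mattis magnetization `m̄`. -/
def mBar (θ γ J n q₁ q₂ : ℝ) : ℝ :=
  D.E₁ fun ξ η y₁ => D.tanhAvg 1 θ γ J n q₁ q₂ ξ η y₁ * spin ξ

end Model

end SupDAM

end

/-!
Why the theorem holds.

*Interpolation.* Guerra's path joins the original model (`t = 1`) to a model of independent sites
(`t = 0`). For a finite set of configurations and energies that are affine in two layers of Gaussian
variables, `hasDerivAt_press` computes the derivative of `𝔼_x log 𝔼_y Z^θ` along a path of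
coefficients: Gaussian integration by parts turns every Gaussian variable into a covariance between
two replicas, which share the first layer only (weight `θ`) or both layers (weight `1 - θ`). Along
Guerra's path the covariances are functions of the overlap, up to the error
`abs_multiOverlap_sub_le`, so the derivative `Model.guerraDeriv` consists of averages of
`n₁^P - P n^(P-1) n₁` and of `q₁₂^P - P qₐ^(P-1) q₁₂`.

*Self-consistency and free energy.* At `t = 0` the averages factorise over the sites into one-site
expressions, and by hypothesis they converge to `n, q₁, q₂`. This gives the self-consistency
equations (`Model.OneRSB.selfConsistent`). They imply `0 ≤ q₁ ≤ q₂`, so that the square roots in the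
amplitudes of the one-body fields are honest and the interpolation applies. By self-averaging the
derivative converges, boundedly, to a constant for every `t` in `(0, 1)`. Integrating over `t` gives
the free energy (`Model.OneRSB.tendsto_freeEnergyN`).

*Magnetization.* The pressure is stationary in `(n, q₁, q₂)` at solutions of the self-consistency
equations, so only its explicit dependence on `J` contributes to its derivative
(`Model.hasDerivAt_pressure`). The amplitudes may vanish, where square roots are not differentiable,
but the one-site free energy is differentiable in the variances (`hasDerivAt_sitePress_sqrt`).
At every size the free energy is convex in `J`, with the mean magnetization as a subgradient;
subgradients of a convergent sequence of convex functions converge to the derivative of the limit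
where that exists (`tendsto_subgradient`).

*Vanishing field.* The free energies are `1`-Lipschitz in `J` uniformly in `N`, so the limit at
`J = 0` is the limit of the limits as `J ↓ 0`. All one-site expressions are continuous in the order
parameters, and the right derivative at `0` is the limit of the derivatives.
-/

noncomputable section

set_option linter.unusedSectionVars false

namespace SupDAM

/-! ### Gaussian integration -/

instance (ι : Type) [Fintype ι] : IsProbabilityMeasure (stdGaussian ι) := by
  unfold stdGaussian; infer_instance

lemma integrable_exp_abs_gaussianReal (c : ℝ) :
    Integrable (fun x : ℝ => Real.exp (c * |x|)) (gaussianReal 0 1) := by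
  refine ((integrable_exp_mul_gaussianReal c).add (integrable_exp_mul_gaussianReal (-c))).mono'
    (by fun_prop) (ae_of_all _ fun x => ?_)
  rw [Real.norm_of_nonneg (Real.exp_pos _).le, Pi.add_apply]
  rcases abs_cases x with ⟨h, -⟩ | ⟨h, -⟩ <;> rw [h]
  · linarith [Real.exp_pos (-c * x)]
  · rw [show c * -x = -c * x by ring]; linarith [Real.exp_pos (c * x)]

section

variable {ι : Type} [Fintype ι]

lemma integrable_exp_sum_abs (c : ℝ) :
    Integrable (fun x : ι → ℝ => Real.exp (c * ∑ i, |x i|)) (stdGaussian ι) := by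
  have := Integrable.fintype_prod (ι := ι) (E := ℝ) (μ := fun _ => gaussianReal 0 1)
    (f := fun _ x => Real.exp (c * |x|)) (fun _ => integrable_exp_abs_gaussianReal c)
  refine this.congr (ae_of_all _ fun x => ?_)
  simp only [← Real.exp_sum, Finset.mul_sum]

/-- Continuous functions of at most exponential growth are integrable for the standard Gaussian law.
-/
lemma integrable_of_exp_bound {f : (ι → ℝ) → ℝ} (hf : Continuous f) (A c : ℝ)
    (h : ∀ x, |f x| ≤ A * Real.exp (c * ∑ i, |x i|)) : Integrable f (stdGaussian ι) :=
  ((integrable_exp_sum_abs c).const_mul A).mono' hf.aestronglyMeasurable (ae_of_all _ h)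

lemma integrable_of_bound {f : (ι → ℝ) → ℝ} (hf : Continuous f) (A : ℝ)
    (h : ∀ x, |f x| ≤ A) : Integrable f (stdGaussian ι) :=
  (integrable_const A).mono' hf.aestronglyMeasurable (ae_of_all _ h)

lemma sum_abs_nonneg (x : ι → ℝ) : 0 ≤ ∑ i, |x i| := Finset.sum_nonneg fun _ _ => abs_nonneg _

lemma abs_coord_le_sum (x : ι → ℝ) (i : ι) : |x i| ≤ ∑ i, |x i| :=
  Finset.single_le_sum (f := fun i => |x i|) (fun _ _ => abs_nonneg _) (Finset.mem_univ i)

/-- Resampling one coordinate of a standard Gaussian vector does not change its law. -/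
lemma measurePreserving_update [DecidableEq ι] (i : ι) :
    MeasurePreserving (fun p : (ι → ℝ) × ℝ => Function.update p.1 i p.2)
      ((stdGaussian ι).prod (gaussianReal 0 1)) (stdGaussian ι) := by
  have hm : Measurable (fun p : (ι → ℝ) × ℝ => Function.update p.1 i p.2) := by
    refine measurable_pi_iff.2 fun j => ?_
    by_cases h : j = i
    · subst h; simpa using measurable_snd
    · simp only [Function.update_of_ne h]
      exact (measurable_pi_apply j).comp measurable_fst
  refine ⟨hm, ?_⟩
  symm
  refine Measure.pi_eq fun s hs => ?_
  rw [Measure.map_apply hm (MeasurableSet.univ_pi hs)]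
  have : (fun p : (ι → ℝ) × ℝ => Function.update p.1 i p.2) ⁻¹' Set.univ.pi s
      = (Set.univ.pi (Function.update s i Set.univ)) ×ˢ (s i) := by
    ext ⟨x, t⟩
    simp only [Set.mem_preimage, Set.mem_pi, Set.mem_univ, true_implies, Set.mem_prod]
    constructor
    · intro h
      refine ⟨fun j => ?_, by simpa using h i⟩
      by_cases hj : j = i
      · subst hj; simp
      · simpa [Function.update_of_ne hj] using h j
    · rintro ⟨h, h'⟩ j
      by_cases hj : j = i
      · subst hj; simpa using h'
      · simpa [Function.update_of_ne hj] using h j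
  rw [this, Measure.prod_prod, stdGaussian, Measure.pi_pi,
    ← Finset.mul_prod_erase _ _ (Finset.mem_univ i),
    ← Finset.mul_prod_erase (a := i) _ (fun j => gaussianReal 0 1 (s j)) (Finset.mem_univ i)]
  simp only [Function.update_self, measure_univ, one_mul]
  rw [mul_comm]
  congr 1
  refine Finset.prod_congr rfl fun j hj => ?_
  rw [Function.update_of_ne (Finset.ne_of_mem_erase hj)]

lemma integrable_gaussianReal_iff {f : ℝ → ℝ} :
    Integrable f (gaussianReal 0 1) ↔ Integrable fun x => gaussianPDFReal 0 1 x * f x := by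
  rw [gaussianReal_of_var_ne_zero 0 one_ne_zero,
    integrable_withDensity_iff_integrable_smul' (measurable_gaussianPDF _ _)
      (ae_of_all _ fun x => gaussianPDF_lt_top)]
  simp only [toReal_gaussianPDF, smul_eq_mul]

/-- Stein's identity for a standard Gaussian variable. -/
lemma integral_id_mul_gaussianReal {f f' : ℝ → ℝ} (hf : ∀ s, HasDerivAt f (f' s) s)
    (h0 : Integrable f (gaussianReal 0 1)) (h1 : Integrable (fun s => s * f s) (gaussianReal 0 1))
    (h2 : Integrable f' (gaussianReal 0 1)) :
    ∫ s, s * f s ∂gaussianReal 0 1 = ∫ s, f' s ∂gaussianReal 0 1 := by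
  have hg : ∀ s, HasDerivAt (gaussianPDFReal 0 1) (-(s * gaussianPDFReal 0 1 s)) s := by
    intro s
    have h : HasDerivAt (fun x : ℝ => (√(2 * Real.pi * ((1 : NNReal) : ℝ)))⁻¹ *
        Real.exp (-(x - 0) ^ 2 / (2 * ((1 : NNReal) : ℝ)))) _ s :=
      ((((((hasDerivAt_id s).sub_const 0).pow 2).neg).div_const _).exp).const_mul _
    rw [gaussianPDFReal_def]
    convert h using 1
    simp
    ring
  have h := integral_mul_deriv_eq_deriv_mul_of_integrable (u := f) (u' := f')
    (v := gaussianPDFReal 0 1) (v' := fun s => -(s * gaussianPDFReal 0 1 s))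
    (fun x _ => hf x) (fun x _ => hg x)
    (by
      refine ((integrable_gaussianReal_iff.1 h1).neg).congr (ae_of_all _ fun s => ?_)
      simp only [Pi.neg_apply, Pi.mul_apply]; ring)
    (by
      refine (integrable_gaussianReal_iff.1 h2).congr (ae_of_all _ fun s => ?_)
      simp only [Pi.mul_apply]; ring)
    (by
      refine (integrable_gaussianReal_iff.1 h0).congr (ae_of_all _ fun s => ?_)
      simp only [Pi.mul_apply]; ring)
  rw [integral_gaussianReal_eq_integral_smul one_ne_zero,
    integral_gaussianReal_eq_integral_smul one_ne_zero]
  simp only [smul_eq_mul]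
  rw [← neg_inj, ← integral_neg]
  calc _ = ∫ s, f s * -(s * gaussianPDFReal 0 1 s) := by congr 1; ext s; ring
    _ = _ := h
    _ = _ := by congr 2; ext s; ring

/-- Gaussian integration by parts in one coordinate of a standard Gaussian vector; the partial
derivative is the derivative along `Function.update`. -/
lemma integral_coord_mul [DecidableEq ι] (i : ι) {f f' : (ι → ℝ) → ℝ}
    (hf : ∀ x s, HasDerivAt (fun s => f (Function.update x i s)) (f' (Function.update x i s)) s)
    (h0 : Integrable f (stdGaussian ι)) (h1 : Integrable (fun x => x i * f x) (stdGaussian ι))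
    (h2 : Integrable f' (stdGaussian ι)) :
    ∫ x, x i * f x ∂stdGaussian ι = ∫ x, f' x ∂stdGaussian ι := by
  have mp := measurePreserving_update (ι := ι) i
  have key : ∀ F : (ι → ℝ) → ℝ, Integrable F (stdGaussian ι) →
      Integrable (fun p : (ι → ℝ) × ℝ => F (Function.update p.1 i p.2))
        ((stdGaussian ι).prod (gaussianReal 0 1)) ∧
      ∫ x, F x ∂stdGaussian ι =
        ∫ x, ∫ s, F (Function.update x i s) ∂gaussianReal 0 1 ∂stdGaussian ι := by
    intro F hF
    have hi := mp.integrable_comp_of_integrable hF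
    refine ⟨hi, ?_⟩
    have h := integral_prod _ hi
    simp only [Function.comp_apply] at h
    rw [← h]
    conv_lhs => rw [← mp.map_eq]
    refine integral_map mp.measurable.aemeasurable ?_
    rw [mp.map_eq]
    exact hF.aestronglyMeasurable
  rw [(key _ h1).2, (key _ h2).2]
  refine integral_congr_ae ?_
  filter_upwards [(key _ h0).1.prod_right_ae, (key _ h1).1.prod_right_ae,
    (key _ h2).1.prod_right_ae] with x hx0 hx1 hx2
  simp only [Function.update_self] at hx1 ⊢
  exact integral_id_mul_gaussianReal (hf x) hx0 hx1 hx2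

end

/-- Integrating over a Gaussian vector indexed by a sum type, one block after the other. -/
lemma integral_stdGaussian_sum {ι κ : Type} [Fintype ι] [Fintype κ] {f : (ι ⊕ κ → ℝ) → ℝ}
    (hf : Integrable f (stdGaussian (ι ⊕ κ))) :
    ∫ x, f x ∂stdGaussian (ι ⊕ κ) =
      ∫ x, ∫ y, f (Sum.elim x y) ∂stdGaussian κ ∂stdGaussian ι := by
  have mp := (measurePreserving_sumPiEquivProdPi (X := fun _ : ι ⊕ κ => ℝ)
    (fun _ => gaussianReal 0 1)).symm
  have hi := mp.integrable_comp_of_integrable hf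
  have h := mp.integral_comp' (g := f)
  change _ = ∫ x, f x ∂stdGaussian (ι ⊕ κ) at h
  rw [← h]
  exact integral_prod _ hi

/-! ### Gibbs weights of a finite system -/

section

variable {S L : Type} [Fintype S] [Fintype L]

/-- The partition function of the energies `h` (inverse temperature and sign included in `h`). -/
def zf (h : S → ℝ) : ℝ := ∑ σ, Real.exp (h σ)

/-- The Gibbs probability of `σ` for the energies `h`. -/
def gib (h : S → ℝ) (σ : S) : ℝ := Real.exp (h σ) / zf h

/-- The energies `e σ + ∑ j, z σ j * y j` in the external field `y`. -/
def lin (e : S → ℝ) (z : S → L → ℝ) (y : L → ℝ) (σ : S) : ℝ := e σ + ∑ j, z σ j * y j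

/-- The unnormalised average `𝔼_y (Z^θ w)` over the Gaussian field `y` of the second level. -/
def level (θ : ℝ) (w : (S → ℝ) → ℝ) (e : S → ℝ) (z : S → L → ℝ) : ℝ :=
  ∫ y, zf (lin e z y) ^ θ * w (lin e z y) ∂stdGaussian L

/-- The average of `w` over the second-level field, tilted by the weight `Z^θ`. -/
def tilt (θ : ℝ) (w : (S → ℝ) → ℝ) (e : S → ℝ) (z : S → L → ℝ) : ℝ :=
  level θ w e z / level θ (fun _ => 1) e z

/-- Second-level tilted probability of the configuration `σ`. -/
def tiltOne (θ : ℝ) (e : S → ℝ) (z : S → L → ℝ) (σ : S) : ℝ := tilt θ (fun h => gib h σ) e z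

/-- Second-level tilted probability of two replicas `σ, τ` that share the second-level field. -/
def tiltTwo (θ : ℝ) (e : S → ℝ) (z : S → L → ℝ) (σ τ : S) : ℝ :=
  tilt θ (fun h => gib h σ * gib h τ) e z

/-- The bilinear form `∑ j, z' σ j * z τ j`, through which Gaussian integration by parts couples
two replicas. -/
def cov (z' z : S → L → ℝ) (σ τ : S) : ℝ := ∑ j, z' σ j * z τ j

section Gibbs

variable [Nonempty S]

lemma zf_pos (h : S → ℝ) : 0 < zf h :=
  Finset.sum_pos (fun _ _ => Real.exp_pos _) Finset.univ_nonempty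

lemma gib_nonneg (h : S → ℝ) (σ : S) : 0 ≤ gib h σ := (div_pos (Real.exp_pos _) (zf_pos h)).le

lemma sum_gib (h : S → ℝ) : ∑ σ, gib h σ = 1 := by
  unfold gib
  rw [← Finset.sum_div]
  exact div_self (zf_pos h).ne'

lemma gib_le_one (h : S → ℝ) (σ : S) : gib h σ ≤ 1 := by
  rw [← sum_gib h]
  exact Finset.single_le_sum (fun τ _ => gib_nonneg h τ) (Finset.mem_univ σ)

@[fun_prop]
lemma continuous_zf : Continuous (zf : (S → ℝ) → ℝ) := by unfold zf; fun_prop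

@[fun_prop]
lemma continuous_gib (σ : S) : Continuous fun h : S → ℝ => gib h σ := by
  unfold gib
  exact Continuous.div (by fun_prop) (by fun_prop) fun h => (zf_pos h).ne'

lemma zf_rpow_le {θ : ℝ} (hθ : 0 ≤ θ) {h : S → ℝ} {B : ℝ} (hB : ∀ σ, |h σ| ≤ B) :
    zf h ^ θ ≤ (Fintype.card S : ℝ) ^ θ * Real.exp (θ * B) := by
  have : zf h ≤ Fintype.card S * Real.exp B := by
    unfold zf
    refine (Finset.sum_le_card_nsmul _ _ (Real.exp B) fun σ _ =>
      Real.exp_le_exp.2 ((le_abs_self _).trans (hB σ))).trans ?_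
    simp
  calc zf h ^ θ ≤ (Fintype.card S * Real.exp B) ^ θ :=
        Real.rpow_le_rpow (zf_pos h).le this hθ
    _ = _ := by
        rw [Real.mul_rpow (by positivity) (Real.exp_pos _).le, ← Real.exp_mul, mul_comm B]

lemma hasDerivAt_zf_rpow (θ : ℝ) {h : ℝ → S → ℝ} {h' : S → ℝ} {t : ℝ} (hh : HasDerivAt h h' t) :
    HasDerivAt (fun t => zf (h t) ^ θ) (zf (h t) ^ θ * ∑ τ, θ * gib (h t) τ * h' τ) t := by
  have h1 : HasDerivAt (fun t => zf (h t)) (∑ τ, Real.exp (h t τ) * h' τ) t :=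
    HasDerivAt.fun_sum fun σ _ => ((hasDerivAt_pi.1 hh) σ).exp
  convert h1.rpow_const (p := θ) (Or.inl (zf_pos _).ne') using 1
  rw [Real.rpow_sub_one (zf_pos _).ne', Finset.mul_sum, Finset.sum_mul, Finset.sum_mul]
  refine Finset.sum_congr rfl fun σ _ => ?_
  unfold gib
  ring

lemma hasDerivAt_gib {h : ℝ → S → ℝ} {h' : S → ℝ} {t : ℝ} (hh : HasDerivAt h h' t) (σ : S) :
    HasDerivAt (fun t => gib (h t) σ)
      (gib (h t) σ * (h' σ - ∑ τ, gib (h t) τ * h' τ)) t := by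
  have h1 : HasDerivAt (fun t => zf (h t)) (∑ τ, Real.exp (h t τ) * h' τ) t :=
    HasDerivAt.fun_sum fun σ _ => ((hasDerivAt_pi.1 hh) σ).exp
  refine (((hasDerivAt_pi.1 hh) σ).exp.div h1 (zf_pos _).ne').congr_deriv ?_
  have : ∑ τ, gib (h t) τ * h' τ = (∑ τ, Real.exp (h t τ) * h' τ) / zf (h t) := by
    rw [Finset.sum_div]
    exact Finset.sum_congr rfl fun τ _ => by unfold gib; ring
  rw [this]
  unfold gib
  have := (zf_pos (h t)).ne'
  field_simp

end Gibbs

/-- `wt` is the gradient of `Z^θ w` divided by `Z^θ`, and both `w` and `wt` are continuous and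
bounded by `1`. -/
structure IsTilt (θ : ℝ) (w : (S → ℝ) → ℝ) (wt : S → (S → ℝ) → ℝ) : Prop where
  cont : Continuous w
  bound : ∀ h, |w h| ≤ 1
  cont' : ∀ τ, Continuous (wt τ)
  bound' : ∀ τ h, |wt τ h| ≤ 1
  deriv : ∀ (h : ℝ → S → ℝ) (h' : S → ℝ) (t : ℝ), HasDerivAt h h' t →
    HasDerivAt (fun t => zf (h t) ^ θ * w (h t)) (zf (h t) ^ θ * ∑ τ, wt τ (h t) * h' τ) t

section Tilt

variable [Nonempty S] {θ : ℝ}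

lemma isTilt_one (hθ : 0 ≤ θ) (hθ1 : θ ≤ 1) :
    IsTilt (S := S) θ (fun _ => 1) fun τ h => θ * gib h τ where
  cont := continuous_const
  bound _ := by simp
  cont' _ := by fun_prop
  bound' τ h := by
    rw [abs_of_nonneg (mul_nonneg hθ (gib_nonneg h τ))]
    exact mul_le_one₀ hθ1 (gib_nonneg h τ) (gib_le_one h τ)
  deriv h h' t hh := by simpa using hasDerivAt_zf_rpow θ hh

lemma isTilt_gib [DecidableEq S] (hθ : 0 ≤ θ) (hθ1 : θ ≤ 1) (σ : S) :
    IsTilt θ (fun h => gib h σ)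
      fun τ h => gib h σ * ((if τ = σ then 1 else 0) - (1 - θ) * gib h τ) where
  cont := by fun_prop
  bound h := abs_le.2 ⟨by linarith [gib_nonneg h σ], gib_le_one h σ⟩
  cont' _ := by fun_prop
  bound' τ h := by
    have h1 := gib_nonneg h τ
    have h2 := gib_le_one h τ
    rw [abs_mul, abs_of_nonneg (gib_nonneg h σ)]
    refine mul_le_one₀ (gib_le_one h σ) (abs_nonneg _) (abs_le.2 ?_)
    have h3 : (1 - θ) * gib h τ ≤ 1 := mul_le_one₀ (by linarith) h1 h2
    have h4 : 0 ≤ (1 - θ) * gib h τ := mul_nonneg (by linarith) h1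
    split_ifs <;> constructor <;> linarith
  deriv h h' t hh := by
    refine ((hasDerivAt_zf_rpow θ hh).mul (hasDerivAt_gib hh σ)).congr_deriv ?_
    have h1 : ∑ τ, gib (h t) σ * ((if τ = σ then 1 else 0) - (1 - θ) * gib (h t) τ) * h' τ
        = gib (h t) σ * (h' σ - (1 - θ) * ∑ τ, gib (h t) τ * h' τ) := by
      have h3 : ∀ τ, gib (h t) σ * ((if τ = σ then 1 else 0) - (1 - θ) * gib (h t) τ) * h' τ =
          (if τ = σ then gib (h t) σ * h' τ else 0) -
            gib (h t) σ * (1 - θ) * (gib (h t) τ * h' τ) := by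
        intro τ; split_ifs <;> ring
      simp only [h3, Finset.sum_sub_distrib, ← Finset.mul_sum]
      simp
      ring
    have h2 : ∑ τ, θ * gib (h t) τ * h' τ = θ * ∑ τ, gib (h t) τ * h' τ := by
      rw [Finset.mul_sum]
      exact Finset.sum_congr rfl fun τ _ => by ring
    rw [h1, h2]
    ring

end Tilt

/-! ### Averages over the second-level field -/

lemma continuous_lin : Continuous fun p : (S → ℝ) × (S → L → ℝ) × (L → ℝ) =>
    lin p.1 p.2.1 p.2.2 := by
  unfold lin
  fun_prop

@[fun_prop]
lemma Continuous.lin' {X : Type*} [TopologicalSpace X] {e : X → S → ℝ} {z : X → S → L → ℝ}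
    {y : X → L → ℝ} (he : Continuous e) (hz : Continuous z) (hy : Continuous y) :
    Continuous fun x => lin (e x) (z x) (y x) :=
  continuous_lin.comp (he.prodMk (hz.prodMk hy))

lemma abs_lin_le {e : S → ℝ} {z : S → L → ℝ} {C : ℝ} (he : ‖e‖ ≤ C) (hz : ‖z‖ ≤ C)
    (y : L → ℝ) (σ : S) : |lin e z y σ| ≤ C + C * ∑ j, |y j| := by
  unfold lin
  refine (abs_add_le _ _).trans (add_le_add ((norm_le_pi_norm e σ).trans he) ?_)
  refine (Finset.abs_sum_le_sum_abs _ _).trans ?_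
  rw [Finset.mul_sum]
  refine Finset.sum_le_sum fun j _ => ?_
  rw [abs_mul]
  exact mul_le_mul_of_nonneg_right
    ((norm_le_pi_norm (z σ) j).trans ((norm_le_pi_norm z σ).trans hz)) (abs_nonneg _)

lemma hasDerivAt_lin {e : ℝ → S → ℝ} {z : ℝ → S → L → ℝ} {e' : S → ℝ} {z' : S → L → ℝ} {t : ℝ}
    (he : HasDerivAt e e' t) (hz : HasDerivAt z z' t) (y : L → ℝ) :
    HasDerivAt (fun t => lin (e t) (z t) y) (lin e' z' y) t := by
  refine hasDerivAt_pi.2 fun σ => ?_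
  exact (hasDerivAt_pi.1 he σ).add (HasDerivAt.fun_sum fun j _ =>
    (hasDerivAt_pi.1 (hasDerivAt_pi.1 hz σ) j).mul_const (y j))

lemma lin_update [DecidableEq L] (e : S → ℝ) (z : S → L → ℝ) (y : L → ℝ) (j : L) (s : ℝ) :
    HasDerivAt (fun s => lin e z (Function.update y j s)) (fun σ => z σ j) s := by
  refine hasDerivAt_pi.2 fun σ => ?_
  have h : ∀ k, HasDerivAt (fun s => z σ k * Function.update y j s k)
      (z σ k * (Pi.single j (1 : ℝ) : L → ℝ) k) s := fun k =>
    (hasDerivAt_pi.1 (hasDerivAt_update y j s) k).const_mul _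
  have := (HasDerivAt.fun_sum (u := Finset.univ) fun k _ => h k).const_add (e σ)
  simpa [lin, Pi.single_apply] using this

variable [Nonempty S] {θ : ℝ}

lemma abs_integrand_le (hθ : 0 ≤ θ) {e : S → ℝ} {z : S → L → ℝ} {C : ℝ} (he : ‖e‖ ≤ C)
    (hz : ‖z‖ ≤ C) {a : ℝ} (ha : |a| ≤ 1) (y : L → ℝ) :
    |zf (lin e z y) ^ θ * a| ≤
      (Fintype.card S : ℝ) ^ θ * Real.exp (θ * C) * Real.exp ((θ * C) * ∑ j, |y j|) := by
  rw [abs_mul, abs_of_nonneg (Real.rpow_nonneg (zf_pos _).le _)]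
  refine (mul_le_of_le_one_right (Real.rpow_nonneg (zf_pos _).le _) ha).trans ?_
  refine (zf_rpow_le hθ (abs_lin_le he hz y)).trans (le_of_eq ?_)
  rw [mul_assoc, ← Real.exp_add]
  ring_nf

lemma abs_integrand_mul_le (hθ : 0 ≤ θ) {e : S → ℝ} {z : S → L → ℝ} {C : ℝ} (he : ‖e‖ ≤ C)
    (hz : ‖z‖ ≤ C) {a : ℝ} (ha : |a| ≤ 1) (y : L → ℝ) {b : ℝ}
    (hb : |b| ≤ C + C * ∑ j, |y j|) :
    |zf (lin e z y) ^ θ * a * b| ≤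
      (Fintype.card S : ℝ) ^ θ * Real.exp (θ * C) * Real.exp C *
        Real.exp ((θ * C + C) * ∑ j, |y j|) := by
  rw [abs_mul]
  refine (mul_le_mul (abs_integrand_le hθ he hz ha y) (hb.trans
    ((le_add_of_nonneg_right zero_le_one).trans (Real.add_one_le_exp _))) (abs_nonneg _)
    (by positivity)).trans (le_of_eq ?_)
  rw [Real.exp_add, add_mul, Real.exp_add]
  ring

lemma integrable_integrand (hθ : 0 ≤ θ) {w : (S → ℝ) → ℝ} (hw : Continuous w)
    (hw1 : ∀ h, |w h| ≤ 1) (e : S → ℝ) (z : S → L → ℝ) :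
    Integrable (fun y => zf (lin e z y) ^ θ * w (lin e z y)) (stdGaussian L) :=
  integrable_of_exp_bound (by fun_prop) _ _ fun y =>
    abs_integrand_le hθ (le_max_left ‖e‖ ‖z‖) (le_max_right ‖e‖ ‖z‖) (hw1 _) y

lemma integrable_integrand_mul (hθ : 0 ≤ θ) {w : (S → ℝ) → ℝ} (hw : Continuous w)
    (hw1 : ∀ h, |w h| ≤ 1) (e : S → ℝ) (z : S → L → ℝ) (j : L) :
    Integrable (fun y => zf (lin e z y) ^ θ * w (lin e z y) * y j) (stdGaussian L) := by
  have h1 : ‖e‖ ≤ max (max ‖e‖ ‖z‖) 1 := (le_max_left ‖e‖ ‖z‖).trans (le_max_left _ _)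
  have h2 : ‖z‖ ≤ max (max ‖e‖ ‖z‖) 1 := (le_max_right ‖e‖ ‖z‖).trans (le_max_left _ _)
  have h3 : 1 ≤ max (max ‖e‖ ‖z‖) 1 := le_max_right _ _
  refine integrable_of_exp_bound (by fun_prop) _ _ fun y =>
    abs_integrand_mul_le hθ h1 h2 (hw1 _) y ?_
  have := abs_coord_le_sum y j
  nlinarith [sum_abs_nonneg y]

lemma continuous_level (hθ : 0 ≤ θ) {w : (S → ℝ) → ℝ} (hw : Continuous w)
    (hw1 : ∀ h, |w h| ≤ 1) :
    Continuous fun p : (S → ℝ) × (S → L → ℝ) => level θ w p.1 p.2 := by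
  refine continuous_iff_continuousAt.2 fun p => ?_
  have hb : ∀ᶠ q : (S → ℝ) × (S → L → ℝ) in 𝓝 p, ‖q‖ < ‖p‖ + 1 :=
    continuous_norm.continuousAt.eventually_lt continuousAt_const (by linarith)
  refine continuousAt_of_dominated (F := fun (q : (S → ℝ) × (S → L → ℝ)) y =>
    zf (lin q.1 q.2 y) ^ θ * w (lin q.1 q.2 y)) (Eventually.of_forall fun q => ?_) ?_
    ((integrable_exp_sum_abs (θ * (‖p‖ + 1))).const_mul
      ((Fintype.card S : ℝ) ^ θ * Real.exp (θ * (‖p‖ + 1))))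
    (ae_of_all _ fun y => ?_)
  · exact (Continuous.aestronglyMeasurable (by fun_prop))
  · filter_upwards [hb] with q hq
    refine ae_of_all _ fun y => ?_
    exact abs_integrand_le hθ ((norm_fst_le q).trans hq.le) ((norm_snd_le q).trans hq.le) (hw1 _) y
  · fun_prop

lemma level_one_pos (hθ : 0 ≤ θ) (e : S → ℝ) (z : S → L → ℝ) :
    0 < level θ (fun _ => 1) e z := by
  unfold level
  have hpos : ∀ y : L → ℝ, 0 < zf (lin e z y) ^ θ * 1 := fun y => by
    rw [mul_one]; exact Real.rpow_pos_of_pos (zf_pos _) _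
  rw [integral_pos_iff_support_of_nonneg (fun y => (hpos y).le)
    (integrable_integrand hθ continuous_const (by simp) e z)]
  have : (Function.support fun y : L → ℝ => zf (lin e z y) ^ θ * 1) = Set.univ :=
    Set.eq_univ_of_forall fun y => (hpos y).ne'
  rw [this]
  simp

lemma level_mul_left (c : ℝ) (w : (S → ℝ) → ℝ) (e : S → ℝ) (z : S → L → ℝ) :
    level θ (fun h => c * w h) e z = c * level θ w e z := by
  unfold level
  rw [← integral_const_mul]
  congr 1; ext y; ring

lemma level_add (hθ : 0 ≤ θ) {w₁ w₂ : (S → ℝ) → ℝ} (h1 : Continuous w₁) (h1' : ∀ h, |w₁ h| ≤ 1)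
    (h2 : Continuous w₂) (h2' : ∀ h, |w₂ h| ≤ 1) (e : S → ℝ) (z : S → L → ℝ) :
    level θ (fun h => w₁ h + w₂ h) e z = level θ w₁ e z + level θ w₂ e z := by
  unfold level
  rw [← integral_add (integrable_integrand hθ h1 h1' e z) (integrable_integrand hθ h2 h2' e z)]
  congr 1; ext y; ring

lemma level_sum (hθ : 0 ≤ θ) {κ : Type} (s : Finset κ) {w : κ → (S → ℝ) → ℝ}
    (h1 : ∀ k, Continuous (w k)) (h1' : ∀ k h, |w k h| ≤ 1) (e : S → ℝ) (z : S → L → ℝ) :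
    level θ (fun h => ∑ k ∈ s, w k h) e z = ∑ k ∈ s, level θ (w k) e z := by
  unfold level
  rw [← integral_finsetSum _ fun k _ => integrable_integrand hθ (h1 k) (h1' k) e z]
  congr 1; ext y; rw [Finset.mul_sum]

lemma level_nonneg {w : (S → ℝ) → ℝ} (hw : ∀ h, 0 ≤ w h) (e : S → ℝ) (z : S → L → ℝ) :
    0 ≤ level θ w e z :=
  integral_nonneg fun _ => mul_nonneg (Real.rpow_nonneg (zf_pos _).le _) (hw _)

lemma abs_level_le (hθ : 0 ≤ θ) {w : (S → ℝ) → ℝ} (hw1 : ∀ h, |w h| ≤ 1) (e : S → ℝ)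
    (z : S → L → ℝ) : |level θ w e z| ≤ level θ (fun _ => 1) e z := by
  unfold level
  refine (norm_integral_le_integral_norm
    (fun y => zf (lin e z y) ^ θ * w (lin e z y))).trans ?_
  refine integral_mono_of_nonneg (ae_of_all _ fun y => norm_nonneg _)
    (integrable_integrand hθ continuous_const (by simp) e z) (ae_of_all _ fun y => ?_)
  have h0 := Real.rpow_nonneg (zf_pos (lin e z y)).le θ
  simp only [Real.norm_eq_abs, abs_mul, abs_of_nonneg h0]
  exact mul_le_mul_of_nonneg_left (hw1 _) h0

/-- Differentiation under the second-level Gaussian integral. The path of energies and couplings is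
continuously differentiable, so the integrand is dominated near `t` by an exponential. -/
lemma hasDerivAt_level {w : (S → ℝ) → ℝ} {wt : S → (S → ℝ) → ℝ} (hθ : 0 ≤ θ)
    (hw : IsTilt θ w wt) {U : Set ℝ} (hU : IsOpen U) {e e' : ℝ → S → ℝ} {z z' : ℝ → S → L → ℝ}
    (he : ∀ t ∈ U, HasDerivAt e (e' t) t) (he' : ContinuousOn e' U)
    (hz : ∀ t ∈ U, HasDerivAt z (z' t) t) (hz' : ContinuousOn z' U) {t : ℝ} (ht : t ∈ U) :
    HasDerivAt (fun t => level θ w (e t) (z t))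
      (∑ τ, ∫ y, zf (lin (e t) (z t) y) ^ θ * wt τ (lin (e t) (z t) y) * lin (e' t) (z' t) y τ
        ∂stdGaussian L) t := by
  have hUt := hU.mem_nhds ht
  set C : ℝ := max (max ‖e t‖ ‖z t‖) (max ‖e' t‖ ‖z' t‖) + 1 with hC
  have hnb : ∀ {E : Type} [NormedAddCommGroup E] {f : ℝ → E}, ContinuousAt f t →
      ‖f t‖ < C → ∀ᶠ s in 𝓝 t, ‖f s‖ ≤ C := fun hf hlt =>
    (hf.norm.eventually_lt continuousAt_const hlt).mono fun _ h => h.le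
  have hV : ∀ᶠ s in 𝓝 t, s ∈ U ∧ ‖e s‖ ≤ C ∧ ‖z s‖ ≤ C ∧ ‖e' s‖ ≤ C ∧ ‖z' s‖ ≤ C := by
    filter_upwards [hUt, hnb (he t ht).continuousAt
        (by rw [hC]; linarith [le_max_left (max ‖e t‖ ‖z t‖) (max ‖e' t‖ ‖z' t‖),
            le_max_left ‖e t‖ ‖z t‖]),
      hnb (hz t ht).continuousAt
        (by rw [hC]; linarith [le_max_left (max ‖e t‖ ‖z t‖) (max ‖e' t‖ ‖z' t‖),
            le_max_right ‖e t‖ ‖z t‖]),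
      hnb (he'.continuousAt hUt)
        (by rw [hC]; linarith [le_max_right (max ‖e t‖ ‖z t‖) (max ‖e' t‖ ‖z' t‖),
            le_max_left ‖e' t‖ ‖z' t‖]),
      hnb (hz'.continuousAt hUt)
        (by rw [hC]; linarith [le_max_right (max ‖e t‖ ‖z t‖) (max ‖e' t‖ ‖z' t‖),
            le_max_right ‖e' t‖ ‖z' t‖])] with s h1 h2 h3 h4 h5
    exact ⟨h1, h2, h3, h4, h5⟩
  have hwc := hw.cont
  have hwtc := hw.cont'
  have hint : ∀ τ, Integrable (fun y => zf (lin (e t) (z t) y) ^ θ *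
      wt τ (lin (e t) (z t) y) * lin (e' t) (z' t) y τ) (stdGaussian L) := fun τ =>
    integrable_of_exp_bound (Continuous.mul (Continuous.mul (by fun_prop)
        ((hwtc τ).comp (f := fun y => lin (e t) (z t) y) (by fun_prop)))
        ((continuous_apply τ).comp (f := fun y => lin (e' t) (z' t) y) (by fun_prop)))
      _ _ fun y =>
      abs_integrand_mul_le hθ hV.self_of_nhds.2.1 hV.self_of_nhds.2.2.1 (hw.bound' τ _) y
        (abs_lin_le hV.self_of_nhds.2.2.2.1 hV.self_of_nhds.2.2.2.2 y τ)
  rw [← integral_finsetSum _ fun τ _ => hint τ]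
  refine (hasDerivAt_integral_of_dominated_loc_of_deriv_le (μ := stdGaussian L)
    (F := fun s y => zf (lin (e s) (z s) y) ^ θ * w (lin (e s) (z s) y))
    (F' := fun s y => ∑ τ, zf (lin (e s) (z s) y) ^ θ * wt τ (lin (e s) (z s) y) *
      lin (e' s) (z' s) y τ) hV (Eventually.of_forall fun s => ?_) ?_ ?_
    (bound := fun y => ∑ _τ : S, (Fintype.card S : ℝ) ^ θ * Real.exp (θ * C) * Real.exp C *
        Real.exp ((θ * C + C) * ∑ j, |y j|)) (ae_of_all _ fun y s hs => ?_) ?_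
    (ae_of_all _ fun y s hs => ?_)).2
  · exact Continuous.aestronglyMeasurable (by fun_prop)
  · exact integrable_integrand hθ hw.cont hw.bound _ _
  · exact (integrable_finsetSum _ fun τ _ => hint τ).aestronglyMeasurable
  · refine (norm_sum_le _ _).trans (Finset.sum_le_sum fun τ _ => ?_)
    exact abs_integrand_mul_le hθ hs.2.1 hs.2.2.1 (hw.bound' τ _) y
      (abs_lin_le hs.2.2.2.1 hs.2.2.2.2 y τ)
  · exact integrable_finsetSum _ fun τ _ => (integrable_exp_sum_abs _).const_mul _
  · refine (hw.deriv (fun s => lin (e s) (z s) y) _ s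
      (hasDerivAt_lin (he s hs.1) (hz s hs.1) y)).congr_deriv ?_
    rw [Finset.mul_sum]
    exact Finset.sum_congr rfl fun τ _ => by ring

/-- Gaussian integration by parts at the second level. -/
lemma integral_coord_mul_level {w : (S → ℝ) → ℝ} {wt : S → (S → ℝ) → ℝ} (hθ : 0 ≤ θ)
    (hw : IsTilt θ w wt) (e : S → ℝ) (z : S → L → ℝ) (j : L) :
    ∫ y, zf (lin e z y) ^ θ * w (lin e z y) * y j ∂stdGaussian L =
      ∑ τ, z τ j * level θ (wt τ) e z := by
  classical
  have hwtc := hw.cont'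
  have hi : ∀ τ, Integrable (fun y => z τ j * (zf (lin e z y) ^ θ * wt τ (lin e z y)))
      (stdGaussian L) := fun τ =>
    (integrable_integrand hθ (hw.cont' τ) (hw.bound' τ) e z).const_mul _
  have h := integral_coord_mul (ι := L) j
    (f := fun y => zf (lin e z y) ^ θ * w (lin e z y))
    (f' := fun y => ∑ τ, z τ j * (zf (lin e z y) ^ θ * wt τ (lin e z y)))
    (fun y s => by
      convert hw.deriv _ _ s (lin_update e z y j s) using 1
      rw [Finset.mul_sum]
      exact Finset.sum_congr rfl fun τ _ => by ring)
    (integrable_integrand hθ hw.cont hw.bound e z)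
    ((integrable_integrand_mul hθ hw.cont hw.bound e z j).congr
      (ae_of_all _ fun y => by simp only []; ring))
    (integrable_finsetSum _ fun τ _ => hi τ)
  rw [integral_finsetSum _ fun τ _ => hi τ] at h
  simp only [integral_const_mul] at h
  unfold level
  rw [← h]
  congr 1; ext y; ring

lemma abs_gib_le (h : S → ℝ) (σ : S) : |gib h σ| ≤ 1 :=
  abs_le.2 ⟨by linarith [gib_nonneg h σ], gib_le_one h σ⟩

lemma abs_gib_mul_gib_le (h : S → ℝ) (σ τ : S) : |gib h σ * gib h τ| ≤ 1 := by
  rw [abs_mul]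
  exact mul_le_one₀ (abs_gib_le h σ) (abs_nonneg _) (abs_gib_le h τ)

/-- The right-hand side of integration by parts for `w = gib σ`, in terms of one and two replicas.
-/
lemma level_gib_wt [DecidableEq S] (hθ : 0 ≤ θ) (hθ1 : θ ≤ 1) (e : S → ℝ) (z : S → L → ℝ)
    (σ : S) (a : S → ℝ) :
    ∑ τ, a τ * level θ (fun h => gib h σ * ((if τ = σ then 1 else 0) - (1 - θ) * gib h τ)) e z =
      a σ * level θ (fun h => gib h σ) e z -
        (1 - θ) * ∑ τ, a τ * level θ (fun h => gib h σ * gib h τ) e z := by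
  have h1 : ∀ τ, level θ (fun h => gib h σ * ((if τ = σ then 1 else 0) - (1 - θ) * gib h τ)) e z
      = (if τ = σ then 1 else 0) * level θ (fun h => gib h σ) e z
        + (-(1 - θ)) * level θ (fun h => gib h σ * gib h τ) e z := by
    intro τ
    rw [← level_mul_left, ← level_mul_left, ← level_add hθ (by fun_prop) _ (by fun_prop)]
    · congr 1; ext h; ring
    · intro h
      rw [abs_mul, abs_of_nonpos (by linarith), neg_neg]
      exact mul_le_one₀ (by linarith) (abs_nonneg _) (abs_gib_mul_gib_le h σ τ)
    · intro h
      split_ifs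
      · simpa using abs_gib_le h σ
      · simp
  simp only [h1, mul_add, Finset.sum_add_distrib, Finset.mul_sum]
  rw [sub_eq_add_neg (a σ * _), ← Finset.sum_neg_distrib]
  congr 1
  · simp
  · exact Finset.sum_congr rfl fun τ _ => by ring

/-- Derivative of the tilted free energy of the second level along a path of energies `e` and
couplings `z`. -/
lemma hasDerivAt_log_level (hθ : 0 ≤ θ) (hθ1 : θ ≤ 1) {U : Set ℝ} (hU : IsOpen U)
    {e e' : ℝ → S → ℝ} {z z' : ℝ → S → L → ℝ}
    (he : ∀ t ∈ U, HasDerivAt e (e' t) t) (he' : ContinuousOn e' U)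
    (hz : ∀ t ∈ U, HasDerivAt z (z' t) t) (hz' : ContinuousOn z' U) {t : ℝ} (ht : t ∈ U) :
    HasDerivAt (fun t => Real.log (level θ (fun _ => 1) (e t) (z t)))
      (θ * (∑ σ, e' t σ * tiltOne θ (e t) (z t) σ
        + ∑ σ, cov (z' t) (z t) σ σ * tiltOne θ (e t) (z t) σ
        - (1 - θ) * ∑ σ, ∑ τ, cov (z' t) (z t) σ τ * tiltTwo θ (e t) (z t) σ τ)) t := by
  classical
  have h1 := (hasDerivAt_level hθ (isTilt_one hθ hθ1) hU he he' hz hz' ht).log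
    (level_one_pos hθ _ _).ne'
  convert h1 using 1
  rw [eq_div_iff (level_one_pos hθ _ _).ne']
  have h2 : ∀ τ, ∫ y, zf (lin (e t) (z t) y) ^ θ * (θ * gib (lin (e t) (z t) y) τ) *
      lin (e' t) (z' t) y τ ∂stdGaussian L
      = θ * (e' t τ * level θ (fun h => gib h τ) (e t) (z t) +
        ∑ j, z' t τ j * (z t τ j * level θ (fun h => gib h τ) (e t) (z t) -
          (1 - θ) * ∑ σ, z t σ j * level θ (fun h => gib h τ * gib h σ) (e t) (z t))) := by
    intro τ
    have h : ∀ j, z t τ j * level θ (fun h => gib h τ) (e t) (z t) -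
          (1 - θ) * ∑ σ, z t σ j * level θ (fun h => gib h τ * gib h σ) (e t) (z t) =
        ∫ y, zf (lin (e t) (z t) y) ^ θ * gib (lin (e t) (z t) y) τ * y j ∂stdGaussian L :=
      fun j => (level_gib_wt hθ hθ1 (e t) (z t) τ fun σ => z t σ j).symm.trans
        (integral_coord_mul_level hθ (isTilt_gib hθ hθ1 τ) (e t) (z t) j).symm
    simp only [h]
    unfold level
    rw [← integral_const_mul]
    simp only [← integral_const_mul]
    rw [← integral_finsetSum _ fun j _ =>
        (integrable_integrand_mul hθ (continuous_gib τ) (fun h => abs_gib_le h τ) _ _ j).const_mul _,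
      ← integral_add
        ((integrable_integrand hθ (continuous_gib τ) (fun h => abs_gib_le h τ) _ _).const_mul _)
        (integrable_finsetSum _ fun j _ =>
        (integrable_integrand_mul hθ (continuous_gib τ) (fun h => abs_gib_le h τ) _ _
          j).const_mul _),
      ← integral_const_mul]
    congr 1; ext y
    unfold lin
    rw [mul_add, mul_add, Finset.mul_sum, Finset.mul_sum]
    congr 1
    · ring
    · exact Finset.sum_congr rfl fun j _ => by ring
  simp only [h2]
  rw [← Finset.mul_sum]
  have hG := (level_one_pos hθ (e t) (z t)).ne'
  have h3 : ∀ σ, level θ (fun h => gib h σ) (e t) (z t) =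
      tiltOne θ (e t) (z t) σ * level θ (fun _ => 1) (e t) (z t) := fun σ =>
    (div_mul_cancel₀ _ hG).symm
  have h4 : ∀ σ τ, level θ (fun h => gib h σ * gib h τ) (e t) (z t) =
      tiltTwo θ (e t) (z t) σ τ * level θ (fun _ => 1) (e t) (z t) := fun σ τ =>
    (div_mul_cancel₀ _ hG).symm
  simp only [h3, h4, mul_assoc]
  congr 1
  rw [add_sub_assoc, add_mul, sub_mul, Finset.sum_add_distrib]
  congr 1
  · rw [Finset.sum_mul]
    exact Finset.sum_congr rfl fun σ _ => by ring
  · rw [mul_assoc, Finset.sum_mul, Finset.sum_mul, Finset.mul_sum, ← Finset.sum_sub_distrib]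
    refine Finset.sum_congr rfl fun σ _ => ?_
    simp only [mul_sub, Finset.sum_sub_distrib, cov]
    congr 1
    · rw [Finset.sum_mul, Finset.sum_mul]
      exact Finset.sum_congr rfl fun j _ => by ring
    · simp only [Finset.sum_mul, Finset.mul_sum]
      rw [Finset.sum_comm]
      refine Finset.sum_congr rfl fun j _ => Finset.sum_congr rfl fun τ _ => by ring

/-- Derivative of a second-level probability along a path of energies, at fixed couplings. -/
lemma hasDerivAt_tiltOne (hθ : 0 ≤ θ) (hθ1 : θ ≤ 1) {e : ℝ → S → ℝ} {e' : S → ℝ}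
    (z : S → L → ℝ) (he : ∀ t, HasDerivAt e e' t) (t : ℝ) (σ : S) :
    HasDerivAt (fun t => tiltOne θ (e t) z σ)
      (e' σ * tiltOne θ (e t) z σ - (1 - θ) * ∑ τ, e' τ * tiltTwo θ (e t) z σ τ
        - θ * tiltOne θ (e t) z σ * ∑ τ, e' τ * tiltOne θ (e t) z τ) t := by
  classical
  have hG := (level_one_pos hθ (e t) z).ne'
  have key : ∀ {w : (S → ℝ) → ℝ} {wt : S → (S → ℝ) → ℝ}, IsTilt θ w wt →
      HasDerivAt (fun t => level θ w (e t) z) (∑ τ, e' τ * level θ (wt τ) (e t) z) t := by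
    intro w wt hw
    convert hasDerivAt_level (U := Set.univ) hθ hw isOpen_univ (fun s _ => he s)
      continuousOn_const (fun s _ => hasDerivAt_const s z) continuousOn_const (Set.mem_univ t)
      using 1
    refine Finset.sum_congr rfl fun τ _ => ?_
    unfold level
    rw [← integral_const_mul]
    congr 1; ext y
    simp only [lin, Pi.zero_apply, zero_mul, Finset.sum_const_zero, add_zero]
    ring
  have h1 := (key (isTilt_gib hθ hθ1 σ)).div (key (isTilt_one hθ hθ1)) hG
  rw [level_gib_wt hθ hθ1] at h1
  refine h1.congr_deriv ?_
  simp only [level_mul_left]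
  have h3 : ∀ σ, level θ (fun h => gib h σ) (e t) z =
      tiltOne θ (e t) z σ * level θ (fun _ => 1) (e t) z := fun σ =>
    (div_mul_cancel₀ _ hG).symm
  have h4 : ∀ σ τ, level θ (fun h => gib h σ * gib h τ) (e t) z =
      tiltTwo θ (e t) z σ τ * level θ (fun _ => 1) (e t) z := fun σ τ =>
    (div_mul_cancel₀ _ hG).symm
  simp only [h3, h4]
  rw [div_eq_iff (pow_ne_zero 2 hG)]
  have h5 : ∑ τ, e' τ * (tiltTwo θ (e t) z σ τ * level θ (fun _ => 1) (e t) z) =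
      (∑ τ, e' τ * tiltTwo θ (e t) z σ τ) * level θ (fun _ => 1) (e t) z := by
    rw [Finset.sum_mul]; exact Finset.sum_congr rfl fun _ _ => by ring
  have h6 : ∑ τ, e' τ * (θ * (tiltOne θ (e t) z τ * level θ (fun _ => 1) (e t) z)) =
      θ * (∑ τ, e' τ * tiltOne θ (e t) z τ) * level θ (fun _ => 1) (e t) z := by
    rw [mul_assoc, Finset.sum_mul, Finset.mul_sum]; exact Finset.sum_congr rfl fun _ _ => by ring
  rw [h5, h6]
  ring

end

/-! ### The two-level free energy and its derivative -/

section

variable {S I L : Type} [Fintype S] [Fintype I] [Fintype L]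

/-- The two-level free energy `𝔼_x log 𝔼_y Z^θ` (unnormalised), for the energies
`c σ + ∑ i, v σ i * x i + ∑ j, z σ j * y j`. -/
def press (θ : ℝ) (c : S → ℝ) (v : S → I → ℝ) (z : S → L → ℝ) : ℝ :=
  ∫ x, Real.log (level θ (fun _ => 1) (lin c v x) z) ∂stdGaussian I

/-- The mean probability of the configuration `σ`. -/
def meanOne (θ : ℝ) (c : S → ℝ) (v : S → I → ℝ) (z : S → L → ℝ) (σ : S) : ℝ :=
  ∫ x, tiltOne θ (lin c v x) z σ ∂stdGaussian I

/-- The mean probability of two replicas that share the first-level field only. -/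
def meanPair₁ (θ : ℝ) (c : S → ℝ) (v : S → I → ℝ) (z : S → L → ℝ) (σ τ : S) : ℝ :=
  ∫ x, tiltOne θ (lin c v x) z σ * tiltOne θ (lin c v x) z τ ∂stdGaussian I

/-- The mean probability of two replicas that share the fields of both levels. -/
def meanPair₂ (θ : ℝ) (c : S → ℝ) (v : S → I → ℝ) (z : S → L → ℝ) (σ τ : S) : ℝ :=
  ∫ x, tiltTwo θ (lin c v x) z σ τ ∂stdGaussian I

variable [Nonempty S] {θ : ℝ}

lemma abs_tilt_le (hθ : 0 ≤ θ) {w : (S → ℝ) → ℝ} (hw1 : ∀ h, |w h| ≤ 1) (e : S → ℝ)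
    (z : S → L → ℝ) : |tilt θ w e z| ≤ 1 := by
  unfold tilt
  rw [abs_div, abs_of_pos (level_one_pos hθ e z)]
  exact (div_le_one (level_one_pos hθ e z)).2 (abs_level_le hθ hw1 e z)

lemma continuous_tilt (hθ : 0 ≤ θ) {w : (S → ℝ) → ℝ} (hw : Continuous w)
    (hw1 : ∀ h, |w h| ≤ 1) :
    Continuous fun p : (S → ℝ) × (S → L → ℝ) => tilt θ w p.1 p.2 :=
  (continuous_level hθ hw hw1).div (continuous_level hθ continuous_const (by simp))
    fun p => (level_one_pos hθ _ _).ne'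

lemma tilt_sum (hθ : 0 ≤ θ) {κ : Type} (s : Finset κ) {w : κ → (S → ℝ) → ℝ}
    (h1 : ∀ k, Continuous (w k)) (h1' : ∀ k h, |w k h| ≤ 1) (e : S → ℝ) (z : S → L → ℝ) :
    tilt θ (fun h => ∑ k ∈ s, w k h) e z = ∑ k ∈ s, tilt θ (w k) e z := by
  unfold tilt
  rw [level_sum hθ s h1 h1', Finset.sum_div]

lemma tilt_mul_left (c : ℝ) (w : (S → ℝ) → ℝ) (e : S → ℝ) (z : S → L → ℝ) :
    tilt θ (fun h => c * w h) e z = c * tilt θ w e z := by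
  unfold tilt
  rw [level_mul_left, mul_div_assoc]

lemma tilt_one (hθ : 0 ≤ θ) (e : S → ℝ) (z : S → L → ℝ) : tilt θ (fun _ => 1) e z = 1 :=
  div_self (level_one_pos hθ e z).ne'

lemma tilt_nonneg (hθ : 0 ≤ θ) {w : (S → ℝ) → ℝ} (hw : ∀ h, 0 ≤ w h) (e : S → ℝ)
    (z : S → L → ℝ) : 0 ≤ tilt θ w e z :=
  div_nonneg (level_nonneg hw e z) (level_one_pos hθ e z).le

lemma tiltOne_nonneg (hθ : 0 ≤ θ) (e : S → ℝ) (z : S → L → ℝ) (σ : S) : 0 ≤ tiltOne θ e z σ :=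
  tilt_nonneg hθ (fun h => gib_nonneg h σ) e z

lemma abs_tiltOne_le (hθ : 0 ≤ θ) (e : S → ℝ) (z : S → L → ℝ) (σ : S) :
    |tiltOne θ e z σ| ≤ 1 := abs_tilt_le hθ (fun h => abs_gib_le h σ) e z

lemma tiltTwo_nonneg (hθ : 0 ≤ θ) (e : S → ℝ) (z : S → L → ℝ) (σ τ : S) :
    0 ≤ tiltTwo θ e z σ τ :=
  tilt_nonneg hθ (fun h => mul_nonneg (gib_nonneg h σ) (gib_nonneg h τ)) e z

lemma abs_tiltTwo_le (hθ : 0 ≤ θ) (e : S → ℝ) (z : S → L → ℝ) (σ τ : S) :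
    |tiltTwo θ e z σ τ| ≤ 1 := abs_tilt_le hθ (fun h => abs_gib_mul_gib_le h σ τ) e z

lemma sum_tiltOne (hθ : 0 ≤ θ) (e : S → ℝ) (z : S → L → ℝ) : ∑ σ, tiltOne θ e z σ = 1 := by
  unfold tiltOne
  rw [← tilt_sum hθ _ continuous_gib fun σ h => abs_gib_le h σ]
  simp only [sum_gib]
  exact tilt_one hθ e z

lemma sum_sum_tiltTwo (hθ : 0 ≤ θ) (e : S → ℝ) (z : S → L → ℝ) :
    ∑ σ, ∑ τ, tiltTwo θ e z σ τ = 1 := by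
  rw [← Finset.sum_product' (f := fun σ τ => tiltTwo θ e z σ τ)]
  unfold tiltTwo
  rw [← tilt_sum hθ (Finset.univ ×ˢ Finset.univ)
    (w := fun (k : S × S) h => gib h k.1 * gib h k.2) (fun k => by fun_prop)
    fun k h => abs_gib_mul_gib_le h k.1 k.2]
  rw [← tilt_one hθ e z]
  congr 1; ext h
  rw [Finset.sum_product' (f := fun σ τ => gib h σ * gib h τ), ← Finset.sum_mul_sum, sum_gib,
    one_mul]

lemma Continuous.tilt' (hθ : 0 ≤ θ) {X : Type*} [TopologicalSpace X] {w : (S → ℝ) → ℝ}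
    (hw : Continuous w) (hw1 : ∀ h, |w h| ≤ 1) {e : X → S → ℝ} {z : X → S → L → ℝ}
    (he : Continuous e) (hz : Continuous z) : Continuous fun x => tilt θ w (e x) (z x) :=
  (continuous_tilt hθ hw hw1).comp (f := fun x => (e x, z x)) (he.prodMk hz)

lemma continuous_tiltOne (hθ : 0 ≤ θ) (σ : S) {X : Type*} [TopologicalSpace X] {e : X → S → ℝ}
    {z : X → S → L → ℝ} (he : Continuous e) (hz : Continuous z) :
    Continuous fun x => tiltOne θ (e x) (z x) σ :=
  Continuous.tilt' hθ (w := fun h => gib h σ) (continuous_gib σ) (fun h => abs_gib_le h σ) he hz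

lemma continuous_tiltTwo (hθ : 0 ≤ θ) (σ τ : S) {X : Type*} [TopologicalSpace X] {e : X → S → ℝ}
    {z : X → S → L → ℝ} (he : Continuous e) (hz : Continuous z) :
    Continuous fun x => tiltTwo θ (e x) (z x) σ τ :=
  Continuous.tilt' hθ (w := fun h => gib h σ * gib h τ) (by fun_prop)
    (fun h => abs_gib_mul_gib_le h σ τ) he hz

/-- Changing the energies by at most `‖e₁ - e₂‖` changes `log 𝔼_y Z^θ` by at most
`θ ‖e₁ - e₂‖`. -/
lemma log_level_sub_le (hθ : 0 ≤ θ) (e₁ e₂ : S → ℝ) (z : S → L → ℝ) :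
    Real.log (level θ (fun _ => 1) e₁ z) - Real.log (level θ (fun _ => 1) e₂ z)
      ≤ θ * ‖e₁ - e₂‖ := by
  have h : level θ (fun _ => 1) e₁ z ≤ Real.exp (θ * ‖e₁ - e₂‖) * level θ (fun _ => 1) e₂ z := by
    rw [← level_mul_left]
    unfold level
    refine integral_mono (integrable_integrand hθ continuous_const (by simp) _ _)
      (((integrable_integrand (w := fun _ => 1) hθ continuous_const (by simp) e₂ z).const_mul
        (Real.exp (θ * ‖e₁ - e₂‖))).congr (ae_of_all _ fun y => by simp only []; ring))
      fun y => ?_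
    have hz : zf (lin e₁ z y) ≤ zf (lin e₂ z y) * Real.exp ‖e₁ - e₂‖ := by
      unfold zf
      rw [Finset.sum_mul]
      refine Finset.sum_le_sum fun σ _ => ?_
      rw [← Real.exp_add]
      refine Real.exp_le_exp.2 ?_
      have h1 := (le_abs_self _).trans (norm_le_pi_norm (e₁ - e₂) σ)
      simp only [Pi.sub_apply] at h1
      unfold lin
      linarith
    have := Real.rpow_le_rpow (zf_pos _).le hz hθ
    rw [Real.mul_rpow (zf_pos _).le (Real.exp_pos _).le, ← Real.exp_mul,
      mul_comm _ θ] at this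
    simpa using this
  have h2 := Real.log_le_log (level_one_pos hθ e₁ z) h
  rw [Real.log_mul (Real.exp_pos _).ne' (level_one_pos hθ _ _).ne', Real.log_exp] at h2
  linarith

lemma abs_log_level_le (hθ : 0 ≤ θ) (e : S → ℝ) (z : S → L → ℝ) :
    |Real.log (level θ (fun _ => 1) e z)| ≤
      θ * ‖e‖ + |Real.log (level θ (fun _ => 1) (0 : S → ℝ) z)| := by
  have h1 := log_level_sub_le hθ e 0 z
  have h2 := log_level_sub_le hθ 0 e z
  rw [sub_zero] at h1
  rw [zero_sub, norm_neg] at h2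
  have h3 := abs_le.1 (le_refl |Real.log (level θ (fun _ => 1) (0 : S → ℝ) z)|)
  rw [abs_le]
  constructor <;> linarith [h3.1, h3.2]

lemma continuous_log_level (hθ : 0 ≤ θ) :
    Continuous fun p : (S → ℝ) × (S → L → ℝ) => Real.log (level θ (fun _ => 1) p.1 p.2) :=
  (continuous_level hθ continuous_const (by simp)).log fun p => (level_one_pos hθ _ _).ne'

lemma integral_sub_sub {f g h : (I → ℝ) → ℝ} (hf : Integrable f (stdGaussian I))
    (hg : Integrable g (stdGaussian I)) (hh : Integrable h (stdGaussian I)) :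
    ∫ x, f x - g x - h x ∂stdGaussian I =
      ∫ x, f x ∂stdGaussian I - ∫ x, g x ∂stdGaussian I - ∫ x, h x ∂stdGaussian I := by
  rw [← integral_sub hf hg]
  exact integral_sub (hf.sub hg) hh

lemma integral_add_sub {f g h : (I → ℝ) → ℝ} (hf : Integrable f (stdGaussian I))
    (hg : Integrable g (stdGaussian I)) (hh : Integrable h (stdGaussian I)) :
    ∫ x, f x + g x - h x ∂stdGaussian I =
      ∫ x, f x ∂stdGaussian I + ∫ x, g x ∂stdGaussian I - ∫ x, h x ∂stdGaussian I := by
  rw [← integral_add hf hg]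
  exact integral_sub (hf.add hg) hh

lemma integrable_sum_abs : Integrable (fun x : I → ℝ => ∑ i, |x i|) (stdGaussian I) :=
  integrable_of_exp_bound (by fun_prop) 1 1 fun x => by
    rw [abs_of_nonneg (sum_abs_nonneg x), one_mul, one_mul]
    linarith [Real.add_one_le_exp (∑ i, |x i|)]

lemma norm_lin_le {c : S → ℝ} {v : S → I → ℝ} {C : ℝ} (hc : ‖c‖ ≤ C) (hv : ‖v‖ ≤ C)
    (x : I → ℝ) : ‖lin c v x‖ ≤ C + C * ∑ i, |x i| := by
  have hC : 0 ≤ C := (norm_nonneg _).trans hc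
  exact (pi_norm_le_iff_of_nonneg
    (add_nonneg hC (mul_nonneg hC (sum_abs_nonneg x)))).2 fun σ => abs_lin_le hc hv x σ

lemma integrable_log_level (hθ : 0 ≤ θ) (c : S → ℝ) (v : S → I → ℝ) (z : S → L → ℝ) :
    Integrable (fun x => Real.log (level θ (fun _ => 1) (lin c v x) z)) (stdGaussian I) := by
  have hb : Integrable (fun x : I → ℝ => θ * (max ‖c‖ ‖v‖ + max ‖c‖ ‖v‖ * ∑ i, |x i|) +
      |Real.log (level θ (fun _ => 1) (0 : S → ℝ) z)|) (stdGaussian I) :=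
    (((integrable_const _).add (integrable_sum_abs.const_mul _)).const_mul _).add
      (integrable_const _)
  refine hb.mono' ?_ (ae_of_all _ fun x => ?_)
  · exact ((continuous_log_level hθ).comp
      (f := fun x => (lin c v x, z)) (by fun_prop)).aestronglyMeasurable
  · refine (abs_log_level_le hθ _ _).trans (add_le_add_left ?_ _)
    exact mul_le_mul_of_nonneg_left (norm_lin_le (le_max_left _ _) (le_max_right _ _) x) hθ

lemma continuous_press (hθ : 0 ≤ θ) :
    Continuous fun p : (S → ℝ) × (S → I → ℝ) × (S → L → ℝ) => press θ p.1 p.2.1 p.2.2 := by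
  refine continuous_iff_continuousAt.2 fun p => ?_
  have hb : ∀ᶠ q : (S → ℝ) × (S → I → ℝ) × (S → L → ℝ) in 𝓝 p, ‖q‖ < ‖p‖ + 1 :=
    continuous_norm.continuousAt.eventually_lt continuousAt_const (by linarith)
  have hg : Continuous fun z : S → L → ℝ => |Real.log (level θ (fun _ => 1) (0 : S → ℝ) z)| :=
    ((continuous_log_level hθ).comp (f := fun z => ((0 : S → ℝ), z)) (by fun_prop)).abs
  have hb' : ∀ᶠ q : (S → ℝ) × (S → I → ℝ) × (S → L → ℝ) in 𝓝 p,
      |Real.log (level θ (fun _ => 1) (0 : S → ℝ) q.2.2)| <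
        |Real.log (level θ (fun _ => 1) (0 : S → ℝ) p.2.2)| + 1 :=
    ContinuousAt.eventually_lt (hg.comp (by fun_prop)).continuousAt continuousAt_const (by simp)
  refine continuousAt_of_dominated (F := fun (q : (S → ℝ) × (S → I → ℝ) × (S → L → ℝ)) x =>
    Real.log (level θ (fun _ => 1) (lin q.1 q.2.1 x) q.2.2)) (Eventually.of_forall fun q => ?_) ?_
    (bound := fun x => θ * (‖p‖ + 1 + (‖p‖ + 1) * ∑ i, |x i|) +
      (|Real.log (level θ (fun _ => 1) (0 : S → ℝ) p.2.2)| + 1)) ?_ (ae_of_all _ fun x => ?_)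
  · exact (integrable_log_level hθ _ _ _).aestronglyMeasurable
  · filter_upwards [hb, hb'] with q hq hq'
    refine ae_of_all _ fun x => ?_
    refine (abs_log_level_le hθ _ _).trans (add_le_add ?_ hq'.le)
    exact mul_le_mul_of_nonneg_left (norm_lin_le ((norm_fst_le q).trans hq.le)
      (((norm_fst_le q.2).trans (norm_snd_le q)).trans hq.le) x) hθ
  · exact (((integrable_const _).add (integrable_sum_abs.const_mul _)).const_mul _).add
      (integrable_const _)
  · exact ((continuous_log_level hθ).comp
      (f := fun q : (S → ℝ) × (S → I → ℝ) × (S → L → ℝ) => (lin q.1 q.2.1 x, q.2.2))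
      (by fun_prop)).continuousAt

/-- Gaussian averages of bounded continuous functions of the energies and the couplings depend
continuously on the parameters. -/
lemma continuous_integral_lin {f : (S → ℝ) × (S → L → ℝ) → ℝ} (hf : Continuous f)
    (hf1 : ∀ p, |f p| ≤ 1) :
    Continuous fun p : (S → ℝ) × (S → I → ℝ) × (S → L → ℝ) =>
      ∫ x, f (lin p.1 p.2.1 x, p.2.2) ∂stdGaussian I := by
  refine continuous_of_dominated (fun p => ?_) (bound := fun _ => 1)
    (fun p => ae_of_all _ fun x => hf1 _) (integrable_const _) (ae_of_all _ fun x => ?_)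
  · exact (hf.comp (f := fun x => (lin p.1 p.2.1 x, p.2.2)) (by fun_prop)).aestronglyMeasurable
  · exact hf.comp (f := fun p : (S → ℝ) × (S → I → ℝ) × (S → L → ℝ) =>
      (lin p.1 p.2.1 x, p.2.2)) (by fun_prop)

lemma integrable_tiltOne (hθ : 0 ≤ θ) (c : S → ℝ) (v : S → I → ℝ) (z : S → L → ℝ) (σ : S) :
    Integrable (fun x => tiltOne θ (lin c v x) z σ) (stdGaussian I) :=
  integrable_of_bound (continuous_tiltOne hθ σ (by fun_prop) (by fun_prop)) 1 fun _ =>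
    abs_tiltOne_le hθ _ _ _

lemma integrable_tiltTwo (hθ : 0 ≤ θ) (c : S → ℝ) (v : S → I → ℝ) (z : S → L → ℝ) (σ τ : S) :
    Integrable (fun x => tiltTwo θ (lin c v x) z σ τ) (stdGaussian I) :=
  integrable_of_bound (continuous_tiltTwo hθ σ τ (by fun_prop) (by fun_prop)) 1 fun _ =>
    abs_tiltTwo_le hθ _ _ _ _

lemma integrable_tiltOne_mul (hθ : 0 ≤ θ) (c : S → ℝ) (v : S → I → ℝ) (z : S → L → ℝ)
    (σ τ : S) :
    Integrable (fun x => tiltOne θ (lin c v x) z σ * tiltOne θ (lin c v x) z τ)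
      (stdGaussian I) :=
  integrable_of_bound ((continuous_tiltOne hθ σ (by fun_prop) (by fun_prop)).mul
    (continuous_tiltOne hθ τ (by fun_prop) (by fun_prop))) 1 fun _ => by
      rw [abs_mul]
      exact mul_le_one₀ (abs_tiltOne_le hθ _ _ _) (abs_nonneg _) (abs_tiltOne_le hθ _ _ _)

lemma integrable_coord_mul_tiltOne (hθ : 0 ≤ θ) (c : S → ℝ) (v : S → I → ℝ) (z : S → L → ℝ)
    (σ : S) (i : I) :
    Integrable (fun x => x i * tiltOne θ (lin c v x) z σ) (stdGaussian I) := by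
  refine integrable_sum_abs.mono' (Continuous.aestronglyMeasurable ?_) (ae_of_all _ fun x => ?_)
  · exact (continuous_apply i).mul (continuous_tiltOne hθ σ (by fun_prop) (by fun_prop))
  · rw [norm_mul]
    exact (mul_le_of_le_one_right (norm_nonneg _) (abs_tiltOne_le hθ _ _ _)).trans
      (abs_coord_le_sum x i)

/-- Gaussian integration by parts at the first level. -/
lemma integral_coord_mul_tiltOne (hθ : 0 ≤ θ) (hθ1 : θ ≤ 1) (c : S → ℝ) (v : S → I → ℝ)
    (z : S → L → ℝ) (σ : S) (i : I) :
    ∫ x, x i * tiltOne θ (lin c v x) z σ ∂stdGaussian I =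
      v σ i * meanOne θ c v z σ - (1 - θ) * ∑ τ, v τ i * meanPair₂ θ c v z σ τ
        - θ * ∑ τ, v τ i * meanPair₁ θ c v z σ τ := by
  classical
  have i1 := (integrable_tiltOne hθ c v z σ).const_mul (v σ i)
  have i2 := (integrable_finsetSum Finset.univ fun τ _ =>
    (integrable_tiltTwo hθ c v z σ τ).const_mul (v τ i)).const_mul (1 - θ)
  have i3 := (integrable_finsetSum Finset.univ fun τ _ =>
    (integrable_tiltOne_mul hθ c v z σ τ).const_mul (v τ i)).const_mul θ
  rw [integral_coord_mul (f' := fun x => v σ i * tiltOne θ (lin c v x) z σ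
      - (1 - θ) * ∑ τ, v τ i * tiltTwo θ (lin c v x) z σ τ
      - θ * ∑ τ, v τ i * (tiltOne θ (lin c v x) z σ * tiltOne θ (lin c v x) z τ)) i
      (fun x s => ?_) (integrable_tiltOne hθ c v z σ)
      (integrable_coord_mul_tiltOne hθ c v z σ i) ((i1.sub i2).sub i3)]
  · rw [integral_sub_sub i1 i2 i3]
    simp only [integral_const_mul]
    rw [integral_finsetSum _ fun τ _ => (integrable_tiltTwo hθ c v z σ τ).const_mul (v τ i),
      integral_finsetSum _ fun τ _ => (integrable_tiltOne_mul hθ c v z σ τ).const_mul (v τ i)]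
    simp only [integral_const_mul]
    rfl
  · refine (hasDerivAt_tiltOne (e := fun s => lin c v (Function.update x i s)) hθ hθ1 z
      (fun t => lin_update c v x i t) s σ).congr_deriv ?_
    congr 1
    rw [mul_assoc, Finset.mul_sum]
    congr 1
    exact Finset.sum_congr rfl fun τ _ => by ring

lemma abs_cov_le {z' z : S → L → ℝ} {C : ℝ} (h' : ‖z'‖ ≤ C) (h : ‖z‖ ≤ C) (σ τ : S) :
    |cov z' z σ τ| ≤ Fintype.card L * (C * C) := by
  unfold cov
  refine (Finset.abs_sum_le_sum_abs _ _).trans ((Finset.sum_le_card_nsmul _ _ (C * C)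
    fun j _ => ?_).trans (by simp))
  rw [abs_mul]
  exact mul_le_mul ((norm_le_pi_norm _ j).trans ((norm_le_pi_norm z' σ).trans h'))
    ((norm_le_pi_norm _ j).trans ((norm_le_pi_norm z τ).trans h)) (abs_nonneg _)
    ((norm_nonneg _).trans h)

/-- Differentiation under the first-level Gaussian integral. -/
lemma hasDerivAt_press_aux (hθ : 0 ≤ θ) (hθ1 : θ ≤ 1) {U : Set ℝ} (hU : IsOpen U)
    {c c' : ℝ → S → ℝ} {v v' : ℝ → S → I → ℝ} {z z' : ℝ → S → L → ℝ}
    (hc : ∀ t ∈ U, HasDerivAt c (c' t) t) (hc' : ContinuousOn c' U)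
    (hv : ∀ t ∈ U, HasDerivAt v (v' t) t) (hv' : ContinuousOn v' U)
    (hz : ∀ t ∈ U, HasDerivAt z (z' t) t) (hz' : ContinuousOn z' U) {t : ℝ} (ht : t ∈ U) :
    HasDerivAt (fun t => press θ (c t) (v t) (z t))
      (∫ x, θ * (∑ σ, lin (c' t) (v' t) x σ * tiltOne θ (lin (c t) (v t) x) (z t) σ
        + ∑ σ, cov (z' t) (z t) σ σ * tiltOne θ (lin (c t) (v t) x) (z t) σ
        - (1 - θ) * ∑ σ, ∑ τ, cov (z' t) (z t) σ τ *
            tiltTwo θ (lin (c t) (v t) x) (z t) σ τ) ∂stdGaussian I) t := by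
  have hUt := hU.mem_nhds ht
  have hnb : ∀ {E : Type} [NormedAddCommGroup E] {f : ℝ → E}, ContinuousAt f t →
      ∀ᶠ s in 𝓝 t, ‖f s‖ ≤ ‖f t‖ + 1 := fun hf =>
    (hf.norm.eventually_lt continuousAt_const (lt_add_one _)).mono fun _ h => h.le
  set C : ℝ := (‖c' t‖ + 1) + (‖v' t‖ + 1) + (‖z' t‖ + 1) + (‖z t‖ + 1) with hC
  have hV : ∀ᶠ s in 𝓝 t, s ∈ U ∧ ‖c' s‖ ≤ C ∧ ‖v' s‖ ≤ C ∧ ‖z' s‖ ≤ C ∧ ‖z s‖ ≤ C := by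
    have n1 := norm_nonneg (c' t)
    have n2 := norm_nonneg (v' t)
    have n3 := norm_nonneg (z' t)
    have n4 := norm_nonneg (z t)
    filter_upwards [hUt, hnb (hc'.continuousAt hUt), hnb (hv'.continuousAt hUt),
      hnb (hz'.continuousAt hUt), hnb (hz t ht).continuousAt] with s h1 h2 h3 h4 h5
    refine ⟨h1, ?_, ?_, ?_, ?_⟩ <;> rw [hC] <;> linarith
  refine (hasDerivAt_integral_of_dominated_loc_of_deriv_le (μ := stdGaussian I)
    (F := fun s x => Real.log (level θ (fun _ => 1) (lin (c s) (v s) x) (z s)))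
    (F' := fun t x => θ * (∑ σ, lin (c' t) (v' t) x σ * tiltOne θ (lin (c t) (v t) x) (z t) σ
        + ∑ σ, cov (z' t) (z t) σ σ * tiltOne θ (lin (c t) (v t) x) (z t) σ
        - (1 - θ) * ∑ σ, ∑ τ, cov (z' t) (z t) σ τ *
            tiltTwo θ (lin (c t) (v t) x) (z t) σ τ)) hV (Eventually.of_forall fun s => ?_) ?_ ?_
    (bound := fun x => 1 * (∑ _σ : S, (C + C * ∑ i, |x i|)
      + ∑ _σ : S, (Fintype.card L * (C * C) : ℝ)
      + 1 * ∑ _σ : S, ∑ _τ : S, (Fintype.card L * (C * C) : ℝ)))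
    (ae_of_all _ fun x s hs => ?_) ?_ (ae_of_all _ fun x s hs => ?_)).2
  · exact (integrable_log_level hθ _ _ _).aestronglyMeasurable
  · exact integrable_log_level hθ _ _ _
  · refine Continuous.aestronglyMeasurable (continuous_const.mul ?_)
    refine ((continuous_finsetSum _ fun σ _ => ?_).add (continuous_finsetSum _ fun σ _ => ?_)).sub
      (continuous_const.mul
        (continuous_finsetSum _ fun σ _ => continuous_finsetSum _ fun τ _ => ?_))
    · exact ((continuous_apply σ).comp (f := fun x => lin (c' t) (v' t) x) (by fun_prop)).mul
        (continuous_tiltOne hθ σ (by fun_prop) (by fun_prop))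
    · exact continuous_const.mul (continuous_tiltOne hθ σ (by fun_prop) (by fun_prop))
    · exact continuous_const.mul (continuous_tiltTwo hθ σ τ (by fun_prop) (by fun_prop))
  · obtain ⟨-, h1, h2, h3, h4⟩ := hs
    rw [Real.norm_eq_abs, abs_mul, abs_of_nonneg hθ]
    refine mul_le_mul hθ1 ?_ (abs_nonneg _) zero_le_one
    have hmul : ∀ {a b B : ℝ}, |a| ≤ B → |b| ≤ 1 → |a * b| ≤ B := fun ha hb => by
      rw [abs_mul]; exact (mul_le_of_le_one_right (abs_nonneg _) hb).trans ha
    refine (abs_sub _ _).trans (add_le_add ((abs_add_le _ _).trans (add_le_add ?_ ?_)) ?_)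
    · exact (Finset.abs_sum_le_sum_abs _ _).trans (Finset.sum_le_sum fun σ _ =>
        hmul (abs_lin_le h1 h2 x σ) (abs_tiltOne_le hθ _ _ _))
    · exact (Finset.abs_sum_le_sum_abs _ _).trans (Finset.sum_le_sum fun σ _ =>
        hmul (abs_cov_le h3 h4 σ σ) (abs_tiltOne_le hθ _ _ _))
    · rw [abs_mul]
      refine mul_le_mul (abs_le.2 ⟨by linarith, by linarith⟩) ?_ (abs_nonneg _) zero_le_one
      exact (Finset.abs_sum_le_sum_abs _ _).trans (Finset.sum_le_sum fun σ _ =>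
        (Finset.abs_sum_le_sum_abs _ _).trans (Finset.sum_le_sum fun τ _ =>
        hmul (abs_cov_le h3 h4 σ τ) (abs_tiltTwo_le hθ _ _ _ _)))
  · refine (((integrable_finsetSum _ fun σ _ => ?_).add (integrable_const _)).add
      (integrable_const _)).const_mul _
    exact (integrable_const _).add (integrable_sum_abs.const_mul _)
  · exact hasDerivAt_log_level hθ hθ1 hU (e := fun s => lin (c s) (v s) x)
      (e' := fun s => lin (c' s) (v' s) x)
      (fun s hs => hasDerivAt_lin (hc s hs) (hv s hs) x)
      (continuous_lin.comp_continuousOn (hc'.prodMk (hv'.prodMk continuousOn_const)))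
      hz hz' hs.1

/-- Derivative of the two-level free energy along a path of parameters: differentiation under the
integral followed by Gaussian integration by parts at both levels. -/
theorem hasDerivAt_press (hθ : 0 ≤ θ) (hθ1 : θ ≤ 1) {U : Set ℝ} (hU : IsOpen U)
    {c c' : ℝ → S → ℝ} {v v' : ℝ → S → I → ℝ} {z z' : ℝ → S → L → ℝ}
    (hc : ∀ t ∈ U, HasDerivAt c (c' t) t) (hc' : ContinuousOn c' U)
    (hv : ∀ t ∈ U, HasDerivAt v (v' t) t) (hv' : ContinuousOn v' U)
    (hz : ∀ t ∈ U, HasDerivAt z (z' t) t) (hz' : ContinuousOn z' U) {t : ℝ} (ht : t ∈ U) :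
    HasDerivAt (fun t => press θ (c t) (v t) (z t))
      (θ * (∑ σ, (c' t σ + cov (v' t) (v t) σ σ + cov (z' t) (z t) σ σ) *
            meanOne θ (c t) (v t) (z t) σ
        - (1 - θ) * ∑ σ, ∑ τ, (cov (v' t) (v t) σ τ + cov (z' t) (z t) σ τ) *
            meanPair₂ θ (c t) (v t) (z t) σ τ
        - θ * ∑ σ, ∑ τ, cov (v' t) (v t) σ τ * meanPair₁ θ (c t) (v t) (z t) σ τ)) t := by
  refine (hasDerivAt_press_aux hθ hθ1 hU hc hc' hv hv' hz hz' ht).congr_deriv ?_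
  have i1 : ∀ σ, Integrable (fun x => lin (c' t) (v' t) x σ *
      tiltOne θ (lin (c t) (v t) x) (z t) σ) (stdGaussian I) := by
    intro σ
    have : Integrable (fun x => c' t σ * tiltOne θ (lin (c t) (v t) x) (z t) σ +
        ∑ i, v' t σ i * (x i * tiltOne θ (lin (c t) (v t) x) (z t) σ)) (stdGaussian I) :=
      ((integrable_tiltOne hθ _ _ _ _).const_mul _).add (integrable_finsetSum _ fun i _ =>
        (integrable_coord_mul_tiltOne hθ _ _ _ _ i).const_mul _)
    refine this.congr (ae_of_all _ fun x => ?_)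
    simp only [lin, add_mul, Finset.sum_mul]
    congr 1
    exact Finset.sum_congr rfl fun i _ => by ring
  have e1 : ∀ σ, ∫ x, lin (c' t) (v' t) x σ * tiltOne θ (lin (c t) (v t) x) (z t) σ ∂stdGaussian I
      = (c' t σ + cov (v' t) (v t) σ σ) * meanOne θ (c t) (v t) (z t) σ
        - (1 - θ) * ∑ τ, cov (v' t) (v t) σ τ * meanPair₂ θ (c t) (v t) (z t) σ τ
        - θ * ∑ τ, cov (v' t) (v t) σ τ * meanPair₁ θ (c t) (v t) (z t) σ τ := by
    intro σ
    have : ∫ x, lin (c' t) (v' t) x σ * tiltOne θ (lin (c t) (v t) x) (z t) σ ∂stdGaussian I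
        = ∫ x, (c' t σ * tiltOne θ (lin (c t) (v t) x) (z t) σ +
          ∑ i, v' t σ i * (x i * tiltOne θ (lin (c t) (v t) x) (z t) σ)) ∂stdGaussian I := by
      congr 1; ext x
      simp only [lin, add_mul, Finset.sum_mul]
      congr 1
      exact Finset.sum_congr rfl fun i _ => by ring
    rw [this, integral_add ((integrable_tiltOne hθ _ _ _ _).const_mul _)
      (integrable_finsetSum _ fun i _ =>
        (integrable_coord_mul_tiltOne hθ _ _ _ _ i).const_mul _),
      integral_finsetSum _ fun i _ => (integrable_coord_mul_tiltOne hθ _ _ _ _ i).const_mul _]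
    simp only [integral_const_mul, integral_coord_mul_tiltOne hθ hθ1]
    simp only [cov, add_mul, Finset.sum_mul, mul_sub, Finset.sum_sub_distrib, Finset.mul_sum]
    rw [Finset.sum_comm (s := (Finset.univ : Finset I)) (t := (Finset.univ : Finset S)),
      Finset.sum_comm (s := (Finset.univ : Finset I)) (t := (Finset.univ : Finset S))]
    unfold meanOne
    have e2 : ∀ {f f' g g' h h' : ℝ} (a : ℝ), f = f' → g = g' → h = h' →
        a + (f - g - h) = a + f' - g' - h' := by
      intro f f' g g' h h' a h1 h2 h3; rw [h1, h2, h3]; ring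
    exact e2 _ (Finset.sum_congr rfl fun i _ => by ring)
      (Finset.sum_congr rfl fun τ _ => Finset.sum_congr rfl fun i _ => by ring)
      (Finset.sum_congr rfl fun τ _ => Finset.sum_congr rfl fun i _ => by ring)
  have i2 := fun σ => (integrable_tiltOne hθ (c t) (v t) (z t) σ).const_mul (cov (z' t) (z t) σ σ)
  have i3 := fun σ τ => (integrable_tiltTwo hθ (c t) (v t) (z t) σ τ).const_mul
    (cov (z' t) (z t) σ τ)
  have i4 := fun σ => integrable_finsetSum Finset.univ fun τ _ => i3 σ τ
  rw [integral_const_mul, integral_add_sub (integrable_finsetSum _ fun σ _ => i1 σ)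
    (integrable_finsetSum _ fun σ _ => i2 σ)
    ((integrable_finsetSum _ fun σ _ => i4 σ).const_mul (1 - θ)), integral_const_mul,
    integral_finsetSum _ fun σ _ => i1 σ, integral_finsetSum _ fun σ _ => i2 σ,
    integral_finsetSum _ fun σ _ => i4 σ]
  simp only [e1, integral_finsetSum _ fun τ _ => i3 _ τ, integral_const_mul, add_mul,
    Finset.sum_add_distrib, Finset.sum_sub_distrib, ← Finset.mul_sum]
  unfold meanOne meanPair₂
  ring

end

/-! ### Independent sites -/

lemma spin_mul_self (b : Bool) : spin b * spin b = 1 := by unfold spin; split_ifs <;> norm_num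

lemma abs_spin (b : Bool) : |spin b| = 1 := by unfold spin; split_ifs <;> norm_num

section

variable {S L : Type} [Fintype S] [Fintype L] [Nonempty S] {θ : ℝ}

lemma sum_mul_tiltOne (hθ : 0 ≤ θ) (a : S → ℝ) (e : S → ℝ) (z : S → L → ℝ) :
    ∑ σ, a σ * tiltOne θ e z σ = tilt θ (fun h => ∑ σ, a σ * gib h σ) e z := by
  unfold tiltOne tilt level
  have : ∀ y, zf (lin e z y) ^ θ * ∑ σ, a σ * gib (lin e z y) σ =
      ∑ σ, a σ * (zf (lin e z y) ^ θ * gib (lin e z y) σ) := fun y => by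
    rw [Finset.mul_sum]; exact Finset.sum_congr rfl fun σ _ => by ring
  simp only [this]
  rw [integral_finsetSum _ fun σ _ =>
    (integrable_integrand hθ (continuous_gib σ) (fun h => abs_gib_le h σ) e z).const_mul _,
    Finset.sum_div]
  simp only [integral_const_mul, mul_div_assoc]

lemma sum_mul_tiltTwo (hθ : 0 ≤ θ) (a : S → S → ℝ) (e : S → ℝ) (z : S → L → ℝ) :
    ∑ σ, ∑ τ, a σ τ * tiltTwo θ e z σ τ =
      tilt θ (fun h => ∑ σ, ∑ τ, a σ τ * (gib h σ * gib h τ)) e z := by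
  unfold tiltTwo tilt level
  have : ∀ y, zf (lin e z y) ^ θ * ∑ σ, ∑ τ, a σ τ * (gib (lin e z y) σ * gib (lin e z y) τ) =
      ∑ σ, ∑ τ, a σ τ * (zf (lin e z y) ^ θ * (gib (lin e z y) σ * gib (lin e z y) τ)) :=
    fun y => by
      simp only [Finset.mul_sum]
      exact Finset.sum_congr rfl fun σ _ => Finset.sum_congr rfl fun τ _ => by ring
  simp only [this]
  have hi := fun σ τ => (integrable_integrand (w := fun h => gib h σ * gib h τ) hθ (by fun_prop)
    (fun h => abs_gib_mul_gib_le h σ τ) e z).const_mul (a σ τ)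
  rw [integral_finsetSum _ fun σ _ => integrable_finsetSum _ fun τ _ => hi σ τ, Finset.sum_div]
  refine Finset.sum_congr rfl fun σ _ => ?_
  rw [integral_finsetSum _ fun τ _ => hi σ τ, Finset.sum_div]
  simp only [integral_const_mul, mul_div_assoc]

end

/-- `𝔼_y cosh^θ (u + y b)`. -/
def siteZ (θ u b : ℝ) : ℝ := ∫ y, Real.cosh (u + y * b) ^ θ ∂gaussianReal 0 1

/-- `𝔼_y [cosh^θ tanh^k] / 𝔼_y [cosh^θ]` at the field `u + y b`. -/
def siteT (k : ℕ) (θ u b : ℝ) : ℝ :=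
  (∫ y, Real.cosh (u + y * b) ^ θ * Real.tanh (u + y * b) ^ k ∂gaussianReal 0 1) / siteZ θ u b

/-- The one-site two-level free energy `𝔼_x log 𝔼_y cosh^θ (u + x a + y b)`. -/
def sitePress (θ u a b : ℝ) : ℝ := ∫ x, Real.log (siteZ θ (u + x * a) b) ∂gaussianReal 0 1

/-- The one-site magnetization. -/
def siteM (θ u a b : ℝ) : ℝ := ∫ x, siteT 1 θ (u + x * a) b ∂gaussianReal 0 1

/-- The one-site overlap of the first level. -/
def siteQ₁ (θ u a b : ℝ) : ℝ := ∫ x, siteT 1 θ (u + x * a) b ^ 2 ∂gaussianReal 0 1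

/-- The one-site overlap of the second level. -/
def siteQ₂ (θ u a b : ℝ) : ℝ := ∫ x, siteT 2 θ (u + x * a) b ∂gaussianReal 0 1

section

variable {ι : Type} [Fintype ι] [DecidableEq ι] {θ : ℝ}

/-- The energies of independent spins in the fields `u`. -/
def fieldE (u : ι → ℝ) (σ : ι → Bool) : ℝ := ∑ i, u i * spin (σ i)

/-- The couplings of independent spins to site-dependent Gaussian fields of amplitude `b`. -/
def spinC (b : ℝ) (σ : ι → Bool) (i : ι) : ℝ := b * spin (σ i)

@[fun_prop]
lemma continuous_fieldE : Continuous (fieldE : (ι → ℝ) → (ι → Bool) → ℝ) := by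
  unfold fieldE; fun_prop

@[fun_prop]
lemma continuous_spinC : Continuous (spinC : ℝ → (ι → Bool) → ι → ℝ) := by
  unfold spinC; fun_prop

lemma lin_fieldE (u : ι → ℝ) (b : ℝ) (y : ι → ℝ) :
    lin (fieldE u) (spinC b) y = fieldE fun i => u i + y i * b := by
  ext σ
  simp only [lin, fieldE, spinC, ← Finset.sum_add_distrib]
  exact Finset.sum_congr rfl fun i _ => by ring

lemma sum_exp_fieldE_mul_prod (h : ι → ℝ) (f : ι → Bool → ℝ) :
    ∑ σ, Real.exp (fieldE h σ) * ∏ i, f i (σ i) =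
      ∏ i, (Real.exp (h i) * f i true + Real.exp (-h i) * f i false) := by
  have : ∀ σ : ι → Bool, Real.exp (fieldE h σ) * ∏ i, f i (σ i) =
      ∏ i, Real.exp (h i * spin (σ i)) * f i (σ i) := fun σ => by
    rw [fieldE, Real.exp_sum, Finset.prod_mul_distrib]
  simp only [this]
  rw [← Fintype.prod_sum (f := fun i s => Real.exp (h i * spin s) * f i s)]
  refine Finset.prod_congr rfl fun i _ => ?_
  simp [spin]

lemma zf_fieldE (h : ι → ℝ) : zf (fieldE h) = ∏ i, (2 * Real.cosh (h i)) := by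
  have := sum_exp_fieldE_mul_prod h fun _ _ => 1
  simp only [Finset.prod_const_one, mul_one] at this
  rw [zf, this]
  exact Finset.prod_congr rfl fun i _ => by rw [Real.cosh_eq]; ring

lemma sum_spin_mul_gib_fieldE (h : ι → ℝ) (i : ι) :
    ∑ σ, spin (σ i) * gib (fieldE h) σ = Real.tanh (h i) := by
  have h1 := sum_exp_fieldE_mul_prod h fun j s => if j = i then spin s else 1
  have h2 : ∀ σ : ι → Bool, ∏ j, (if j = i then spin (σ j) else 1) = spin (σ i) := fun σ => by
    rw [Finset.prod_ite_eq' Finset.univ i fun j => spin (σ j)]; simp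
  have h3 : ∀ j, (Real.exp (h j) * (if j = i then spin true else 1) +
      Real.exp (-h j) * (if j = i then spin false else 1)) =
      (2 * Real.cosh (h j)) * (if j = i then Real.tanh (h j) else 1) := by
    intro j
    rw [Real.tanh_eq_sinh_div_cosh]
    have := (Real.cosh_pos (h j)).ne'
    split_ifs
    · field_simp
      rw [Real.sinh_eq]; simp [spin]; ring
    · rw [Real.cosh_eq]; ring
  simp only [h2, h3, Finset.prod_mul_distrib] at h1
  rw [Finset.prod_ite_eq' Finset.univ i fun j => Real.tanh (h j), if_pos (Finset.mem_univ i),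
    ← Finset.prod_mul_distrib, ← zf_fieldE] at h1
  unfold gib
  simp only [← mul_div_assoc]
  rw [← Finset.sum_div, div_eq_iff (zf_pos _).ne', mul_comm (Real.tanh _), ← h1]
  exact Finset.sum_congr rfl fun σ _ => mul_comm _ _

/-- The magnetization of the site `i`, as a function of the energies. -/
def siteMag (i : ι) (h : (ι → Bool) → ℝ) : ℝ := ∑ σ, spin (σ i) * gib h σ

@[fun_prop]
lemma continuous_siteMag (i : ι) : Continuous (siteMag i) := by unfold siteMag; fun_prop

lemma abs_siteMag_le (i : ι) (h : (ι → Bool) → ℝ) : |siteMag i h| ≤ 1 := by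
  unfold siteMag
  refine (Finset.abs_sum_le_sum_abs _ _).trans ?_
  rw [← sum_gib h]
  refine Finset.sum_le_sum fun σ _ => ?_
  rw [abs_mul, abs_spin, one_mul, abs_of_nonneg (gib_nonneg h σ)]

lemma abs_siteMag_pow_le (i : ι) (k : ℕ) (h : (ι → Bool) → ℝ) : |siteMag i h ^ k| ≤ 1 := by
  rw [abs_pow]
  exact pow_le_one₀ (abs_nonneg _) (abs_siteMag_le i h)

lemma level_fieldE_one (u : ι → ℝ) (b : ℝ) :
    level θ (fun _ => 1) (fieldE u) (spinC b) = ∏ i, (2 ^ θ * siteZ θ (u i) b) := by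
  unfold level siteZ
  have : ∀ y : ι → ℝ, zf (lin (fieldE u) (spinC b) y) ^ θ * 1 =
      ∏ i, (2 ^ θ * Real.cosh (u i + y i * b) ^ θ) := fun y => by
    rw [lin_fieldE, zf_fieldE, mul_one, ← Real.finsetProd_rpow _ _ fun i _ => by positivity]
    exact Finset.prod_congr rfl fun i _ =>
      Real.mul_rpow zero_le_two (Real.cosh_pos _).le
  simp only [this, stdGaussian]
  rw [integral_fintype_prod_eq_prod (fun (i : ι) (s : ℝ) => 2 ^ θ * Real.cosh (u i + s * b) ^ θ)]
  simp only [integral_const_mul]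

lemma siteZ_pos (hθ : 0 ≤ θ) (u b : ℝ) : 0 < siteZ θ u b := by
  have h := level_one_pos (S := Unit → Bool) (L := Unit) hθ (fieldE fun _ => u) (spinC b)
  rw [level_fieldE_one] at h
  simp only [Finset.univ_unique, Finset.prod_singleton] at h
  exact pos_of_mul_pos_right h (by positivity)

/-- For independent spins the tilted moments of the magnetization of a site are one-site integrals:
the factors of the other sites cancel. -/
lemma tilt_siteMag_pow (hθ : 0 ≤ θ) (k : ℕ) (u : ι → ℝ) (b : ℝ) (i : ι) :
    tilt θ (fun h => siteMag i h ^ k) (fieldE u) (spinC b) = siteT k θ (u i) b := by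
  have h0 := level_one_pos hθ (fieldE u) (spinC b)
  unfold tilt
  rw [div_eq_iff h0.ne', level_fieldE_one]
  unfold level
  have : ∀ y : ι → ℝ, zf (lin (fieldE u) (spinC b) y) ^ θ *
      siteMag i (lin (fieldE u) (spinC b) y) ^ k =
      ∏ j, (2 ^ θ * (Real.cosh (u j + y j * b) ^ θ *
        if j = i then Real.tanh (u j + y j * b) ^ k else 1)) := fun y => by
    rw [lin_fieldE, zf_fieldE, siteMag, sum_spin_mul_gib_fieldE,
      ← Real.finsetProd_rpow _ _ fun i _ => by positivity]
    simp only [← mul_assoc]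
    rw [Finset.prod_mul_distrib,
      Finset.prod_ite_eq' Finset.univ i fun j => Real.tanh (u j + y j * b) ^ k,
      if_pos (Finset.mem_univ i)]
    congr 1
    exact Finset.prod_congr rfl fun i _ =>
      Real.mul_rpow zero_le_two (Real.cosh_pos _).le
  simp only [this, stdGaussian]
  rw [integral_fintype_prod_eq_prod (fun (j : ι) (s : ℝ) => 2 ^ θ *
    (Real.cosh (u j + s * b) ^ θ * if j = i then Real.tanh (u j + s * b) ^ k else 1))]
  simp only [integral_const_mul]
  have h1 : ∀ j, 2 ^ θ * ∫ s, (Real.cosh (u j + s * b) ^ θ *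
      if j = i then Real.tanh (u j + s * b) ^ k else 1) ∂gaussianReal 0 1 =
      (2 ^ θ * siteZ θ (u j) b) * if j = i then siteT k θ (u j) b else 1 := by
    intro j
    split_ifs with hj
    · rw [siteT, mul_assoc, mul_div_cancel₀ _ (siteZ_pos hθ _ _).ne']
    · simp only [mul_one, siteZ]
  simp only [h1]
  rw [Finset.prod_mul_distrib, Finset.prod_ite_eq' Finset.univ i fun j => siteT k θ (u j) b,
    if_pos (Finset.mem_univ i), mul_comm]

lemma abs_siteT_le (hθ : 0 ≤ θ) (k : ℕ) (u b : ℝ) : |siteT k θ u b| ≤ 1 := by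
  rw [← tilt_siteMag_pow hθ k (fun _ : Unit => u) b ()]
  exact abs_tilt_le hθ (fun h => abs_siteMag_pow_le () k h) _ _

lemma continuous_siteT (hθ : 0 ≤ θ) (k : ℕ) :
    Continuous fun p : ℝ × ℝ => siteT k θ p.1 p.2 := by
  simp only [← fun u b => tilt_siteMag_pow hθ k (fun _ : Unit => u) b ()]
  exact Continuous.tilt' hθ (w := fun h => siteMag () h ^ k) (by fun_prop)
    (fun h => abs_siteMag_pow_le () k h) (by fun_prop) (by fun_prop)

lemma log_level_fieldE (hθ : 0 ≤ θ) (u : ι → ℝ) (b : ℝ) :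
    Real.log (level θ (fun _ => 1) (fieldE u) (spinC b)) =
      ∑ i, (θ * Real.log 2 + Real.log (siteZ θ (u i) b)) := by
  rw [level_fieldE_one, Real.log_prod fun i _ =>
    (mul_pos (by positivity) (siteZ_pos hθ _ _)).ne']
  refine Finset.sum_congr rfl fun i _ => ?_
  rw [Real.log_mul (by positivity) (siteZ_pos hθ _ _).ne', Real.log_rpow zero_lt_two]

lemma integrable_log_siteZ (hθ : 0 ≤ θ) (u a b : ℝ) :
    Integrable (fun x => Real.log (siteZ θ (u + x * a) b)) (gaussianReal 0 1) := by
  have h := integrable_log_level hθ (fieldE fun _ : Unit => u) (spinC a) (spinC (ι := Unit) b)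
  simp only [lin_fieldE, log_level_fieldE hθ, Finset.univ_unique, Finset.sum_singleton] at h
  have mp := measurePreserving_eval (fun _ : Unit => gaussianReal 0 1) ()
  have h2 := (mp.integrable_comp_emb (MeasurableEquiv.funUnique Unit ℝ).measurableEmbedding
    (g := fun x => θ * Real.log 2 + Real.log (siteZ θ (u + x * a) b))).1 h
  refine (h2.sub (integrable_const (θ * Real.log 2))).congr (ae_of_all _ fun x => ?_)
  simp

/-- The two-level free energy of independent sites. -/
lemma press_fieldE (hθ : 0 ≤ θ) (u : ι → ℝ) (a b : ℝ) :
    press θ (fieldE u) (spinC a) (spinC (ι := ι) b) =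
      ∑ i, (θ * Real.log 2 + sitePress θ (u i) a b) := by
  unfold press
  simp only [lin_fieldE, log_level_fieldE hθ, stdGaussian]
  have hi : ∀ i, Integrable (fun s => θ * Real.log 2 + Real.log (siteZ θ (u i + s * a) b))
      (gaussianReal 0 1) := fun i => (integrable_const _).add (integrable_log_siteZ hθ _ _ _)
  rw [integral_finsetSum _ fun i _ => integrable_comp_eval (i := i) (hi i)]
  refine Finset.sum_congr rfl fun i _ => ?_
  rw [integral_comp_eval (μ := fun _ : ι => gaussianReal 0 1) (i := i)
    (hi i).aestronglyMeasurable, integral_add (integrable_const _) (integrable_log_siteZ hθ _ _ _)]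
  simp [sitePress]

lemma integral_siteT_pow (hθ : 0 ≤ θ) (k l : ℕ) (u : ι → ℝ) (a b : ℝ) (i : ι) :
    ∫ x, tilt θ (fun h => siteMag i h ^ k) (lin (fieldE u) (spinC a) x) (spinC b) ^ l
        ∂stdGaussian ι = ∫ x, siteT k θ (u i + x * a) b ^ l ∂gaussianReal 0 1 := by
  simp only [lin_fieldE, tilt_siteMag_pow hθ, stdGaussian]
  have hc : Continuous fun s => siteT k θ (u i + s * a) b ^ l :=
    ((continuous_siteT hθ k).comp (f := fun s => (u i + s * a, b)) (by fun_prop)).pow l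
  exact integral_comp_eval (μ := fun _ : ι => gaussianReal 0 1) (i := i)
    (f := fun s => siteT k θ (u i + s * a) b ^ l) hc.aestronglyMeasurable

lemma continuous_integral_siteT (hθ : 0 ≤ θ) (k l : ℕ) :
    Continuous fun p : ℝ × ℝ × ℝ =>
      ∫ x, siteT k θ (p.1 + x * p.2.1) p.2.2 ^ l ∂gaussianReal 0 1 := by
  simp only [← fun u a b => integral_siteT_pow (ι := Unit) hθ k l (fun _ => u) a b ()]
  refine (continuous_integral_lin (f := fun p : ((Unit → Bool) → ℝ) × ((Unit → Bool) → Unit → ℝ) =>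
    tilt θ (fun h => siteMag () h ^ k) p.1 p.2 ^ l) ?_ fun p => ?_).comp
    (f := fun p : ℝ × ℝ × ℝ => (fieldE fun _ : Unit => p.1, spinC (ι := Unit) p.2.1,
      spinC (ι := Unit) p.2.2)) (by fun_prop)
  · exact (continuous_tilt hθ (by fun_prop) fun h => abs_siteMag_pow_le () k h).pow l
  · rw [abs_pow]
    exact pow_le_one₀ (abs_nonneg _) (abs_tilt_le hθ (fun h => abs_siteMag_pow_le () k h) _ _)

lemma continuous_siteM (hθ : 0 ≤ θ) : Continuous fun p : ℝ × ℝ × ℝ => siteM θ p.1 p.2.1 p.2.2 := by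
  simpa [siteM] using continuous_integral_siteT hθ 1 1

lemma continuous_siteQ₁ (hθ : 0 ≤ θ) :
    Continuous fun p : ℝ × ℝ × ℝ => siteQ₁ θ p.1 p.2.1 p.2.2 :=
  continuous_integral_siteT hθ 1 2

lemma continuous_siteQ₂ (hθ : 0 ≤ θ) :
    Continuous fun p : ℝ × ℝ × ℝ => siteQ₂ θ p.1 p.2.1 p.2.2 := by
  simpa [siteQ₂] using continuous_integral_siteT hθ 2 1

lemma continuous_sitePress (hθ : 0 ≤ θ) :
    Continuous fun p : ℝ × ℝ × ℝ => sitePress θ p.1 p.2.1 p.2.2 := by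
  have h : ∀ u a b, sitePress θ u a b = press θ (fieldE fun _ : Unit => u) (spinC a)
      (spinC (ι := Unit) b) - θ * Real.log 2 := fun u a b => by
    rw [press_fieldE hθ]; simp
  simp only [h]
  exact ((continuous_press hθ).comp (f := fun p : ℝ × ℝ × ℝ => (fieldE fun _ : Unit => p.1,
    spinC (ι := Unit) p.2.1, spinC (ι := Unit) p.2.2)) (by fun_prop)).sub continuous_const

/-! Averages of single-site observables under the two-level measure, for general energies. -/

lemma sum_spin_mul_tiltOne {L : Type} [Fintype L] (hθ : 0 ≤ θ) (e : (ι → Bool) → ℝ)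
    (z : (ι → Bool) → L → ℝ) (i : ι) :
    ∑ σ, spin (σ i) * tiltOne θ e z σ = tilt θ (fun h => siteMag i h ^ 1) e z := by
  rw [sum_mul_tiltOne hθ]
  simp only [pow_one]
  rfl

lemma sum_spin_mul_tiltTwo {L : Type} [Fintype L] (hθ : 0 ≤ θ) (e : (ι → Bool) → ℝ)
    (z : (ι → Bool) → L → ℝ) (i : ι) :
    ∑ σ, ∑ τ, spin (σ i) * spin (τ i) * tiltTwo θ e z σ τ =
      tilt θ (fun h => siteMag i h ^ 2) e z := by
  rw [sum_mul_tiltTwo hθ]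
  congr 1; ext h
  rw [sq, siteMag, Finset.sum_mul_sum]
  exact Finset.sum_congr rfl fun σ _ => Finset.sum_congr rfl fun τ _ => by ring

lemma sum_spin_mul_meanOne {I L : Type} [Fintype I] [Fintype L] (hθ : 0 ≤ θ)
    (c : (ι → Bool) → ℝ) (v : (ι → Bool) → I → ℝ) (z : (ι → Bool) → L → ℝ) (i : ι) :
    ∑ σ, spin (σ i) * meanOne θ c v z σ =
      ∫ x, tilt θ (fun h => siteMag i h ^ 1) (lin c v x) z ∂stdGaussian I := by
  simp only [← sum_spin_mul_tiltOne hθ]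
  rw [integral_finsetSum _ fun σ _ => (integrable_tiltOne hθ c v z σ).const_mul _]
  simp only [integral_const_mul, meanOne]

lemma sum_spin_mul_meanPair₁ {I L : Type} [Fintype I] [Fintype L] (hθ : 0 ≤ θ)
    (c : (ι → Bool) → ℝ) (v : (ι → Bool) → I → ℝ) (z : (ι → Bool) → L → ℝ) (i : ι) :
    ∑ σ, ∑ τ, spin (σ i) * spin (τ i) * meanPair₁ θ c v z σ τ =
      ∫ x, tilt θ (fun h => siteMag i h ^ 1) (lin c v x) z ^ 2 ∂stdGaussian I := by
  simp only [← sum_spin_mul_tiltOne hθ, sq, Finset.sum_mul_sum]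
  have h := fun σ τ : ι → Bool => (integrable_tiltOne_mul hθ c v z σ τ).const_mul
    (spin (σ i) * spin (τ i))
  have h' : ∀ x : I → ℝ, ∀ σ τ : ι → Bool, spin (σ i) * tiltOne θ (lin c v x) z σ *
      (spin (τ i) * tiltOne θ (lin c v x) z τ) = spin (σ i) * spin (τ i) *
      (tiltOne θ (lin c v x) z σ * tiltOne θ (lin c v x) z τ) := fun x σ τ => by ring
  simp only [h']
  rw [integral_finsetSum _ fun σ _ => integrable_finsetSum _ fun τ _ => h σ τ]
  simp only [integral_finsetSum _ fun τ _ => h _ τ, integral_const_mul, meanPair₁]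

lemma sum_spin_mul_meanPair₂ {I L : Type} [Fintype I] [Fintype L] (hθ : 0 ≤ θ)
    (c : (ι → Bool) → ℝ) (v : (ι → Bool) → I → ℝ) (z : (ι → Bool) → L → ℝ) (i : ι) :
    ∑ σ, ∑ τ, spin (σ i) * spin (τ i) * meanPair₂ θ c v z σ τ =
      ∫ x, tilt θ (fun h => siteMag i h ^ 2) (lin c v x) z ∂stdGaussian I := by
  simp only [← sum_spin_mul_tiltTwo hθ]
  have h := fun σ τ : ι → Bool => (integrable_tiltTwo hθ c v z σ τ).const_mul
    (spin (σ i) * spin (τ i))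
  rw [integral_finsetSum _ fun σ _ => integrable_finsetSum _ fun τ _ => h σ τ]
  simp only [integral_finsetSum _ fun τ _ => h _ τ, integral_const_mul, meanPair₂]

lemma sum_meanOne {S I L : Type} [Fintype S] [Nonempty S] [Fintype I] [Fintype L] (hθ : 0 ≤ θ)
    (c : S → ℝ) (v : S → I → ℝ) (z : S → L → ℝ) : ∑ σ, meanOne θ c v z σ = 1 := by
  unfold meanOne
  rw [← integral_finsetSum _ fun σ _ => integrable_tiltOne hθ c v z σ]
  simp [sum_tiltOne hθ]

lemma sum_spin_fieldE_meanOne (hθ : 0 ≤ θ) (u : ι → ℝ) (a b : ℝ) (i : ι) :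
    ∑ σ, spin (σ i) * meanOne θ (fieldE u) (spinC a) (spinC (ι := ι) b) σ = siteM θ (u i) a b := by
  rw [sum_spin_mul_meanOne hθ]
  simpa [siteM] using integral_siteT_pow hθ 1 1 u a b i

lemma sum_spin_fieldE_meanPair₁ (hθ : 0 ≤ θ) (u : ι → ℝ) (a b : ℝ) (i : ι) :
    ∑ σ, ∑ τ, spin (σ i) * spin (τ i) *
      meanPair₁ θ (fieldE u) (spinC a) (spinC (ι := ι) b) σ τ = siteQ₁ θ (u i) a b := by
  rw [sum_spin_mul_meanPair₁ hθ]
  exact integral_siteT_pow hθ 1 2 u a b i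

lemma sum_spin_fieldE_meanPair₂ (hθ : 0 ≤ θ) (u : ι → ℝ) (a b : ℝ) (i : ι) :
    ∑ σ, ∑ τ, spin (σ i) * spin (τ i) *
      meanPair₂ θ (fieldE u) (spinC a) (spinC (ι := ι) b) σ τ = siteQ₂ θ (u i) a b := by
  rw [sum_spin_mul_meanPair₂ hθ]
  simpa [siteQ₂] using integral_siteT_pow hθ 2 1 u a b i

end

/-- Derivative of the one-site free energy along a path of parameters. -/
lemma hasDerivAt_sitePress {θ : ℝ} (hθ : 0 ≤ θ) (hθ1 : θ ≤ 1) {U : Set ℝ} (hU : IsOpen U)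
    {u u' a a' b b' : ℝ → ℝ} (hu : ∀ t ∈ U, HasDerivAt u (u' t) t) (hu' : ContinuousOn u' U)
    (ha : ∀ t ∈ U, HasDerivAt a (a' t) t) (ha' : ContinuousOn a' U)
    (hb : ∀ t ∈ U, HasDerivAt b (b' t) t) (hb' : ContinuousOn b' U) {t : ℝ} (ht : t ∈ U) :
    HasDerivAt (fun t => sitePress θ (u t) (a t) (b t))
      (θ * (u' t * siteM θ (u t) (a t) (b t)
        + (a' t * a t + b' t * b t) * (1 - (1 - θ) * siteQ₂ θ (u t) (a t) (b t))
        - a' t * a t * (θ * siteQ₁ θ (u t) (a t) (b t)))) t := by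
  have key : ∀ {f f' : ℝ → ℝ} (s : Unit → Bool) {t : ℝ}, HasDerivAt f (f' t) t →
      HasDerivAt (fun t => spinC (ι := Unit) (f t) s) (spinC (f' t) s) t := fun s t h =>
    hasDerivAt_pi.2 fun _ => h.mul_const _
  have h := (hasDerivAt_press (S := Unit → Bool) (I := Unit) (L := Unit) hθ hθ1 hU
    (c := fun t => fieldE fun _ : Unit => u t) (c' := fun t => fieldE fun _ : Unit => u' t)
    (v := fun t => spinC (a t)) (v' := fun t => spinC (a' t))
    (z := fun t => spinC (b t)) (z' := fun t => spinC (b' t))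
    (fun t ht => hasDerivAt_pi.2 fun s => by
      simpa [fieldE] using (hu t ht).mul_const (spin (s ())))
    (continuous_fieldE.comp_continuousOn (continuousOn_pi.2 fun _ => hu'))
    (fun t ht => hasDerivAt_pi.2 fun s => key s (ha t ht))
    (continuous_spinC.comp_continuousOn ha')
    (fun t ht => hasDerivAt_pi.2 fun s => key s (hb t ht))
    (continuous_spinC.comp_continuousOn hb') ht).sub_const (θ * Real.log 2)
  have e : ∀ t, press θ (fieldE fun _ : Unit => u t) (spinC (a t)) (spinC (ι := Unit) (b t)) -
      θ * Real.log 2 = sitePress θ (u t) (a t) (b t) := fun t => by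
    rw [press_fieldE hθ]; simp
  simp only [e] at h
  refine h.congr_deriv ?_
  have hcov : ∀ (p p' : ℝ) (σ τ : Unit → Bool), cov (spinC p') (spinC p) σ τ =
      p' * p * (spin (σ ()) * spin (τ ())) := fun p p' σ τ => by simp [cov, spinC]; ring
  have e1 := sum_spin_fieldE_meanOne hθ (fun _ : Unit => u t) (a t) (b t) ()
  have e2 := sum_spin_fieldE_meanPair₁ hθ (fun _ : Unit => u t) (a t) (b t) ()
  have e3 := sum_spin_fieldE_meanPair₂ hθ (fun _ : Unit => u t) (a t) (b t) ()
  have e4 := sum_meanOne hθ (fieldE fun _ : Unit => u t) (spinC (a t)) (spinC (ι := Unit) (b t))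
  have hf : ∀ (p : ℝ) (σ : Unit → Bool), fieldE (fun _ => p) σ = p * spin (σ ()) :=
    fun p σ => by simp [fieldE]
  rw [← e1, ← e2, ← e3]
  simp only [hcov, hf (u' t), spin_mul_self, mul_one, add_mul]
  simp only [mul_assoc, Finset.sum_add_distrib, ← Finset.mul_sum, e4]
  ring

/-! ### The one-site free energy in terms of the field variances -/

/-- Mean value theorem for the one-site free energy on a segment of fields and variances. In the
interior of the segment a variance is positive, or else it vanishes identically. -/
lemma sitePress_sub_eq {θ : ℝ} (hθ : 0 ≤ θ) (hθ1 : θ ≤ 1) (u₀ u₁ : ℝ) {A₀ A₁ B₀ B₁ : ℝ}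
    (hA₀ : 0 ≤ A₀) (hA₁ : 0 ≤ A₁) (hB₀ : 0 ≤ B₀) (hB₁ : 0 ≤ B₁) :
    ∃ s ∈ Set.Ioo (0 : ℝ) 1, sitePress θ u₁ √A₁ √B₁ - sitePress θ u₀ √A₀ √B₀ =
      θ * ((u₁ - u₀) *
          siteM θ (u₀ + s * (u₁ - u₀)) √(A₀ + s * (A₁ - A₀)) √(B₀ + s * (B₁ - B₀))
        + ((A₁ - A₀) / 2 + (B₁ - B₀) / 2) * (1 - (1 - θ) *
          siteQ₂ θ (u₀ + s * (u₁ - u₀)) √(A₀ + s * (A₁ - A₀)) √(B₀ + s * (B₁ - B₀)))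
        - (A₁ - A₀) / 2 * (θ *
          siteQ₁ θ (u₀ + s * (u₁ - u₀)) √(A₀ + s * (A₁ - A₀)) √(B₀ + s * (B₁ - B₀)))) := by
  have hlin : ∀ {A₀ A₁ : ℝ}, 0 ≤ A₀ → 0 ≤ A₁ → ∀ s ∈ Set.Ioo (0 : ℝ) 1,
      (A₀ = 0 ∧ A₁ = 0) ∨ 0 < A₀ + s * (A₁ - A₀) := by
    intro A₀ A₁ h0 h1 s hs
    rcases h0.eq_or_lt with h0 | h0
    · rcases h1.eq_or_lt with h1 | h1
      · exact Or.inl ⟨h0.symm, h1.symm⟩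
      · right; rw [← h0, sub_zero, zero_add]; exact mul_pos hs.1 h1
    · right; nlinarith [mul_pos (sub_pos.2 hs.2) h0, mul_nonneg hs.1.le h1]
  -- For two vanishing variances the quotient below is `0 / 0 = 0`, the derivative of a constant.
  have hder : ∀ {A₀ A₁ : ℝ}, 0 ≤ A₀ → 0 ≤ A₁ → ∀ s ∈ Set.Ioo (0 : ℝ) 1,
      HasDerivAt (fun s => √(A₀ + s * (A₁ - A₀))) ((A₁ - A₀) / (2 * √(A₀ + s * (A₁ - A₀)))) s := by
    intro A₀ A₁ h0 h1 s hs
    rcases hlin h0 h1 s hs with ⟨rfl, rfl⟩ | h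
    · simpa using hasDerivAt_const s (0 : ℝ)
    · have := (((hasDerivAt_id s).mul_const (A₁ - A₀)).const_add A₀).sqrt h.ne'
      simpa using this
  have hcont : ∀ {A₀ A₁ : ℝ}, 0 ≤ A₀ → 0 ≤ A₁ →
      ContinuousOn (fun s => (A₁ - A₀) / (2 * √(A₀ + s * (A₁ - A₀)))) (Set.Ioo (0 : ℝ) 1) := by
    intro A₀ A₁ h0 h1
    by_cases h : A₀ = 0 ∧ A₁ = 0
    · rw [h.1, h.2]; simpa using continuousOn_const
    · refine continuousOn_const.div (by fun_prop) fun s hs => ?_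
      have := Real.sqrt_pos.2 ((hlin h0 h1 s hs).resolve_left h)
      positivity
  have hmul : ∀ {A₀ A₁ : ℝ}, 0 ≤ A₀ → 0 ≤ A₁ → ∀ s ∈ Set.Ioo (0 : ℝ) 1,
      (A₁ - A₀) / (2 * √(A₀ + s * (A₁ - A₀))) * √(A₀ + s * (A₁ - A₀)) = (A₁ - A₀) / 2 := by
    intro A₀ A₁ h0 h1 s hs
    rcases hlin h0 h1 s hs with ⟨rfl, rfl⟩ | h
    · simp
    · have := (Real.sqrt_pos.2 h).ne'
      rw [div_mul_eq_mul_div, mul_div_mul_right _ _ this]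
  obtain ⟨s, hs, h⟩ := exists_hasDerivAt_eq_slope
    (fun s => sitePress θ (u₀ + s * (u₁ - u₀)) √(A₀ + s * (A₁ - A₀)) √(B₀ + s * (B₁ - B₀))) _
    one_pos
    (((continuous_sitePress hθ).comp (f := fun s : ℝ => (u₀ + s * (u₁ - u₀),
      √(A₀ + s * (A₁ - A₀)), √(B₀ + s * (B₁ - B₀)))) (by fun_prop)).continuousOn)
    (fun s hs => hasDerivAt_sitePress hθ hθ1 (U := Set.Ioo 0 1) isOpen_Ioo
      (u := fun s => u₀ + s * (u₁ - u₀)) (u' := fun _ => u₁ - u₀)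
      (fun s _ => by simpa using ((hasDerivAt_id s).mul_const (u₁ - u₀)).const_add u₀)
      continuousOn_const (hder hA₀ hA₁) (hcont hA₀ hA₁) (hder hB₀ hB₁) (hcont hB₀ hB₁) hs)
  refine ⟨s, hs, ?_⟩
  rw [hmul hA₀ hA₁ s hs, hmul hB₀ hB₁ s hs] at h
  rw [h]
  simp

/-- Chain rule for the one-site free energy as a function of the field and of the variances of the
Gaussian fields. The variances may vanish, where the square roots are not differentiable. -/
lemma hasDerivAt_sitePress_sqrt {θ : ℝ} (hθ : 0 ≤ θ) (hθ1 : θ ≤ 1) {u A B : ℝ → ℝ}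
    {u' A' B' J : ℝ} (hu : HasDerivAt u u' J) (hA : HasDerivAt A A' J) (hB : HasDerivAt B B' J)
    (hA0 : ∀ᶠ x in 𝓝 J, 0 ≤ A x) (hB0 : ∀ᶠ x in 𝓝 J, 0 ≤ B x) :
    HasDerivAt (fun x => sitePress θ (u x) √(A x) √(B x))
      (θ * (u' * siteM θ (u J) √(A J) √(B J)
        + (A' / 2 + B' / 2) * (1 - (1 - θ) * siteQ₂ θ (u J) √(A J) √(B J))
        - A' / 2 * (θ * siteQ₁ θ (u J) √(A J) √(B J)))) J := by
  have hex : ∀ x, ∃ s ∈ Set.Ioo (0 : ℝ) 1, 0 ≤ A x → 0 ≤ B x →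
      sitePress θ (u x) √(A x) √(B x) - sitePress θ (u J) √(A J) √(B J) =
      θ * ((u x - u J) *
          siteM θ (u J + s * (u x - u J)) √(A J + s * (A x - A J)) √(B J + s * (B x - B J))
        + ((A x - A J) / 2 + (B x - B J) / 2) * (1 - (1 - θ) *
          siteQ₂ θ (u J + s * (u x - u J)) √(A J + s * (A x - A J)) √(B J + s * (B x - B J)))
        - (A x - A J) / 2 * (θ * siteQ₁ θ (u J + s * (u x - u J))
          √(A J + s * (A x - A J)) √(B J + s * (B x - B J)))) := by
    intro x
    by_cases h : 0 ≤ A x ∧ 0 ≤ B x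
    · obtain ⟨s, hs, e⟩ := sitePress_sub_eq hθ hθ1 (u J) (u x) hA0.self_of_nhds h.1
        hB0.self_of_nhds h.2
      exact ⟨s, hs, fun _ _ => e⟩
    · exact ⟨1 / 2, by norm_num, fun h1 h2 => absurd ⟨h1, h2⟩ h⟩
  -- The increments are evaluated at intermediate points, which converge to the end point.
  choose s hs e using hex
  have hlim : ∀ {f : ℝ → ℝ} {f' : ℝ}, HasDerivAt f f' J →
      Tendsto (fun x => f J + s x * (f x - f J)) (𝓝[≠] J) (𝓝 (f J)) := by
    intro f f' hf
    have h0 : Tendsto (fun x => f x - f J) (𝓝[≠] J) (𝓝 0) := by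
      have h : Tendsto f (𝓝[≠] J) (𝓝 (f J)) :=
        hf.continuousAt.tendsto.mono_left nhdsWithin_le_nhds
      simpa using h.sub_const (f J)
    have h1 : Tendsto (fun x => s x * (f x - f J)) (𝓝[≠] J) (𝓝 0) := by
      refine squeeze_zero_norm (fun x => ?_) (tendsto_norm_zero.comp h0)
      rw [norm_mul, Real.norm_eq_abs, abs_of_pos (hs x).1]
      exact mul_le_of_le_one_left (norm_nonneg _) (hs x).2.le
    simpa using h1.const_add (f J)
  have hpt : Tendsto (fun x => (u J + s x * (u x - u J), √(A J + s x * (A x - A J)),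
      √(B J + s x * (B x - B J)))) (𝓝[≠] J) (𝓝 (u J, √(A J), √(B J))) :=
    (hlim hu).prodMk_nhds ((hlim hA).sqrt.prodMk_nhds (hlim hB).sqrt)
  have hM := ((continuous_siteM hθ).tendsto _).comp hpt
  have hQ₁ := ((continuous_siteQ₁ hθ).tendsto _).comp hpt
  have hQ₂ := ((continuous_siteQ₂ hθ).tendsto _).comp hpt
  simp only [Function.comp_def] at hM hQ₁ hQ₂
  rw [hasDerivAt_iff_tendsto_slope] at hu hA hB ⊢
  refine Tendsto.congr' ?_ ((((hu.mul hM).add (((hA.div_const 2).add (hB.div_const 2)).mul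
    ((hQ₂.const_mul (1 - θ)).const_sub 1))).sub
    ((hA.div_const 2).mul (hQ₁.const_mul θ))).const_mul θ)
  filter_upwards [nhdsWithin_le_nhds hA0, nhdsWithin_le_nhds hB0] with x h1 h2
  have := e x h1 h2
  simp only [slope_def_field] at this ⊢
  rw [this]
  ring

/-! ### Limit lemmas -/

/-- Concentration of `X` at `q` in mean square yields the limits of the means of quantities close
to `X ^ P`. -/
lemma tendsto_sum_of_sq {Ω : ℕ → Type} [∀ N, Fintype (Ω N)] {p X Y : ∀ N, Ω N → ℝ} {q : ℝ}
    (P : ℕ) (hp : ∀ N ω, 0 ≤ p N ω) (hp1 : ∀ N, ∑ ω, p N ω = 1)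
    (hX : ∀ N ω, |X N ω| ≤ 1) {δ : ℕ → ℝ} (hδ : Tendsto δ atTop (𝓝 0))
    (hY : ∀ᶠ N in atTop, ∀ ω, |Y N ω - X N ω ^ P| ≤ δ N)
    (h : Tendsto (fun N => ∑ ω, p N ω * (X N ω - q) ^ 2) atTop (𝓝 0)) :
    Tendsto (fun N => ∑ ω, p N ω * Y N ω) atTop (𝓝 (q ^ P)) := by
  have hsum : ∀ (N : ℕ) (c : ℝ), ∑ ω, p N ω * c = c := fun N c => by
    rw [← Finset.sum_mul, hp1, one_mul]
  have habs : ∀ N, ∑ ω, p N ω * |X N ω - q| ≤ √(∑ ω, p N ω * (X N ω - q) ^ 2) := by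
    intro N
    refine Real.le_sqrt_of_sq_le ?_
    have := Finset.sum_sq_le_sum_mul_sum_of_sq_le_mul Finset.univ
      (r := fun ω => p N ω * |X N ω - q|)
      (f := fun ω => p N ω) (g := fun ω => p N ω * (X N ω - q) ^ 2) (fun ω _ => hp N ω)
      (fun ω _ => mul_nonneg (hp N ω) (sq_nonneg _))
      (fun ω _ => le_of_eq (by rw [mul_pow, sq_abs]; ring))
    rwa [hp1, one_mul] at this
  set C : ℝ := P * max 1 |q| ^ (P - 1)
  have hC : 0 ≤ C := by positivity
  rw [tendsto_iff_norm_sub_tendsto_zero]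
  have hlim : Tendsto (fun N => δ N + C * √(∑ ω, p N ω * (X N ω - q) ^ 2)) atTop (𝓝 0) := by
    simpa using hδ.add (h.sqrt.const_mul C)
  refine squeeze_zero' (Eventually.of_forall fun N => norm_nonneg _) ?_ hlim
  filter_upwards [hY] with N hN
  have h1 : ∀ ω, |Y N ω - q ^ P| ≤ δ N + C * |X N ω - q| := by
    intro ω
    have h2 : |X N ω ^ P - q ^ P| ≤ C * |X N ω - q| := by
      refine (abs_pow_sub_pow_le ..).trans ?_
      rw [mul_assoc, mul_comm]
      refine mul_le_mul_of_nonneg_right (mul_le_mul_of_nonneg_left ?_ (Nat.cast_nonneg _))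
        (abs_nonneg _)
      exact pow_le_pow_left₀ (le_max_of_le_left (abs_nonneg _)) (max_le_max_right _ (hX N ω)) _
    calc |Y N ω - q ^ P| = |(Y N ω - X N ω ^ P) + (X N ω ^ P - q ^ P)| := by ring_nf
      _ ≤ _ := (abs_add_le _ _).trans (add_le_add (hN ω) h2)
  calc ‖∑ ω, p N ω * Y N ω - q ^ P‖ = |∑ ω, p N ω * (Y N ω - q ^ P)| := by
        rw [Real.norm_eq_abs]
        congr 1
        simp only [mul_sub, Finset.sum_sub_distrib, hsum]
    _ ≤ ∑ ω, p N ω * (δ N + C * |X N ω - q|) := by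
        refine (Finset.abs_sum_le_sum_abs _ _).trans (Finset.sum_le_sum fun ω _ => ?_)
        rw [abs_mul, abs_of_nonneg (hp N ω)]
        exact mul_le_mul_of_nonneg_left (h1 ω) (hp N ω)
    _ = δ N + C * ∑ ω, p N ω * |X N ω - q| := by
        simp only [mul_add, Finset.sum_add_distrib, hsum, Finset.mul_sum]
        congr 1
        exact Finset.sum_congr rfl fun ω _ => by ring
    _ ≤ _ := by
        have := mul_le_mul_of_nonneg_left (habs N) hC
        linarith

/-- Weak convergence of uniformly bounded variables to a constant yields convergence of moments. -/
lemma tendsto_pow_of_weak {F : ℕ → (ℝ → ℝ) → ℝ} {C n : ℝ}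
    (hF : ∀ᶠ N in atTop, ∀ φ ψ : ℝ → ℝ, (∀ x, |x| ≤ C → φ x = ψ x) → F N φ = F N ψ)
    (h : ∀ φ : ℝ →ᵇ ℝ, Tendsto (fun N => F N φ) atTop (𝓝 (φ n))) (k : ℕ) :
    Tendsto (fun N => F N fun x => x ^ k) atTop (𝓝 (n ^ k)) := by
  set B := max C |n|
  have hB : 0 ≤ B := le_max_of_le_right (abs_nonneg n)
  have hcl : ∀ x : ℝ, |x| ≤ B → max (-B) (min B x) = x := fun x hx => by
    rw [min_eq_right (abs_le.1 hx).2, max_eq_right (abs_le.1 hx).1]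
  have hbd : ∀ x : ℝ, |max (-B) (min B x)| ≤ B := fun x =>
    abs_le.2 ⟨le_max_left _ _, max_le (by linarith) (min_le_left _ _)⟩
  -- The power is truncated outside the range of the variables.
  let φ : ℝ →ᵇ ℝ := BoundedContinuousFunction.ofNormedAddCommGroup
    (fun x => max (-B) (min B x) ^ k) (by fun_prop) (B ^ k) fun x => by
      rw [norm_pow]; exact pow_le_pow_left₀ (norm_nonneg _) (hbd x) k
  have hφ : ∀ x, |x| ≤ B → φ x = x ^ k := fun x hx => by
    change max (-B) (min B x) ^ k = x ^ k
    rw [hcl x hx]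
  have := h φ
  rw [hφ n (le_max_right _ _)] at this
  refine this.congr' ?_
  filter_upwards [hF] with N hN
  exact hN _ _ fun x hx => hφ x (hx.trans (le_max_left _ _))

/-- Limits of increments over `[0, 1]` from pointwise limits of uniformly bounded derivatives. -/
lemma tendsto_sub_of_tendsto_deriv {f f' : ℕ → ℝ → ℝ} {d B : ℝ}
    (hc : ∀ᶠ N in atTop, ContinuousOn (f N) (Set.Icc 0 1))
    (hd : ∀ᶠ N in atTop, ∀ t ∈ Set.Ioo (0 : ℝ) 1, HasDerivAt (f N) (f' N t) t)
    (hb : ∀ᶠ N in atTop, ∀ t ∈ Set.Ioo (0 : ℝ) 1, |f' N t| ≤ B)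
    (hlim : ∀ t ∈ Set.Ioo (0 : ℝ) 1, Tendsto (fun N => f' N t) atTop (𝓝 d)) :
    Tendsto (fun N => f N 1 - f N 0) atTop (𝓝 d) := by
  have hae : ∀ᵐ t ∂(volume : Measure ℝ), t ∈ Set.uIoc (0 : ℝ) 1 → t ∈ Set.Ioo (0 : ℝ) 1 := by
    have : ∀ᵐ t ∂(volume : Measure ℝ), t ≠ 1 := by simp [ae_iff]
    filter_upwards [this] with t ht h
    rw [Set.uIoc_of_le zero_le_one] at h
    exact ⟨h.1, lt_of_le_of_ne h.2 ht⟩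
  have h := intervalIntegral.tendsto_integral_filter_of_dominated_convergence
    (μ := volume) (a := 0) (b := 1) (l := atTop) (F := fun N => deriv (f N)) (f := fun _ => d)
    (fun _ => |B|) (Eventually.of_forall fun N => (measurable_deriv _).aestronglyMeasurable)
    (by
      filter_upwards [hd, hb] with N h1 h2
      filter_upwards [hae] with t ht htm
      rw [(h1 t (ht htm)).deriv]
      exact (h2 t (ht htm)).trans (le_abs_self B))
    (by simp)
    (by
      filter_upwards [hae] with t ht htm
      refine (hlim t (ht htm)).congr' ?_
      filter_upwards [hd] with N h1
      exact (h1 t (ht htm)).deriv.symm)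
  rw [intervalIntegral.integral_const, sub_zero, one_smul] at h
  refine h.congr' ?_
  filter_upwards [hc, hd, hb] with N h1 h2 h3
  refine intervalIntegral.integral_eq_sub_of_hasDerivAt_of_le zero_le_one h1
    (fun t ht => by rw [(h2 t ht).deriv]; exact h2 t ht) ?_
  refine (intervalIntegrable_const (c := |B|) (μ := volume)).mono_fun'
    (measurable_deriv _).aestronglyMeasurable ?_
  rw [Filter.EventuallyLE, ae_restrict_iff' measurableSet_uIoc]
  filter_upwards [hae] with t ht htm
  rw [(h2 t (ht htm)).deriv]
  exact (h3 t (ht htm)).trans (le_abs_self B)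

/-- Subgradients at `J` of a sequence of functions that converges near `J` converge to the
derivative of the limit. -/
lemma tendsto_subgradient {f : ℕ → ℝ → ℝ} {m : ℕ → ℝ} {F : ℝ → ℝ} {d J : ℝ}
    (hsub : ∀ᶠ N in atTop, ∀ x, f N J + m N * (x - J) ≤ f N x)
    (hf : ∀ᶠ x in 𝓝 J, Tendsto (fun N => f N x) atTop (𝓝 (F x))) (hF : HasDerivAt F d J) :
    Tendsto m atTop (𝓝 d) := by
  have hs := hasDerivAt_iff_tendsto_slope.1 hF
  rw [tendsto_order]
  have main : ∀ x, Tendsto (fun N => f N x) atTop (𝓝 (F x)) →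
      Tendsto (fun N => slope (f N) J x) atTop (𝓝 (slope F J x)) := fun x hx => by
    simp only [slope_def_field]
    exact (hx.sub hf.self_of_nhds).div_const _
  -- Left difference quotients bound subgradients from below, right ones from above.
  constructor
  · intro a ha
    have h1 : ∀ᶠ x in 𝓝[<] J, a < slope F J x :=
      (hs.mono_left (nhdsWithin_mono _ fun x hx => ne_of_lt hx)).eventually (lt_mem_nhds ha)
    obtain ⟨x, ⟨h2, h3⟩, h4⟩ :=
      ((h1.and (nhdsWithin_le_nhds hf)).and self_mem_nhdsWithin).exists
    filter_upwards [(main x h3).eventually (lt_mem_nhds h2), hsub] with N h5 h6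
    refine h5.trans_le ?_
    rw [slope_def_field, div_le_iff_of_neg (sub_neg.2 h4)]
    linarith [h6 x]
  · intro a ha
    have h1 : ∀ᶠ x in 𝓝[>] J, slope F J x < a :=
      (hs.mono_left (nhdsWithin_mono _ fun x hx => ne_of_gt hx)).eventually (gt_mem_nhds ha)
    obtain ⟨x, ⟨h2, h3⟩, h4⟩ :=
      ((h1.and (nhdsWithin_le_nhds hf)).and self_mem_nhdsWithin).exists
    filter_upwards [(main x h3).eventually (gt_mem_nhds h2), hsub] with N h5 h6
    refine lt_of_le_of_lt ?_ h5
    rw [slope_def_field, le_div_iff₀ (sub_pos.2 h4)]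
    linarith [h6 x]

/-! ### Elementary symmetric polynomials of many bounded variables -/

section

variable {N : ℕ}

/-- The injective tuples with range `s` are the enumerations of `s`. -/
lemma card_injective_image_eq (P : ℕ) (s : Finset (Fin N)) (hs : s.card = P) :
    (Finset.univ.filter fun f : Fin P → Fin N =>
      Function.Injective f ∧ Finset.univ.image f = s).card = P.factorial := by
  have h : Fintype.card (Fin P ≃ s) = P.factorial := by
    have e : Fin P ≃ s := Fintype.equivOfCardEq (by simp [hs])
    rw [Fintype.card_equiv e, Fintype.card_fin]
  rw [← h, ← Finset.card_univ]
  symm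
  refine Finset.card_bij (fun e _ k => (e k : Fin N)) (fun e _ => ?_) (fun e _ e' _ hee => ?_)
    fun f hf => ?_
  · simp only [Finset.mem_filter, Finset.mem_univ, true_and]
    refine ⟨Subtype.val_injective.comp e.injective, ?_⟩
    ext i
    simp only [Finset.mem_image, Finset.mem_univ, true_and]
    constructor
    · rintro ⟨k, rfl⟩; exact (e k).2
    · intro hi; exact ⟨e.symm ⟨i, hi⟩, by simp⟩
  · ext k; exact congrArg Fin.val (congrFun hee k)
  · simp only [Finset.mem_filter, Finset.mem_univ, true_and] at hf
    obtain ⟨hinj, himg⟩ := hf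
    have hm : ∀ k, f k ∈ s := fun k => himg ▸ Finset.mem_image_of_mem f (Finset.mem_univ k)
    refine ⟨Equiv.ofBijective (fun k => ⟨f k, hm k⟩) ⟨fun a b hab => hinj ?_, fun i => ?_⟩,
      Finset.mem_univ _, ?_⟩
    · exact congrArg Subtype.val hab
    · obtain ⟨k, -, hk⟩ := Finset.mem_image.1 (himg.symm ▸ i.2 :
        (i : Fin N) ∈ Finset.univ.image f)
      exact ⟨k, Subtype.ext hk⟩
    · rfl

/-- Grouping the injective tuples by their range. -/
lemma sum_injective_prod (P : ℕ) (x : Fin N → ℝ) :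
    ∑ f : Fin P → Fin N with Function.Injective f, ∏ k, x (f k) =
      P.factorial * ∑ s : Inter P N, ∏ i ∈ s.1, x i := by
  have h1 : ∑ s : Inter P N, ∏ i ∈ s.1, x i =
      ∑ s ∈ Finset.univ.filter fun s : Finset (Fin N) => s.card = P, ∏ i ∈ s, x i :=
    (Finset.sum_subtype _ (by simp) fun s : Finset (Fin N) => ∏ i ∈ s, x i).symm
  rw [h1, Finset.mul_sum, ← Finset.sum_fiberwise_of_maps_to
    (t := Finset.univ.filter fun s : Finset (Fin N) => s.card = P)
    (g := fun f : Fin P → Fin N => Finset.univ.image f)]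
  · refine Finset.sum_congr rfl fun s hs => ?_
    rw [Finset.filter_filter, ← card_injective_image_eq P s (by simpa using hs), ← nsmul_eq_mul,
      ← Finset.sum_const]
    refine Finset.sum_congr rfl fun f hf => ?_
    simp only [Finset.mem_filter, Finset.mem_univ, true_and] at hf
    rw [← hf.2, Finset.prod_image fun a _ b _ hab => hf.1 hab]
  · intro f hf
    simp only [Finset.mem_filter, Finset.mem_univ, true_and] at hf ⊢
    rw [Finset.card_image_of_injective _ hf, Finset.card_univ, Fintype.card_fin]

lemma card_filter_injective (P : ℕ) :
    (Finset.univ.filter fun f : Fin P → Fin N => Function.Injective f).card =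
      N.descFactorial P := by
  have : Fintype.card (Fin P ↪ Fin N) = N.descFactorial P := by
    rw [Fintype.card_embedding_eq]; simp
  rw [← this, ← Fintype.card_subtype]
  exact Fintype.card_congr (Equiv.subtypeInjectiveEquivEmbedding _ _)

lemma abs_prod_le_one {κ : Type} (s : Finset κ) {x : κ → ℝ} (hx : ∀ i, |x i| ≤ 1) :
    |∏ i ∈ s, x i| ≤ 1 := by
  rw [Finset.abs_prod]
  exact Finset.prod_le_one (fun _ _ => abs_nonneg _) fun i _ => hx i

/-- `P!` times the elementary symmetric polynomial differs from `(∑ i, x i) ^ P` by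
the contribution of the tuples with a repeated index. -/
lemma abs_factorial_mul_sum_sub_pow_le (P : ℕ) {x : Fin N → ℝ} (hx : ∀ i, |x i| ≤ 1) :
    |P.factorial * ∑ s : Inter P N, ∏ i ∈ s.1, x i - (∑ i, x i) ^ P| ≤
      (N : ℝ) ^ P - N.descFactorial P := by
  have h1 : (∑ i, x i) ^ P = ∑ f : Fin P → Fin N, ∏ k, x (f k) := by
    rw [Finset.sum_pow', Fintype.piFinset_univ]
  rw [h1, ← sum_injective_prod,
    ← Finset.sum_filter_add_sum_filter_not Finset.univ (fun f : Fin P → Fin N =>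
      Function.Injective f), sub_add_cancel_left, abs_neg]
  refine (Finset.abs_sum_le_sum_abs _ _).trans ((Finset.sum_le_card_nsmul _ _ 1 fun f _ =>
    abs_prod_le_one _ fun k => hx (f k)).trans ?_)
  have h2 := Finset.card_filter_add_card_filter_not (s := Finset.univ)
    (fun f : Fin P → Fin N => Function.Injective f)
  rw [card_filter_injective, Finset.card_univ, Fintype.card_fun, Fintype.card_fin,
    Fintype.card_fin] at h2
  rw [nsmul_one, le_sub_iff_add_le, add_comm]
  exact_mod_cast h2.le

lemma abs_factorial_mul_sum_le (P : ℕ) {x : Fin N → ℝ} (hx : ∀ i, |x i| ≤ 1) :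
    |P.factorial * ∑ s : Inter P N, ∏ i ∈ s.1, x i| ≤ (N : ℝ) ^ P := by
  rw [← sum_injective_prod]
  refine (Finset.abs_sum_le_sum_abs _ _).trans ((Finset.sum_le_card_nsmul _ _ 1 fun f _ =>
    abs_prod_le_one _ fun k => hx (f k)).trans ?_)
  rw [card_filter_injective, nsmul_one]
  exact_mod_cast Nat.descFactorial_le_pow N P

lemma tendsto_one_sub_descFactorial_div (P : ℕ) :
    Tendsto (fun N : ℕ => ((N : ℝ) ^ P - N.descFactorial P) / (N : ℝ) ^ P) atTop (𝓝 0) := by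
  have h1 : Tendsto (fun N : ℕ => (((N : ℝ) - P) / N) ^ P) atTop (𝓝 1) := by
    have : Tendsto (fun N : ℕ => 1 - (P : ℝ) / N) atTop (𝓝 (1 - 0)) :=
      (tendsto_const_div_atTop_nhds_zero_nat (P : ℝ)).const_sub 1
    have h2 := this.pow P
    rw [sub_zero, one_pow] at h2
    refine h2.congr' ?_
    filter_upwards [eventually_gt_atTop 0] with N hN
    have : (N : ℝ) ≠ 0 := by positivity
    field_simp
  have h3 : Tendsto (fun N : ℕ => 1 - (((N : ℝ) - P) / N) ^ P) atTop (𝓝 0) := by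
    simpa using h1.const_sub 1
  refine squeeze_zero' (Eventually.of_forall fun N => ?_) ?_ h3
  · refine div_nonneg (sub_nonneg.2 ?_) (by positivity)
    exact_mod_cast Nat.descFactorial_le_pow N P
  -- `(N - P) ^ P ≤ N (N - 1) ⋯ (N - P + 1)`.
  · filter_upwards [eventually_gt_atTop 0, eventually_ge_atTop P] with N hN hNP
    have h0 : (0 : ℝ) < (N : ℝ) ^ P := by positivity
    rw [sub_div, div_self h0.ne', div_pow]
    refine sub_le_sub_left (div_le_div_of_nonneg_right ?_ h0.le) _
    have h4 := Nat.pow_sub_le_descFactorial N P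
    have h5 : (N : ℝ) - P ≤ ((N + 1 - P : ℕ) : ℝ) := by
      rw [Nat.cast_sub (by omega)]; push_cast; linarith
    calc ((N : ℝ) - P) ^ P ≤ ((N + 1 - P : ℕ) : ℝ) ^ P :=
          pow_le_pow_left₀ (sub_nonneg.2 (by exact_mod_cast hNP)) h5 P
      _ ≤ _ := by exact_mod_cast h4

end

/-! ### The interpolating model at finite size -/

section

variable {S I I' L : Type} [Fintype S] [Nonempty S] [Fintype I] [Fintype I'] [Fintype L] {θ : ℝ}

/-- A block of coordinates of a standard Gaussian vector is a standard Gaussian vector. -/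
lemma integral_comp_inr {F : (I → ℝ) → ℝ} (hF : Continuous F) :
    ∫ x, F (fun j => x (Sum.inr j)) ∂stdGaussian (I' ⊕ I) = ∫ y, F y ∂stdGaussian I := by
  have mp : MeasurePreserving (fun x : I' ⊕ I → ℝ => fun j => x (Sum.inr j))
      (stdGaussian (I' ⊕ I)) (stdGaussian I) :=
    (measurePreserving_snd (μ := stdGaussian I') (ν := stdGaussian I)).comp
      (measurePreserving_sumPiEquivProdPi (X := fun _ : I' ⊕ I => ℝ) (fun _ => gaussianReal 0 1))
  rw [← mp.map_eq, integral_map mp.measurable.aemeasurable hF.aestronglyMeasurable]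

lemma lin_sumElim_zero (c : S → ℝ) (v : S → I → ℝ) (x : I' ⊕ I → ℝ) :
    lin c (fun σ => Sum.elim (fun _ : I' => 0) (v σ)) x = lin c v fun j => x (Sum.inr j) := by
  ext σ
  simp [lin]

/-- Gaussian variables with vanishing coefficients do not contribute. -/
lemma press_sumElim_zero (hθ : 0 ≤ θ) (c : S → ℝ) (v : S → I → ℝ) (z : S → L → ℝ) :
    press θ c (fun σ => Sum.elim (fun _ : I' => 0) (v σ)) z = press θ c v z := by
  unfold press
  simp only [lin_sumElim_zero]
  exact integral_comp_inr (F := fun x => Real.log (level θ (fun _ => 1) (lin c v x) z))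
    ((continuous_log_level hθ).comp (f := fun x => (lin c v x, z)) (by fun_prop))

lemma meanOne_sumElim_zero (hθ : 0 ≤ θ) (c : S → ℝ) (v : S → I → ℝ) (z : S → L → ℝ) (σ : S) :
    meanOne θ c (fun σ => Sum.elim (fun _ : I' => 0) (v σ)) z σ = meanOne θ c v z σ := by
  unfold meanOne
  simp only [lin_sumElim_zero]
  exact integral_comp_inr (F := fun x => tiltOne θ (lin c v x) z σ)
    (continuous_tiltOne hθ σ (by fun_prop) (by fun_prop))

lemma meanPair₁_sumElim_zero (hθ : 0 ≤ θ) (c : S → ℝ) (v : S → I → ℝ) (z : S → L → ℝ)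
    (σ τ : S) : meanPair₁ θ c (fun σ => Sum.elim (fun _ : I' => 0) (v σ)) z σ τ =
      meanPair₁ θ c v z σ τ := by
  unfold meanPair₁
  simp only [lin_sumElim_zero]
  exact integral_comp_inr (F := fun x => tiltOne θ (lin c v x) z σ * tiltOne θ (lin c v x) z τ)
    ((continuous_tiltOne hθ σ (by fun_prop) (by fun_prop)).mul
      (continuous_tiltOne hθ τ (by fun_prop) (by fun_prop)))

lemma meanPair₂_sumElim_zero (hθ : 0 ≤ θ) (c : S → ℝ) (v : S → I → ℝ) (z : S → L → ℝ)
    (σ τ : S) : meanPair₂ θ c (fun σ => Sum.elim (fun _ : I' => 0) (v σ)) z σ τ =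
      meanPair₂ θ c v z σ τ := by
  unfold meanPair₂
  simp only [lin_sumElim_zero]
  exact integral_comp_inr (F := fun x => tiltTwo θ (lin c v x) z σ τ)
    (continuous_tiltTwo hθ σ τ (by fun_prop) (by fun_prop))

lemma meanOne_nonneg (hθ : 0 ≤ θ) (c : S → ℝ) (v : S → I → ℝ) (z : S → L → ℝ) (σ : S) :
    0 ≤ meanOne θ c v z σ := integral_nonneg fun _ => tiltOne_nonneg hθ _ _ _

lemma meanPair₁_nonneg (hθ : 0 ≤ θ) (c : S → ℝ) (v : S → I → ℝ) (z : S → L → ℝ) (σ τ : S) :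
    0 ≤ meanPair₁ θ c v z σ τ :=
  integral_nonneg fun _ => mul_nonneg (tiltOne_nonneg hθ _ _ _) (tiltOne_nonneg hθ _ _ _)

lemma meanPair₂_nonneg (hθ : 0 ≤ θ) (c : S → ℝ) (v : S → I → ℝ) (z : S → L → ℝ) (σ τ : S) :
    0 ≤ meanPair₂ θ c v z σ τ := integral_nonneg fun _ => tiltTwo_nonneg hθ _ _ _ _

lemma sum_meanPair₁ (hθ : 0 ≤ θ) (c : S → ℝ) (v : S → I → ℝ) (z : S → L → ℝ) :
    ∑ σ, ∑ τ, meanPair₁ θ c v z σ τ = 1 := by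
  unfold meanPair₁
  have h := fun σ τ => integrable_tiltOne_mul hθ c v z σ τ
  simp only [← integral_finsetSum _ fun τ _ => h _ τ]
  rw [← integral_finsetSum _ fun σ _ => integrable_finsetSum _ fun τ _ => h σ τ]
  simp [← Finset.sum_mul_sum, sum_tiltOne hθ]

lemma sum_meanPair₂ (hθ : 0 ≤ θ) (c : S → ℝ) (v : S → I → ℝ) (z : S → L → ℝ) :
    ∑ σ, ∑ τ, meanPair₂ θ c v z σ τ = 1 := by
  unfold meanPair₂
  have h := fun σ τ => integrable_tiltTwo hθ c v z σ τ
  simp only [← integral_finsetSum _ fun τ _ => h _ τ]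
  rw [← integral_finsetSum _ fun σ _ => integrable_finsetSum _ fun τ _ => h σ τ]
  simp [sum_sum_tiltTwo hθ]

end

namespace Model

variable (D : Model)

/-- The joint law of the archetype and of its examples at one site. -/
def siteWt (x : Bool) (y : Fin D.M → Bool) : ℝ := (1 / 2) * ∏ a, flipProb D.r x (y a)

/-- The average over the archetype and its examples at one site. -/
def siteAvg (f : Bool → (Fin D.M → Bool) → ℝ) : ℝ := ∑ x, ∑ y, D.siteWt x y * f x y

/-- The joint law of the archetype and of its examples. -/
def wt {N : ℕ} (ξ : Fin N → Bool) (η : Fin N → Fin D.M → Bool) : ℝ := ∏ i, D.siteWt (ξ i) (η i)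

/-- The average over the archetype and its examples. -/
def dAvg {N : ℕ} (F : (Fin N → Bool) → (Fin N → Fin D.M → Bool) → ℝ) : ℝ :=
  ∑ ξ, ∑ η, D.wt ξ η * F ξ η

lemma E₀_eq (N : ℕ) (f : (Fin N → Bool) → (Fin N → Fin D.M → Bool) → (Inter D.P N → ℝ) → ℝ) :
    D.E₀ N f = D.dAvg fun ξ η => ∫ l, f ξ η l ∂stdGaussian (Inter D.P N) := rfl

lemma siteWt_nonneg (hr : 0 ≤ D.r) (hr1 : D.r ≤ 1) (x : Bool) (y : Fin D.M → Bool) :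
    0 ≤ D.siteWt x y := by
  refine mul_nonneg (by norm_num) (Finset.prod_nonneg fun a _ => ?_)
  unfold flipProb
  split_ifs <;> linarith

lemma sum_siteWt : ∑ x, ∑ y, D.siteWt x y = 1 := by
  have h : ∀ x, ∑ y : Fin D.M → Bool, ∏ a, flipProb D.r x (y a) = 1 := by
    intro x
    rw [← Fintype.prod_sum (f := fun _ s => flipProb D.r x s)]
    refine Finset.prod_eq_one fun a _ => ?_
    cases x <;> simp [flipProb] <;> ring
  simp [siteWt, ← Finset.mul_sum, h]

lemma wt_nonneg (hr : 0 ≤ D.r) (hr1 : D.r ≤ 1) {N : ℕ} (ξ : Fin N → Bool)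
    (η : Fin N → Fin D.M → Bool) : 0 ≤ D.wt ξ η :=
  Finset.prod_nonneg fun _ _ => D.siteWt_nonneg hr hr1 _ _

/-- The sites are independent under the joint law of the archetype and its examples. -/
lemma sum_wt_mul_prod {N : ℕ} (f : Fin N → Bool → (Fin D.M → Bool) → ℝ) :
    ∑ ξ, ∑ η, D.wt ξ η * ∏ i, f i (ξ i) (η i) = ∏ i, D.siteAvg (f i) := by
  unfold siteAvg wt
  simp only [← Finset.prod_mul_distrib]
  rw [Fintype.prod_sum]
  refine Finset.sum_congr rfl fun ξ _ => ?_
  rw [Fintype.prod_sum]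

lemma siteAvg_const (c : ℝ) : D.siteAvg (fun _ _ => c) = c := by
  simp only [siteAvg, ← Finset.sum_mul, sum_siteWt, one_mul]

lemma sum_wt (N : ℕ) : ∑ ξ : Fin N → Bool, ∑ η : Fin N → Fin D.M → Bool, D.wt ξ η = 1 := by
  have := D.sum_wt_mul_prod (N := N) fun _ _ _ => 1
  simpa [siteAvg_const] using this

lemma dAvg_site {N : ℕ} (k : Fin N) (f : Bool → (Fin D.M → Bool) → ℝ) :
    D.dAvg (fun ξ η => f (ξ k) (η k)) = D.siteAvg f := by
  have h := D.sum_wt_mul_prod (N := N) fun i x y => if i = k then f x y else 1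
  have h1 : ∀ (ξ : Fin N → Bool) (η : Fin N → Fin D.M → Bool),
      ∏ i, (if i = k then f (ξ i) (η i) else 1) = f (ξ k) (η k) := fun ξ η => by
    rw [Finset.prod_ite_eq' Finset.univ k fun i => f (ξ i) (η i)]; simp
  simp only [h1] at h
  unfold dAvg
  rw [h, ← Finset.mul_prod_erase _ _ (Finset.mem_univ k)]
  simp only [if_true]
  rw [Finset.prod_eq_one, mul_one]
  intro i hi
  simp [Finset.ne_of_mem_erase hi, siteAvg_const]

lemma dAvg_sum {N : ℕ} {κ : Type} (s : Finset κ)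
    (F : κ → (Fin N → Bool) → (Fin N → Fin D.M → Bool) → ℝ) :
    D.dAvg (fun ξ η => ∑ k ∈ s, F k ξ η) = ∑ k ∈ s, D.dAvg (F k) := by
  unfold dAvg
  simp only [Finset.mul_sum]
  symm
  exact Finset.sum_comm.trans (Finset.sum_congr rfl fun ξ _ => Finset.sum_comm)

lemma dAvg_const_mul {N : ℕ} (c : ℝ) (F : (Fin N → Bool) → (Fin N → Fin D.M → Bool) → ℝ) :
    D.dAvg (fun ξ η => c * F ξ η) = c * D.dAvg F := by
  unfold dAvg
  simp only [Finset.mul_sum]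
  exact Finset.sum_congr rfl fun ξ _ => Finset.sum_congr rfl fun η _ => by ring

lemma dAvg_sum_site (N : ℕ) (f : Bool → (Fin D.M → Bool) → ℝ) :
    D.dAvg (fun ξ η => ∑ i : Fin N, f (ξ i) (η i)) = N * D.siteAvg f := by
  rw [D.dAvg_sum Finset.univ fun i ξ η => f (ξ i) (η i)]
  simp [D.dAvg_site]

/-- The deterministic part of the effective field, at one site. -/
def siteField (J n : ℝ) (x : Bool) (y : Fin D.M → Bool) : ℝ :=
  J * spin x + D.β' * ((D.P : ℝ) / 2) * n ^ (D.P - 1) * (1 + D.ρ) ^ ((D.P : ℝ) / 2 - 1) *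
    D.etaHat y

/-- The amplitude of the first-level Gaussian field at load `γ`. -/
def amp₁ (γ q₁ : ℝ) : ℝ := D.β' * √(γ * ((D.P : ℝ) / 2) * q₁ ^ (D.P - 1))

/-- The amplitude of the second-level Gaussian field at load `γ`. -/
def amp₂ (γ q₁ q₂ : ℝ) : ℝ := D.β' * √(γ * ((D.P : ℝ) / 2) * (q₂ ^ (D.P - 1) - q₁ ^ (D.P - 1)))

/-- The deterministic part of the interpolating energy. -/
def intC {N : ℕ} (n J t : ℝ) (ξ : Fin N → Bool) (η : Fin N → Fin D.M → Bool)
    (σ : Fin N → Bool) : ℝ :=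
  J * ∑ i, spin (ξ i) * spin (σ i) + t * D.signal η σ + D.ψ n * (1 - t) * (N : ℝ) * D.classMag η σ

/-- The amplitude of the `P`-spin interactions. -/
def noiseAmp (N : ℕ) : ℝ :=
  D.β' * (D.P.factorial : ℝ) * √(D.K N : ℝ) / (2 * (N : ℝ) ^ (D.P - 1))

/-- The couplings to the Gaussian variables of the first level: the interactions and the first
one-body field. -/
def intV {N : ℕ} (q₁ t : ℝ) (σ : Fin N → Bool) : Inter D.P N ⊕ Fin N → ℝ :=
  Sum.elim (fun s => √t * (D.noiseAmp N * ∏ i ∈ s.1, spin (σ i))) (spinC (√(1 - t) * D.A₁ N q₁) σ)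

/-- The couplings to the Gaussian variables of the second level, the second one-body field. -/
def intZ {N : ℕ} (q₁ q₂ t : ℝ) : (Fin N → Bool) → Fin N → ℝ := spinC (√(1 - t) * D.A₂ N q₁ q₂)

section

variable {N : ℕ} {θ : ℝ} (n q₁ q₂ J t : ℝ) (ξ : Fin N → Bool) (η : Fin N → Fin D.M → Bool)

lemma boltz₂_eq (l : Inter D.P N → ℝ) (y₁ y₂ : Fin N → ℝ) (σ : Fin N → Bool) :
    D.boltz₂ n q₁ q₂ J t ξ η l y₁ y₂ σ =
      Real.exp (lin (lin (D.intC n J t ξ η) (D.intV q₁ t) (Sum.elim l y₁))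
        (D.intZ q₁ q₂ t) y₂ σ) := by
  unfold boltz₂ lin intC intV intZ spinC noise noiseAmp
  congr 1
  rw [Fintype.sum_sum_type]
  simp only [Sum.elim_inl, Sum.elim_inr]
  have e1 : ∑ s : Inter D.P N, √t * (D.β' * (D.P.factorial : ℝ) * √(D.K N : ℝ) /
      (2 * (N : ℝ) ^ (D.P - 1)) * ∏ i ∈ s.1, spin (σ i)) * l s =
      √t * (D.β' * (D.P.factorial : ℝ) * √(D.K N : ℝ) / (2 * (N : ℝ) ^ (D.P - 1)) *
        ∑ s : Inter D.P N, l s * ∏ i ∈ s.1, spin (σ i)) := by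
    simp only [Finset.mul_sum]
    exact Finset.sum_congr rfl fun s _ => by ring
  have e2 : ∀ (a : ℝ) (y : Fin N → ℝ), ∑ i, √(1 - t) * a * spin (σ i) * y i =
      √(1 - t) * (a * ∑ i, y i * spin (σ i)) := by
    intro a y
    simp only [Finset.mul_sum]
    exact Finset.sum_congr rfl fun i _ => by ring
  rw [e1, e2, e2]
  ring

lemma Z₂_eq (l : Inter D.P N → ℝ) (y₁ y₂ : Fin N → ℝ) :
    D.Z₂ n q₁ q₂ J t ξ η l y₁ y₂ =
      zf (lin (lin (D.intC n J t ξ η) (D.intV q₁ t) (Sum.elim l y₁)) (D.intZ q₁ q₂ t) y₂) := by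
  unfold Z₂ zf
  simp only [boltz₂_eq]

lemma gibbs_eq (l : Inter D.P N → ℝ) (y₁ y₂ : Fin N → ℝ) (σ : Fin N → Bool) :
    D.gibbs n q₁ q₂ J t ξ η l y₁ y₂ σ =
      gib (lin (lin (D.intC n J t ξ η) (D.intV q₁ t) (Sum.elim l y₁)) (D.intZ q₁ q₂ t) y₂) σ := by
  unfold gibbs gib
  rw [boltz₂_eq, Z₂_eq]

lemma integral_W₂_mul (l : Inter D.P N → ℝ) (y₁ : Fin N → ℝ)
    (w : ((Fin N → Bool) → ℝ) → ℝ) :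
    ∫ y₂, D.W₂ θ n q₁ q₂ J t ξ η l y₁ y₂ *
        w (lin (lin (D.intC n J t ξ η) (D.intV q₁ t) (Sum.elim l y₁)) (D.intZ q₁ q₂ t) y₂)
        ∂stdGaussian (Fin N) =
      tilt θ w (lin (D.intC n J t ξ η) (D.intV q₁ t) (Sum.elim l y₁)) (D.intZ q₁ q₂ t) := by
  unfold W₂ tilt level
  simp only [Z₂_eq, mul_one]
  rw [← integral_div]
  congr 1; ext y
  ring

lemma avgClassMag_eq (hθ : 0 ≤ θ) (φ : ℝ → ℝ) :
    D.avgClassMag N θ n q₁ q₂ J t φ = D.dAvg fun ξ η => ∑ σ, φ (D.classMag η σ) *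
      meanOne θ (D.intC n J t ξ η) (D.intV q₁ t) (D.intZ (N := N) q₁ q₂ t) σ := by
  unfold avgClassMag
  rw [E₀_eq]
  congr 1; ext ξ η
  simp only [gibbs_eq]
  have h : ∀ l y₁, ∫ y₂, D.W₂ θ n q₁ q₂ J t ξ η l y₁ y₂ * ∑ σ, φ (D.classMag η σ) *
      gib (lin (lin (D.intC n J t ξ η) (D.intV q₁ t) (Sum.elim l y₁)) (D.intZ q₁ q₂ t) y₂) σ
        ∂stdGaussian (Fin N) = ∑ σ, φ (D.classMag η σ) *
      tiltOne θ (lin (D.intC n J t ξ η) (D.intV q₁ t) (Sum.elim l y₁)) (D.intZ q₁ q₂ t) σ := by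
    intro l y₁
    rw [sum_mul_tiltOne hθ]
    exact D.integral_W₂_mul n q₁ q₂ J t ξ η l y₁ fun h => ∑ σ, φ (D.classMag η σ) * gib h σ
  simp only [h]
  have hi := fun σ => (integrable_tiltOne hθ (D.intC n J t ξ η) (D.intV q₁ t)
    (D.intZ q₁ q₂ t) σ).const_mul (φ (D.classMag η σ))
  rw [← integral_stdGaussian_sum (f := fun x => ∑ σ, φ (D.classMag η σ) *
    tiltOne θ (lin (D.intC n J t ξ η) (D.intV q₁ t) x) (D.intZ q₁ q₂ t) σ)
    (integrable_finsetSum _ fun σ _ => hi σ), integral_finsetSum _ fun σ _ => hi σ]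
  simp only [integral_const_mul, meanOne]

lemma avgOverlap₁_eq (hθ : 0 ≤ θ) (φ : ℝ → ℝ) :
    D.avgOverlap₁ N θ n q₁ q₂ J t φ = D.dAvg fun ξ η => ∑ σ, ∑ τ, φ (overlap σ τ) *
      meanPair₁ θ (D.intC n J t ξ η) (D.intV q₁ t) (D.intZ (N := N) q₁ q₂ t) σ τ := by
  unfold avgOverlap₁
  rw [E₀_eq]
  congr 1; ext ξ η
  simp only [gibbs_eq]
  have h : ∀ l y₁ σ, ∫ y₂, D.W₂ θ n q₁ q₂ J t ξ η l y₁ y₂ *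
      gib (lin (lin (D.intC n J t ξ η) (D.intV q₁ t) (Sum.elim l y₁)) (D.intZ q₁ q₂ t) y₂) σ
        ∂stdGaussian (Fin N) =
      tiltOne θ (lin (D.intC n J t ξ η) (D.intV q₁ t) (Sum.elim l y₁)) (D.intZ q₁ q₂ t) σ :=
    fun l y₁ σ => D.integral_W₂_mul n q₁ q₂ J t ξ η l y₁ fun h => gib h σ
  simp only [h]
  have hi := fun σ τ => (integrable_tiltOne_mul hθ (D.intC n J t ξ η) (D.intV q₁ t)
    (D.intZ q₁ q₂ t) σ τ).const_mul (φ (overlap σ τ))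
  rw [← integral_stdGaussian_sum (f := fun x => ∑ σ, ∑ τ, φ (overlap σ τ) *
    (tiltOne θ (lin (D.intC n J t ξ η) (D.intV q₁ t) x) (D.intZ q₁ q₂ t) σ *
      tiltOne θ (lin (D.intC n J t ξ η) (D.intV q₁ t) x) (D.intZ q₁ q₂ t) τ))
    (integrable_finsetSum _ fun σ _ => integrable_finsetSum _ fun τ _ => hi σ τ),
    integral_finsetSum _ fun σ _ => integrable_finsetSum _ fun τ _ => hi σ τ]
  simp only [integral_finsetSum _ fun τ _ => hi _ τ, integral_const_mul, meanPair₁]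

lemma avgOverlap₂_eq (hθ : 0 ≤ θ) (φ : ℝ → ℝ) :
    D.avgOverlap₂ N θ n q₁ q₂ J t φ = D.dAvg fun ξ η => ∑ σ, ∑ τ, φ (overlap σ τ) *
      meanPair₂ θ (D.intC n J t ξ η) (D.intV q₁ t) (D.intZ (N := N) q₁ q₂ t) σ τ := by
  unfold avgOverlap₂
  rw [E₀_eq]
  congr 1; ext ξ η
  simp only [gibbs_eq]
  have h : ∀ l y₁, ∫ y₂, D.W₂ θ n q₁ q₂ J t ξ η l y₁ y₂ * ∑ σ, ∑ τ, φ (overlap σ τ) *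
      (gib (lin (lin (D.intC n J t ξ η) (D.intV q₁ t) (Sum.elim l y₁)) (D.intZ q₁ q₂ t) y₂) σ *
        gib (lin (lin (D.intC n J t ξ η) (D.intV q₁ t) (Sum.elim l y₁)) (D.intZ q₁ q₂ t) y₂) τ)
        ∂stdGaussian (Fin N) = ∑ σ, ∑ τ, φ (overlap σ τ) *
      tiltTwo θ (lin (D.intC n J t ξ η) (D.intV q₁ t) (Sum.elim l y₁)) (D.intZ q₁ q₂ t) σ τ := by
    intro l y₁
    rw [sum_mul_tiltTwo hθ]
    exact D.integral_W₂_mul n q₁ q₂ J t ξ η l y₁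
      fun h => ∑ σ, ∑ τ, φ (overlap σ τ) * (gib h σ * gib h τ)
  simp only [h]
  have hi := fun σ τ => (integrable_tiltTwo hθ (D.intC n J t ξ η) (D.intV q₁ t)
    (D.intZ q₁ q₂ t) σ τ).const_mul (φ (overlap σ τ))
  rw [← integral_stdGaussian_sum (f := fun x => ∑ σ, ∑ τ, φ (overlap σ τ) *
    tiltTwo θ (lin (D.intC n J t ξ η) (D.intV q₁ t) x) (D.intZ q₁ q₂ t) σ τ)
    (integrable_finsetSum _ fun σ _ => integrable_finsetSum _ fun τ _ => hi σ τ),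
    integral_finsetSum _ fun σ _ => integrable_finsetSum _ fun τ _ => hi σ τ]
  simp only [integral_finsetSum _ fun τ _ => hi _ τ, integral_const_mul, meanPair₂]

/-! ### The end points of the interpolation -/

/-- At `t = 1` the interpolating model is the original one. -/
lemma press_int_one (hθ : 0 ≤ θ) :
    press θ (D.intC n J 1 ξ η) (D.intV q₁ 1) (D.intZ (N := N) q₁ q₂ 1) =
      θ * ∫ l, Real.log (D.Z J ξ η l) ∂stdGaussian (Inter D.P N) := by
  have hz : D.intZ (N := N) q₁ q₂ 1 = fun _ _ => 0 := by
    ext σ i; simp [intZ, spinC]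
  have hlin : ∀ l (y₁ : Fin N → ℝ) (y₂ : Fin N → ℝ),
      zf (lin (lin (D.intC n J 1 ξ η) (D.intV q₁ 1) (Sum.elim l y₁)) (fun _ _ => 0) y₂) =
        D.Z J ξ η l := by
    intro l y₁ y₂
    rw [← hz, ← Z₂_eq]
    simp [Z₂, Z, boltz₂, boltz]
  unfold press
  rw [integral_stdGaussian_sum (integrable_log_level hθ _ _ _), hz]
  simp only [level, hlin, mul_one]
  have hZ : ∀ l, 0 < D.Z J ξ η l := fun l => by rw [← hlin l 0 0]; exact zf_pos _
  simp [Real.log_rpow (hZ _), integral_const_mul]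

lemma intV_zero : D.intV (N := N) q₁ 0 =
    fun σ => Sum.elim (fun _ => 0) (spinC (D.amp₁ (D.loadN N) q₁) σ) := by
  ext σ i
  rcases i with s | i <;> simp [intV, A₁, amp₁]

lemma intZ_zero : D.intZ (N := N) q₁ q₂ 0 = spinC (D.amp₂ (D.loadN N) q₁ q₂) := by
  simp [intZ, A₂, amp₂]

lemma one_add_ρ_eq (hM : 1 ≤ D.M) (hr : 0 < D.r) : D.r ^ 2 * (1 + D.ρ) = D.R := by
  have : (0 : ℝ) < D.M := by exact_mod_cast hM
  unfold ρ R
  field_simp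

lemma one_add_ρ_pos (hM : 1 ≤ D.M) (hr : 0 < D.r) (hr1 : D.r ≤ 1) : 0 < 1 + D.ρ := by
  have : (0 : ℝ) < D.M := by exact_mod_cast hM
  have : 0 ≤ D.ρ := div_nonneg (by nlinarith) (by positivity)
  linarith

lemma classMag_eq (hM : 1 ≤ D.M) (hr : 0 < D.r) (hr1 : D.r ≤ 1) (σ : Fin N → Bool) :
    (N : ℝ) * D.classMag η σ = ∑ i, 1 / (1 + D.ρ) * D.etaHat (η i) * spin (σ i) := by
  rcases Nat.eq_zero_or_pos N with rfl | hN
  · simp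
  have hN : (N : ℝ) ≠ 0 := by positivity
  have hM' : (D.M : ℝ) ≠ 0 := by positivity
  have h := D.one_add_ρ_eq hM hr
  have hρ := (D.one_add_ρ_pos hM hr hr1).ne'
  unfold classMag etaHat
  rw [← h]
  simp only [← Finset.sum_mul]
  have : ∑ i, 1 / (1 + D.ρ) * (1 / (D.r * D.M) * ∑ a, spin (η i a)) * spin (σ i) =
      1 / (1 + D.ρ) * (1 / (D.r * D.M)) * ∑ i, (∑ a, spin (η i a)) * spin (σ i) := by
    rw [Finset.mul_sum]
    exact Finset.sum_congr rfl fun i _ => by ring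
  rw [this]
  have := hr.ne'
  field_simp

/-- At `t = 0` the deterministic part of the energy is that of independent spins. -/
lemma intC_zero (hM : 1 ≤ D.M) (hr : 0 < D.r) (hr1 : D.r ≤ 1) :
    D.intC n J 0 ξ η = fieldE fun i => D.siteField J n (ξ i) (η i) := by
  ext σ
  unfold intC
  rw [sub_zero, mul_one, zero_mul, add_zero, mul_assoc (D.ψ n), D.classMag_eq η hM hr hr1]
  unfold fieldE siteField ψ
  simp only [add_mul, Finset.sum_add_distrib, Finset.mul_sum]
  congr 1
  · exact Finset.sum_congr rfl fun i _ => by ring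
  · refine Finset.sum_congr rfl fun i _ => ?_
    rw [Real.rpow_sub_one (D.one_add_ρ_pos hM hr hr1).ne']
    ring

/-- At `t = 0` the sites are independent. -/
lemma press_int_zero (hM : 1 ≤ D.M) (hr : 0 < D.r) (hr1 : D.r ≤ 1) (hθ : 0 ≤ θ) :
    press θ (D.intC n J 0 ξ η) (D.intV q₁ 0) (D.intZ (N := N) q₁ q₂ 0) =
      ∑ i, (θ * Real.log 2 + sitePress θ (D.siteField J n (ξ i) (η i))
        (D.amp₁ (D.loadN N) q₁) (D.amp₂ (D.loadN N) q₁ q₂)) := by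
  rw [intV_zero, press_sumElim_zero hθ, intZ_zero, D.intC_zero n J ξ η hM hr hr1, press_fieldE hθ]

end

section

variable {N : ℕ} {θ : ℝ} (n q₁ q₂ J : ℝ)

lemma natCast_mul_overlap (σ τ : Fin N → Bool) :
    (N : ℝ) * overlap σ τ = ∑ i, spin (σ i) * spin (τ i) := by
  rcases Nat.eq_zero_or_pos N with rfl | hN
  · simp
  · unfold overlap
    rw [← mul_assoc, mul_one_div_cancel (by positivity), one_mul]

/-- At `t = 0` the mean of `n₁` is a one-site average; the prefactor comes from `r / R = 1 / (r (1 +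
ρ))`. -/
lemma avgClassMag_zero (hM : 1 ≤ D.M) (hr : 0 < D.r) (hr1 : D.r ≤ 1) (hθ : 0 ≤ θ) (hN : 0 < N) :
    D.avgClassMag N θ n q₁ q₂ J 0 (fun x => x) = 1 / (1 + D.ρ) * D.siteAvg fun x y =>
      siteM θ (D.siteField J n x y) (D.amp₁ (D.loadN N) q₁) (D.amp₂ (D.loadN N) q₁ q₂) *
        D.etaHat y := by
  have hN' : (N : ℝ) ≠ 0 := by positivity
  rw [D.avgClassMag_eq n q₁ q₂ J 0 hθ, ← mul_right_inj' hN', ← D.dAvg_const_mul]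
  rw [show (N : ℝ) * (1 / (1 + D.ρ) * D.siteAvg fun x y =>
      siteM θ (D.siteField J n x y) (D.amp₁ (D.loadN N) q₁) (D.amp₂ (D.loadN N) q₁ q₂) *
        D.etaHat y) = 1 / (1 + D.ρ) * (N * D.siteAvg fun x y =>
      siteM θ (D.siteField J n x y) (D.amp₁ (D.loadN N) q₁) (D.amp₂ (D.loadN N) q₁ q₂) *
        D.etaHat y) by ring, ← D.dAvg_sum_site, ← D.dAvg_const_mul]
  congr 1; ext ξ η
  rw [intV_zero, intZ_zero, D.intC_zero n J ξ η hM hr hr1]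
  simp only [meanOne_sumElim_zero hθ, Finset.mul_sum, ← mul_assoc, D.classMag_eq η hM hr hr1,
    Finset.sum_mul]
  rw [Finset.sum_comm]
  refine Finset.sum_congr rfl fun i _ => ?_
  rw [← sum_spin_fieldE_meanOne hθ (fun i => D.siteField J n (ξ i) (η i)), Finset.mul_sum,
    Finset.sum_mul]
  exact Finset.sum_congr rfl fun σ _ => by ring

lemma avgOverlap₁_zero (hM : 1 ≤ D.M) (hr : 0 < D.r) (hr1 : D.r ≤ 1) (hθ : 0 ≤ θ) (hN : 0 < N) :
    D.avgOverlap₁ N θ n q₁ q₂ J 0 (fun x => x) = D.siteAvg fun x y =>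
      siteQ₁ θ (D.siteField J n x y) (D.amp₁ (D.loadN N) q₁) (D.amp₂ (D.loadN N) q₁ q₂) := by
  have hN' : (N : ℝ) ≠ 0 := by positivity
  rw [D.avgOverlap₁_eq n q₁ q₂ J 0 hθ, ← mul_right_inj' hN', ← D.dAvg_const_mul,
    ← D.dAvg_sum_site]
  congr 1; ext ξ η
  rw [intV_zero, intZ_zero, D.intC_zero n J ξ η hM hr hr1]
  simp only [meanPair₁_sumElim_zero hθ, Finset.mul_sum, ← mul_assoc, natCast_mul_overlap,
    Finset.sum_mul]
  simp only [← fun i => sum_spin_fieldE_meanPair₁ hθ (fun i => D.siteField J n (ξ i) (η i))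
    (D.amp₁ (D.loadN N) q₁) (D.amp₂ (D.loadN N) q₁ q₂) i]
  symm
  exact Finset.sum_comm.trans (Finset.sum_congr rfl fun σ _ => Finset.sum_comm)

lemma avgOverlap₂_zero (hM : 1 ≤ D.M) (hr : 0 < D.r) (hr1 : D.r ≤ 1) (hθ : 0 ≤ θ) (hN : 0 < N) :
    D.avgOverlap₂ N θ n q₁ q₂ J 0 (fun x => x) = D.siteAvg fun x y =>
      siteQ₂ θ (D.siteField J n x y) (D.amp₁ (D.loadN N) q₁) (D.amp₂ (D.loadN N) q₁ q₂) := by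
  have hN' : (N : ℝ) ≠ 0 := by positivity
  rw [D.avgOverlap₂_eq n q₁ q₂ J 0 hθ, ← mul_right_inj' hN', ← D.dAvg_const_mul,
    ← D.dAvg_sum_site]
  congr 1; ext ξ η
  rw [intV_zero, intZ_zero, D.intC_zero n J ξ η hM hr hr1]
  simp only [meanPair₂_sumElim_zero hθ, Finset.mul_sum, ← mul_assoc, natCast_mul_overlap,
    Finset.sum_mul]
  simp only [← fun i => sum_spin_fieldE_meanPair₂ hθ (fun i => D.siteField J n (ξ i) (η i))
    (D.amp₁ (D.loadN N) q₁) (D.amp₂ (D.loadN N) q₁ q₂) i]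
  symm
  exact Finset.sum_comm.trans (Finset.sum_congr rfl fun σ _ => Finset.sum_comm)

end

end Model

/-! ### The interpolation formula -/

lemma abs_overlap_le {N : ℕ} (σ τ : Fin N → Bool) : |overlap σ τ| ≤ 1 := by
  rcases Nat.eq_zero_or_pos N with rfl | hN
  · simp [overlap]
  · have h : |∑ i, spin (σ i) * spin (τ i)| ≤ N := by
      refine (Finset.abs_sum_le_sum_abs _ _).trans (le_of_eq ?_)
      simp [abs_mul, abs_spin]
    rw [overlap, abs_mul, abs_of_nonneg (by positivity), one_div_mul_eq_div]
    exact (div_le_one (by positivity)).2 h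

/-- The normalised covariance `P! N^(-P) ∑_{i₁ < ⋯ < i_P} ∏ σ_i τ_i` of the `P`-spin noise. -/
def multiOverlap (P : ℕ) {N : ℕ} (σ τ : Fin N → Bool) : ℝ :=
  P.factorial * (∑ s : Inter P N, ∏ i ∈ s.1, spin (σ i) * spin (τ i)) / (N : ℝ) ^ P

lemma abs_multiOverlap_sub_le (P : ℕ) {N : ℕ} (hN : 0 < N) (σ τ : Fin N → Bool) :
    |multiOverlap P σ τ - overlap σ τ ^ P| ≤
      ((N : ℝ) ^ P - N.descFactorial P) / (N : ℝ) ^ P := by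
  have h := abs_factorial_mul_sum_sub_pow_le P (x := fun i => spin (σ i) * spin (τ i))
    fun i => by rw [abs_mul, abs_spin, abs_spin, one_mul]
  have h0 : (0 : ℝ) < (N : ℝ) ^ P := by positivity
  rw [← Model.natCast_mul_overlap, mul_pow] at h
  have e : multiOverlap P σ τ - overlap σ τ ^ P = (P.factorial *
      (∑ s : Inter P N, ∏ i ∈ s.1, spin (σ i) * spin (τ i)) - (N : ℝ) ^ P * overlap σ τ ^ P) /
      (N : ℝ) ^ P := by
    unfold multiOverlap
    rw [sub_div, mul_div_cancel_left₀ _ h0.ne']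
  rw [e, abs_div, abs_of_pos h0]
  exact div_le_div_of_nonneg_right h h0.le

lemma abs_multiOverlap_le (P : ℕ) {N : ℕ} (σ τ : Fin N → Bool) : |multiOverlap P σ τ| ≤ 1 := by
  have h := abs_factorial_mul_sum_le P (x := fun i => spin (σ i) * spin (τ i))
    fun i => by rw [abs_mul, abs_spin, abs_spin, one_mul]
  unfold multiOverlap
  rw [abs_div, abs_of_nonneg (by positivity : (0 : ℝ) ≤ (N : ℝ) ^ P)]
  exact div_le_one_of_le₀ h (by positivity)

lemma overlap_self {N : ℕ} (hN : 0 < N) (σ : Fin N → Bool) : overlap σ σ = 1 := by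
  have : (N : ℝ) ≠ 0 := by positivity
  simp [overlap, spin_mul_self, this]

namespace Model

variable (D : Model)

section

variable {N : ℕ}

lemma abs_dAvg_le (hr : 0 ≤ D.r) (hr1 : D.r ≤ 1)
    {F : (Fin N → Bool) → (Fin N → Fin D.M → Bool) → ℝ} {B : ℝ} (hF : ∀ ξ η, |F ξ η| ≤ B) :
    |D.dAvg F| ≤ B := by
  unfold dAvg
  calc |∑ ξ, ∑ η, D.wt ξ η * F ξ η| ≤ ∑ ξ, ∑ η, D.wt ξ η * B := by
        refine (Finset.abs_sum_le_sum_abs _ _).trans (Finset.sum_le_sum fun ξ _ =>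
          (Finset.abs_sum_le_sum_abs _ _).trans (Finset.sum_le_sum fun η _ => ?_))
        rw [abs_mul, abs_of_nonneg (D.wt_nonneg hr hr1 ξ η)]
        exact mul_le_mul_of_nonneg_left (hF ξ η) (D.wt_nonneg hr hr1 ξ η)
    _ = B := by simp only [← Finset.sum_mul, D.sum_wt, one_mul]

lemma dAvg_add (F G : (Fin N → Bool) → (Fin N → Fin D.M → Bool) → ℝ) :
    D.dAvg (fun ξ η => F ξ η + G ξ η) = D.dAvg F + D.dAvg G := by
  simp only [dAvg, mul_add, Finset.sum_add_distrib]

lemma dAvg_sub (F G : (Fin N → Bool) → (Fin N → Fin D.M → Bool) → ℝ) :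
    D.dAvg (fun ξ η => F ξ η - G ξ η) = D.dAvg F - D.dAvg G := by
  simp only [dAvg, mul_sub, Finset.sum_sub_distrib]

lemma dAvg_const (c : ℝ) : D.dAvg (N := N) (fun _ _ => c) = c := by
  simp only [dAvg, ← Finset.sum_mul, D.sum_wt, one_mul]

lemma hasDerivAt_dAvg {F : ℝ → (Fin N → Bool) → (Fin N → Fin D.M → Bool) → ℝ}
    {F' : (Fin N → Bool) → (Fin N → Fin D.M → Bool) → ℝ} {t : ℝ}
    (h : ∀ ξ η, HasDerivAt (fun t => F t ξ η) (F' ξ η) t) :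
    HasDerivAt (fun t => D.dAvg (F t)) (D.dAvg F') t :=
  HasDerivAt.fun_sum fun ξ _ => HasDerivAt.fun_sum fun η _ => (h ξ η).const_mul _

lemma abs_classMag_le (η : Fin N → Fin D.M → Bool) (σ : Fin N → Bool) :
    |D.classMag η σ| ≤ |D.r / D.R| := by
  unfold classMag
  have h : |∑ i, ∑ a, spin (η i a) * spin (σ i)| ≤ (N : ℝ) * D.M := by
    refine (Finset.abs_sum_le_sum_abs _ _).trans ((Finset.sum_le_sum fun i _ =>
      Finset.abs_sum_le_sum_abs _ _).trans (le_of_eq ?_))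
    simp [abs_mul, abs_spin]
  rw [mul_assoc, abs_mul, abs_mul, abs_of_nonneg (by positivity : 0 ≤ 1 / ((N : ℝ) * D.M)),
    one_div_mul_eq_div]
  exact mul_le_of_le_one_right (abs_nonneg _) (div_le_one_of_le₀ h (by positivity))

end

/-- The interpolating free energy per site. -/
def guerra (θ n q₁ q₂ J : ℝ) (N : ℕ) (t : ℝ) : ℝ :=
  1 / (θ * N) * D.dAvg fun ξ η =>
    press θ (D.intC n J t ξ η) (D.intV q₁ t) (D.intZ (N := N) q₁ q₂ t)

/-- The average of `G` over two replicas of the interpolating model that share the disorder and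
the first-level field only. -/
def pairAvg₁ (θ n q₁ q₂ J t : ℝ) {N : ℕ} (G : (Fin N → Bool) → (Fin N → Bool) → ℝ) : ℝ :=
  D.dAvg fun ξ η => ∑ σ, ∑ τ, G σ τ *
    meanPair₁ θ (D.intC n J t ξ η) (D.intV q₁ t) (D.intZ (N := N) q₁ q₂ t) σ τ

/-- The average of `G` over two replicas of the interpolating model that share the disorder and
the Gaussian fields of both levels. -/
def pairAvg₂ (θ n q₁ q₂ J t : ℝ) {N : ℕ} (G : (Fin N → Bool) → (Fin N → Bool) → ℝ) : ℝ :=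
  D.dAvg fun ξ η => ∑ σ, ∑ τ, G σ τ *
    meanPair₂ θ (D.intC n J t ξ η) (D.intV q₁ t) (D.intZ (N := N) q₁ q₂ t) σ τ

/-- The derivative of the interpolating free energy per site. -/
def guerraDeriv (θ n q₁ q₂ J : ℝ) (N : ℕ) (t : ℝ) : ℝ :=
  D.β' / 2 * (1 + D.ρ) ^ ((D.P : ℝ) / 2) *
      D.avgClassMag N θ n q₁ q₂ J t (fun x => x ^ D.P - D.P * n ^ (D.P - 1) * x)
    + D.β' ^ 2 / 4 * D.loadN N *
      (multiOverlap D.P (fun _ : Fin N => true) (fun _ => true) - D.P * q₂ ^ (D.P - 1)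
        - (1 - θ) * D.pairAvg₂ θ n q₁ q₂ J t (N := N)
            (fun σ τ => multiOverlap D.P σ τ - D.P * q₂ ^ (D.P - 1) * overlap σ τ)
        - θ * D.pairAvg₁ θ n q₁ q₂ J t (N := N)
            (fun σ τ => multiOverlap D.P σ τ - D.P * q₁ ^ (D.P - 1) * overlap σ τ))

lemma loadN_nonneg (N : ℕ) : 0 ≤ D.loadN N := by unfold loadN; positivity

lemma A₁_sq (N : ℕ) {q₁ : ℝ} (hq₁ : 0 ≤ q₁) :
    D.A₁ N q₁ ^ 2 = D.β' ^ 2 * (D.loadN N * ((D.P : ℝ) / 2) * q₁ ^ (D.P - 1)) := by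
  have := D.loadN_nonneg N
  rw [A₁, mul_pow, Real.sq_sqrt (by positivity)]

lemma A₂_sq (N : ℕ) {q₁ q₂ : ℝ} (hq₁ : 0 ≤ q₁) (hq₂ : q₁ ≤ q₂) :
    D.A₂ N q₁ q₂ ^ 2 =
      D.β' ^ 2 * (D.loadN N * ((D.P : ℝ) / 2) * (q₂ ^ (D.P - 1) - q₁ ^ (D.P - 1))) := by
  have := D.loadN_nonneg N
  rw [A₂, mul_pow, Real.sq_sqrt]
  exact mul_nonneg (by positivity) (sub_nonneg.2 (pow_le_pow_left₀ hq₁ hq₂ _))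

/-- The covariance of the `P`-spin noise; its prefactor is expressed through the load. -/
lemma noiseAmp_sq_mul (hP : 1 ≤ D.P) {N : ℕ} (hN : 0 < N) (σ τ : Fin N → Bool) :
    D.noiseAmp N ^ 2 * ∑ s : Inter D.P N, ∏ i ∈ s.1, spin (σ i) * spin (τ i) =
      N * (D.β' ^ 2 / 2 * D.loadN N * multiOverlap D.P σ τ) := by
  unfold noiseAmp loadN multiOverlap
  have hN' : (N : ℝ) ≠ 0 := by positivity
  obtain ⟨p, hp⟩ : ∃ p, D.P = p + 1 := ⟨D.P - 1, by omega⟩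
  rw [hp]
  simp only [Nat.add_sub_cancel]
  rw [div_pow, mul_pow, mul_pow, Real.sq_sqrt (Nat.cast_nonneg _)]
  field_simp
  ring

section

variable {N : ℕ} {θ n q₁ q₂ J : ℝ}

/-- Derivative of the interpolating free energy at fixed archetype and examples. -/
lemma hasDerivAt_press_int (hP : 1 ≤ D.P) (hN : 0 < N) (hθ : 0 ≤ θ) (hθ1 : θ ≤ 1) (hq₁ : 0 ≤ q₁)
    (hq₂ : q₁ ≤ q₂) (ξ : Fin N → Bool) (η : Fin N → Fin D.M → Bool) {t : ℝ}
    (ht : t ∈ Set.Ioo (0 : ℝ) 1) :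
    HasDerivAt (fun t => press θ (D.intC n J t ξ η) (D.intV q₁ t) (D.intZ (N := N) q₁ q₂ t))
      (θ * N * (D.β' / 2 * (1 + D.ρ) ^ ((D.P : ℝ) / 2) *
        ∑ σ, (D.classMag η σ ^ D.P - D.P * n ^ (D.P - 1) * D.classMag η σ) *
          meanOne θ (D.intC n J t ξ η) (D.intV q₁ t) (D.intZ (N := N) q₁ q₂ t) σ
        + D.β' ^ 2 / 4 * D.loadN N *
      (multiOverlap D.P (fun _ : Fin N => true) (fun _ => true) - D.P * q₂ ^ (D.P - 1)
        - (1 - θ) * ∑ σ, ∑ τ, (multiOverlap D.P σ τ - D.P * q₂ ^ (D.P - 1) * overlap σ τ) *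
            meanPair₂ θ (D.intC n J t ξ η) (D.intV q₁ t) (D.intZ (N := N) q₁ q₂ t) σ τ
        - θ * ∑ σ, ∑ τ, (multiOverlap D.P σ τ - D.P * q₁ ^ (D.P - 1) * overlap σ τ) *
            meanPair₁ θ (D.intC n J t ξ η) (D.intV q₁ t) (D.intZ (N := N) q₁ q₂ t) σ τ))) t := by
  have hs : ∀ t ∈ Set.Ioo (0 : ℝ) 1, HasDerivAt (fun t => √t) (1 / (2 * √t)) t := fun t ht =>
    Real.hasDerivAt_sqrt ht.1.ne'
  have hs' : ∀ t ∈ Set.Ioo (0 : ℝ) 1,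
      HasDerivAt (fun t => √(1 - t)) (-(1 / (2 * √(1 - t)))) t := fun t ht => by
    have := ((hasDerivAt_id t).const_sub 1).sqrt (sub_pos.2 ht.2).ne'
    refine this.congr_deriv ?_
    simp only [id]
    ring
  have hp : ∀ t ∈ Set.Ioo (0 : ℝ) 1, 0 < √t := fun t ht => Real.sqrt_pos.2 ht.1
  have hp' : ∀ t ∈ Set.Ioo (0 : ℝ) 1, 0 < √(1 - t) := fun t ht =>
    Real.sqrt_pos.2 (sub_pos.2 ht.2)
  have hcs : ContinuousOn (fun t => 1 / (2 * √t)) (Set.Ioo 0 1) :=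
    continuousOn_const.div (by fun_prop) fun t ht => by have := hp t ht; positivity
  have hcs' : ContinuousOn (fun t => -(1 / (2 * √(1 - t)))) (Set.Ioo 0 1) :=
    (continuousOn_const.div (by fun_prop) fun t ht => by have := hp' t ht; positivity).neg
  have h := hasDerivAt_press (S := Fin N → Bool) (I := Inter D.P N ⊕ Fin N) (L := Fin N) hθ hθ1
    (U := Set.Ioo 0 1) isOpen_Ioo
    (c := fun t => D.intC n J t ξ η)
    (c' := fun _ σ => D.signal η σ - D.ψ n * N * D.classMag η σ)
    (v := fun t => D.intV q₁ t)
    (v' := fun t σ => Sum.elim (fun s => 1 / (2 * √t) * (D.noiseAmp N * ∏ i ∈ s.1, spin (σ i)))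
      (spinC (-(1 / (2 * √(1 - t))) * D.A₁ N q₁) σ))
    (z := fun t => D.intZ q₁ q₂ t) (z' := fun t => spinC (-(1 / (2 * √(1 - t))) * D.A₂ N q₁ q₂))
    (fun t _ => hasDerivAt_pi.2 fun σ => by
      unfold intC
      have h1 := (((hasDerivAt_id t).mul_const (D.signal η σ)).const_add
        (J * ∑ i, spin (ξ i) * spin (σ i))).add
        (((((hasDerivAt_id t).const_sub 1).const_mul (D.ψ n)).mul_const (N : ℝ)).mul_const
          (D.classMag η σ))
      refine h1.congr_deriv ?_
      ring)
    continuousOn_const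
    (fun t ht => hasDerivAt_pi.2 fun σ => hasDerivAt_pi.2 fun i => by
      rcases i with s | i
      · exact (hs t ht).mul_const _
      · exact ((hs' t ht).mul_const _).mul_const _)
    (continuousOn_pi.2 fun σ => continuousOn_pi.2 fun i => by
      rcases i with s | i
      · exact hcs.mul continuousOn_const
      · exact (hcs'.mul continuousOn_const).mul continuousOn_const)
    (fun t ht => hasDerivAt_pi.2 fun σ => hasDerivAt_pi.2 fun i =>
      ((hs' t ht).mul_const _).mul_const _)
    (continuousOn_pi.2 fun σ => continuousOn_pi.2 fun i =>
      (hcs'.mul continuousOn_const).mul continuousOn_const) ht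
  refine h.congr_deriv ?_
  -- The square roots make the covariances independent of `t`.
  have e1 : 1 / (2 * √t) * √t = 1 / 2 := by have := (hp t ht).ne'; field_simp
  have e2 : -(1 / (2 * √(1 - t))) * √(1 - t) = -(1 / 2) := by
    have := (hp' t ht).ne'; field_simp
  have hcz : ∀ (a : ℝ) (σ τ : Fin N → Bool), ∑ i, spinC (-(1 / (2 * √(1 - t))) * a) σ i *
      spinC (√(1 - t) * a) τ i = N * (-(1 / 2) * a ^ 2 * overlap σ τ) := by
    intro a σ τ
    have : (N : ℝ) * (-(1 / 2) * a ^ 2 * overlap σ τ) =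
        -(1 / (2 * √(1 - t))) * √(1 - t) * a ^ 2 * (N * overlap σ τ) := by rw [e2]; ring
    rw [this, Model.natCast_mul_overlap, Finset.mul_sum]
    exact Finset.sum_congr rfl fun i _ => by simp only [spinC]; ring
  have hcovz : ∀ σ τ : Fin N → Bool, cov (spinC (-(1 / (2 * √(1 - t))) * D.A₂ N q₁ q₂))
      (D.intZ q₁ q₂ t) σ τ = N * (-(1 / 2) * D.A₂ N q₁ q₂ ^ 2 * overlap σ τ) := fun σ τ =>
    hcz _ σ τ
  have hcovv : ∀ σ τ : Fin N → Bool, cov (fun σ => Sum.elim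
      (fun s : Inter D.P N => 1 / (2 * √t) * (D.noiseAmp N * ∏ i ∈ s.1, spin (σ i)))
      (spinC (-(1 / (2 * √(1 - t))) * D.A₁ N q₁) σ)) (D.intV q₁ t) σ τ =
      N * (D.β' ^ 2 / 4 * D.loadN N * multiOverlap D.P σ τ
        - 1 / 2 * D.A₁ N q₁ ^ 2 * overlap σ τ) := by
    intro σ τ
    unfold cov
    rw [Fintype.sum_sum_type]
    simp only [Sum.elim_inl, Sum.elim_inr, intV, hcz]
    have : ∑ s : Inter D.P N, 1 / (2 * √t) * (D.noiseAmp N * ∏ i ∈ s.1, spin (σ i)) *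
        (√t * (D.noiseAmp N * ∏ i ∈ s.1, spin (τ i))) =
        1 / (2 * √t) * √t * (D.noiseAmp N ^ 2 *
          ∑ s : Inter D.P N, ∏ i ∈ s.1, spin (σ i) * spin (τ i)) := by
      simp only [Finset.mul_sum, Finset.prod_mul_distrib]
      exact Finset.sum_congr rfl fun s _ => by ring
    rw [this, e1, D.noiseAmp_sq_mul hP hN]
    ring
  have hself : ∀ σ : Fin N → Bool, multiOverlap D.P σ σ =
      multiOverlap D.P (fun _ : Fin N => true) (fun _ => true) := fun σ => by
    simp only [multiOverlap, spin_mul_self]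
  simp only [hcovv, hcovz, hself, overlap_self hN, D.A₁_sq N hq₁, D.A₂_sq N hq₁ hq₂]
  have hc' : ∀ σ, D.signal η σ - D.ψ n * N * D.classMag η σ =
      N * (D.β' / 2 * (1 + D.ρ) ^ ((D.P : ℝ) / 2) *
        (D.classMag η σ ^ D.P - D.P * n ^ (D.P - 1) * D.classMag η σ)) := fun σ => by
    unfold signal ψ; ring
  have hone := sum_meanOne hθ (D.intC n J t ξ η) (D.intV q₁ t) (D.intZ (N := N) q₁ q₂ t)
  have f1 : ∀ m : (Fin N → Bool) → ℝ, ∑ σ, m σ = 1 → ∀ (X : (Fin N → Bool) → ℝ) (a b : ℝ),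
      ∑ σ, (X σ + a + b) * m σ = ∑ σ, X σ * m σ + (a + b) := by
    intro m hm X a b
    have : ∀ σ, (X σ + a + b) * m σ = X σ * m σ + (a + b) * m σ := fun σ => by ring
    simp only [this, Finset.sum_add_distrib, ← Finset.mul_sum, hm, mul_one]
  have f2 : ∀ (m G G' : (Fin N → Bool) → (Fin N → Bool) → ℝ) (a : ℝ),
      (∀ σ τ, G σ τ = a * G' σ τ) → ∑ σ, ∑ τ, G σ τ * m σ τ = a * ∑ σ, ∑ τ, G' σ τ * m σ τ := by
    intro m G G' a h
    simp only [h, Finset.mul_sum]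
    exact Finset.sum_congr rfl fun σ _ => Finset.sum_congr rfl fun τ _ => by ring
  rw [f1 _ hone,
    f2 (fun σ τ => meanPair₂ θ (D.intC n J t ξ η) (D.intV q₁ t) (D.intZ (N := N) q₁ q₂ t) σ τ) _
      (fun σ τ => multiOverlap D.P σ τ - D.P * q₂ ^ (D.P - 1) * overlap σ τ)
      (N * (D.β' ^ 2 / 4 * D.loadN N)) (fun σ τ => by ring),
    f2 (fun σ τ => meanPair₁ θ (D.intC n J t ξ η) (D.intV q₁ t) (D.intZ (N := N) q₁ q₂ t) σ τ) _
      (fun σ τ => multiOverlap D.P σ τ - D.P * q₁ ^ (D.P - 1) * overlap σ τ)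
      (N * (D.β' ^ 2 / 4 * D.loadN N)) (fun σ τ => by ring)]
  have f3 : ∀ m : (Fin N → Bool) → ℝ,
      ∑ σ, (D.signal η σ - D.ψ n * N * D.classMag η σ) * m σ =
      N * (D.β' / 2 * (1 + D.ρ) ^ ((D.P : ℝ) / 2) *
        ∑ σ, (D.classMag η σ ^ D.P - D.P * n ^ (D.P - 1) * D.classMag η σ) * m σ) := fun m => by
    simp only [hc', Finset.mul_sum]
    exact Finset.sum_congr rfl fun σ _ => by ring
  rw [f3]
  ring

lemma hasDerivAt_guerra (hP : 1 ≤ D.P) (hN : 0 < N) (hθ : 0 < θ) (hθ1 : θ ≤ 1) (hq₁ : 0 ≤ q₁)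
    (hq₂ : q₁ ≤ q₂) {t : ℝ} (ht : t ∈ Set.Ioo (0 : ℝ) 1) :
    HasDerivAt (D.guerra θ n q₁ q₂ J N) (D.guerraDeriv θ n q₁ q₂ J N t) t := by
  have h := (D.hasDerivAt_dAvg fun ξ η =>
    D.hasDerivAt_press_int (n := n) (J := J) hP hN hθ.le hθ1 hq₁ hq₂ ξ η ht).const_mul
      (1 / (θ * N))
  refine h.congr_deriv ?_
  have h0 : θ * (N : ℝ) ≠ 0 := by positivity
  rw [dAvg_const_mul, ← mul_assoc, one_div_mul_cancel h0, one_mul, guerraDeriv,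
    D.avgClassMag_eq n q₁ q₂ J t hθ.le, pairAvg₁, pairAvg₂]
  simp only [dAvg_add, dAvg_sub, dAvg_const_mul, dAvg_const]

lemma continuous_guerra (hθ : 0 ≤ θ) : Continuous (D.guerra θ n q₁ q₂ J N) := by
  unfold guerra dAvg
  refine continuous_const.mul (continuous_finsetSum _ fun ξ _ => continuous_finsetSum _ fun η _ =>
    continuous_const.mul ?_)
  refine (continuous_press hθ).comp (f := fun t => (D.intC n J t ξ η, D.intV q₁ t,
    D.intZ (N := N) q₁ q₂ t)) (Continuous.prodMk ?_ (Continuous.prodMk ?_ ?_))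
  · unfold intC; fun_prop
  · unfold intV
    refine continuous_pi fun σ => continuous_pi fun i => ?_
    rcases i with s | i
    · simp only [Sum.elim_inl]; fun_prop
    · simp only [Sum.elim_inr, spinC]; fun_prop
  · unfold intZ; fun_prop

/-- At `t = 1` the interpolating free energy is that of the original model. -/
lemma guerra_one (hθ : 0 < θ) (hβ : D.β' ≠ 0) :
    D.guerra θ n q₁ q₂ J N 1 = -D.β' * D.freeEnergyN N J := by
  unfold guerra freeEnergyN
  simp only [D.press_int_one n q₁ q₂ J _ _ hθ.le, dAvg_const_mul, ← E₀_eq]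
  have := hθ.ne'
  rcases eq_or_ne (N : ℝ) 0 with h | h
  · simp [h]
  · field_simp

/-- At `t = 0` the interpolating free energy is a one-site average. -/
lemma guerra_zero (hM : 1 ≤ D.M) (hr : 0 < D.r) (hr1 : D.r ≤ 1) (hθ : 0 < θ) (hN : 0 < N) :
    D.guerra θ n q₁ q₂ J N 0 = Real.log 2 + 1 / θ * D.siteAvg fun x y =>
      sitePress θ (D.siteField J n x y) (D.amp₁ (D.loadN N) q₁) (D.amp₂ (D.loadN N) q₁ q₂) := by
  unfold guerra
  simp only [D.press_int_zero n q₁ q₂ J _ _ hM hr hr1 hθ.le]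
  rw [D.dAvg_sum_site N fun x y => θ * Real.log 2 + sitePress θ (D.siteField J n x y)
    (D.amp₁ (D.loadN N) q₁) (D.amp₂ (D.loadN N) q₁ q₂)]
  have h : ∀ f : Bool → (Fin D.M → Bool) → ℝ, ∀ c : ℝ,
      D.siteAvg (fun x y => c + f x y) = c + D.siteAvg f := fun f c => by
    have := D.siteAvg_const c
    simp only [siteAvg, mul_add, Finset.sum_add_distrib] at this ⊢
    rw [this]
  rw [h]
  have h1 := hθ.ne'
  have h2 : (N : ℝ) ≠ 0 := by positivity
  field_simp

end

/-! ### The thermodynamic limit -/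

/-- Means over two replicas of a quantity close to `q₁₂ ^ k`, when `q₁₂` concentrates at `q` in mean
square. -/
lemma tendsto_dAvg_pair (hr : 0 ≤ D.r) (hr1 : D.r ≤ 1)
    {m : ∀ N, (Fin N → Bool) → (Fin N → Fin D.M → Bool) → (Fin N → Bool) → (Fin N → Bool) → ℝ}
    (hm : ∀ N ξ η σ τ, 0 ≤ m N ξ η σ τ) (hm1 : ∀ N ξ η, ∑ σ, ∑ τ, m N ξ η σ τ = 1) {q : ℝ}
    (h : Tendsto (fun N => D.dAvg fun ξ η => ∑ σ, ∑ τ, (overlap σ τ - q) ^ 2 * m N ξ η σ τ)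
      atTop (𝓝 0)) (k : ℕ) {G : ∀ N, (Fin N → Bool) → (Fin N → Bool) → ℝ} {δ : ℕ → ℝ}
    (hδ : Tendsto δ atTop (𝓝 0))
    (hG : ∀ᶠ N in atTop, ∀ σ τ, |G N σ τ - overlap σ τ ^ k| ≤ δ N) :
    Tendsto (fun N => D.dAvg fun ξ η => ∑ σ, ∑ τ, G N σ τ * m N ξ η σ τ) atTop (𝓝 (q ^ k)) := by
  have e : ∀ N (F : (Fin N → Bool) → (Fin N → Bool) → ℝ),
      (D.dAvg fun ξ η => ∑ σ, ∑ τ, F σ τ * m N ξ η σ τ) =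
      ∑ ω : (Fin N → Bool) × (Fin N → Fin D.M → Bool) × (Fin N → Bool) × (Fin N → Bool),
        (D.wt ω.1 ω.2.1 * m N ω.1 ω.2.1 ω.2.2.1 ω.2.2.2) * F ω.2.2.1 ω.2.2.2 := by
    intro N F
    simp only [dAvg, Fintype.sum_prod_type, Finset.mul_sum]
    exact Finset.sum_congr rfl fun ξ _ => Finset.sum_congr rfl fun η _ =>
      Finset.sum_congr rfl fun σ _ => Finset.sum_congr rfl fun τ _ => by ring
  simp only [e] at h ⊢
  refine tendsto_sum_of_sq
    (Ω := fun N => (Fin N → Bool) × (Fin N → Fin D.M → Bool) × (Fin N → Bool) × (Fin N → Bool))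
    (p := fun N ω => D.wt ω.1 ω.2.1 * m N ω.1 ω.2.1 ω.2.2.1 ω.2.2.2)
    (X := fun N ω => overlap ω.2.2.1 ω.2.2.2) (Y := fun N ω => G N ω.2.2.1 ω.2.2.2) k
    (fun N ω => mul_nonneg (D.wt_nonneg hr hr1 _ _) (hm _ _ _ _ _)) (fun N => ?_)
    (fun N ω => abs_overlap_le _ _) hδ (hG.mono fun N hN ω => hN _ _) h
  have := e N fun _ _ => 1
  simp only [mul_one, one_mul, hm1, D.dAvg_const] at this
  exact this.symm

lemma tendsto_loadN {γ : ℝ} (hK : Tendsto (fun N : ℕ => (D.K N : ℝ) / (N : ℝ) ^ (D.P - 1)) atTop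
    (𝓝 (γ * (2 / (D.P.factorial : ℝ))))) : Tendsto D.loadN atTop (𝓝 γ) := by
  have h := hK.mul_const ((D.P.factorial : ℝ) / 2)
  have hf : (D.P.factorial : ℝ) ≠ 0 := by positivity
  have e : γ * (2 / (D.P.factorial : ℝ)) * ((D.P.factorial : ℝ) / 2) = γ := by field_simp
  rw [e] at h
  refine h.congr fun N => ?_
  unfold loadN
  rw [div_mul_div_comm, mul_comm ((N : ℝ) ^ (D.P - 1)) 2]

end Model

/-! ### The one-site expressions -/

/-- Jensen's inequality for the tilted one-site law. -/
lemma siteT_one_sq_le {θ : ℝ} (hθ : 0 ≤ θ) (u b : ℝ) : siteT 1 θ u b ^ 2 ≤ siteT 2 θ u b := by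
  -- Jensen's inequality for the tilted law: the tilted mean of `(m - μ)² / 4` is nonnegative.
  rw [← tilt_siteMag_pow (ι := Unit) hθ 1 (fun _ => u) b (),
    ← tilt_siteMag_pow (ι := Unit) hθ 2 (fun _ => u) b ()]
  set μ := tilt θ (fun h => siteMag () h ^ 1) (fieldE fun _ : Unit => u) (spinC b) with hμ
  have hμ1 : |μ| ≤ 1 := abs_tilt_le hθ (abs_siteMag_pow_le () 1) _ _
  have hc := fun k : ℕ => (continuous_siteMag (ι := Unit) ()).pow k
  have h0 : 0 ≤ tilt θ (fun h => ∑ k : Fin 3, ![1 / 4 * siteMag () h ^ 2,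
      -(1 / 2 * μ) * siteMag () h ^ 1, 1 / 4 * μ ^ 2 * 1] k) (fieldE fun _ : Unit => u)
      (spinC b) := by
    refine tilt_nonneg hθ (fun h => ?_) _ _
    simp only [Fin.sum_univ_three, Matrix.cons_val]
    nlinarith [sq_nonneg (siteMag () h - μ)]
  rw [tilt_sum hθ Finset.univ (fun k => ?_) (fun k h => ?_)] at h0
  · simp only [Fin.sum_univ_three, Matrix.cons_val] at h0
    rw [tilt_mul_left, tilt_mul_left, tilt_mul_left, tilt_one hθ, ← hμ] at h0
    nlinarith
  · fin_cases k
    · exact continuous_const.mul (hc 2)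
    · exact continuous_const.mul (hc 1)
    · exact continuous_const
  · have h1 := abs_siteMag_pow_le () 1 h
    have h2 := abs_siteMag_pow_le () 2 h
    have h3 : |μ ^ 2| ≤ 1 := by rw [abs_pow]; exact pow_le_one₀ (abs_nonneg _) hμ1
    fin_cases k
    · simp only [Fin.zero_eta, Matrix.cons_val_zero, abs_mul]
      norm_num
      linarith [le_abs_self (siteMag () h ^ 2)]
    · simp only [Fin.mk_one, Matrix.cons_val_one, Matrix.cons_val_zero, abs_mul, abs_neg]
      norm_num at h1 ⊢
      nlinarith [abs_nonneg μ, abs_nonneg (siteMag () h)]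
    · simp only [Fin.reduceFinMk, Matrix.cons_val, abs_mul]
      norm_num
      linarith [le_abs_self (μ ^ 2)]

lemma siteQ₁_nonneg {θ : ℝ} (u a b : ℝ) : 0 ≤ siteQ₁ θ u a b :=
  integral_nonneg fun _ => sq_nonneg _

lemma siteQ₁_le_siteQ₂ {θ : ℝ} (hθ : 0 ≤ θ) (u a b : ℝ) : siteQ₁ θ u a b ≤ siteQ₂ θ u a b := by
  have hi : ∀ k l : ℕ, Integrable (fun x => siteT k θ (u + x * a) b ^ l) (gaussianReal 0 1) :=
    fun k l => Integrable.of_bound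
      ((((continuous_siteT hθ k).comp (f := fun x : ℝ => (u + x * a, b)) (by fun_prop)).pow
        l).aestronglyMeasurable) 1 (ae_of_all _ fun x => by
          rw [Real.norm_eq_abs, abs_pow]
          exact pow_le_one₀ (abs_nonneg _) (abs_siteT_le hθ k _ _))
  refine integral_mono (hi 1 2) ((hi 2 1).congr (ae_of_all _ fun x => pow_one _)) fun x =>
    siteT_one_sq_le hθ _ _

namespace Model

variable (D : Model)

lemma siteAvg_mono (hr : 0 ≤ D.r) (hr1 : D.r ≤ 1) {f g : Bool → (Fin D.M → Bool) → ℝ}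
    (h : ∀ x y, f x y ≤ g x y) : D.siteAvg f ≤ D.siteAvg g :=
  Finset.sum_le_sum fun x _ => Finset.sum_le_sum fun y _ =>
    mul_le_mul_of_nonneg_left (h x y) (D.siteWt_nonneg hr hr1 x y)

lemma pressure_eq (θ γ J n q₁ q₂ : ℝ) : D.pressure θ γ J n q₁ q₂ =
    Real.log 2 + 1 / θ * D.siteAvg (fun x y =>
      sitePress θ (D.siteField J n x y) (D.amp₁ γ q₁) (D.amp₂ γ q₁ q₂))
    + D.β' ^ 2 / 4 * γ * (1 - (D.P : ℝ) * q₂ ^ (D.P - 1) + ((D.P : ℝ) - 1) * q₂ ^ D.P)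
    - D.β' / 2 * ((D.P : ℝ) - 1) * (1 + D.ρ) ^ ((D.P : ℝ) / 2) * n ^ D.P
    - D.β' ^ 2 / 4 * γ * ((D.P : ℝ) - 1) * θ * (q₂ ^ D.P - q₁ ^ D.P) := rfl

lemma E₁_eq (f : Bool → (Fin D.M → Bool) → ℝ → ℝ) :
    D.E₁ f = D.siteAvg fun x y => ∫ y₁, f x y y₁ ∂gaussianReal 0 1 := rfl

lemma tanhAvg_eq (k : ℕ) (θ γ J n q₁ q₂ : ℝ) (x : Bool) (y : Fin D.M → Bool) (y₁ : ℝ) :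
    D.tanhAvg k θ γ J n q₁ q₂ x y y₁ =
      siteT k θ (D.siteField J n x y + y₁ * D.amp₁ γ q₁) (D.amp₂ γ q₁ q₂) := rfl

lemma mBar_eq (θ γ J n q₁ q₂ : ℝ) : D.mBar θ γ J n q₁ q₂ = D.siteAvg fun x y =>
    siteM θ (D.siteField J n x y) (D.amp₁ γ q₁) (D.amp₂ γ q₁ q₂) * spin x := by
  simp only [mBar, E₁_eq, tanhAvg_eq, integral_mul_const, siteM]

/-- The self-consistency equations in terms of the one-site functions. -/
lemma selfConsistent_iff (θ γ J n q₁ q₂ : ℝ) : D.SelfConsistent θ γ J n q₁ q₂ ↔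
    n = 1 / (1 + D.ρ) * D.siteAvg (fun x y =>
      siteM θ (D.siteField J n x y) (D.amp₁ γ q₁) (D.amp₂ γ q₁ q₂) * D.etaHat y) ∧
    q₁ = D.siteAvg (fun x y =>
      siteQ₁ θ (D.siteField J n x y) (D.amp₁ γ q₁) (D.amp₂ γ q₁ q₂)) ∧
    q₂ = D.siteAvg (fun x y =>
      siteQ₂ θ (D.siteField J n x y) (D.amp₁ γ q₁) (D.amp₂ γ q₁ q₂)) := by
  have e : (D.E₁ fun ξ η y₁ => D.tanhAvg 1 θ γ J n q₁ q₂ ξ η y₁ * D.etaHat η) =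
      D.siteAvg (fun x y =>
      siteM θ (D.siteField J n x y) (D.amp₁ γ q₁) (D.amp₂ γ q₁ q₂) * D.etaHat y) := by
    simp only [E₁_eq, tanhAvg_eq, integral_mul_const, siteM]
  constructor
  · rintro ⟨h1, h2, h3⟩
    exact ⟨e ▸ h1, h2, h3⟩
  · rintro ⟨h1, h2, h3⟩
    exact ⟨e ▸ h1, h2, h3⟩

section

variable {θ : ℝ} {X : Type*} {l : Filter X}

/-- Convergence of the arguments of the one-site functions. -/
lemma tendsto_siteArgs {γ J n q₁ q₂ : X → ℝ} {γ₀ J₀ n₀ a₁ a₂ : ℝ} (hγ : Tendsto γ l (𝓝 γ₀))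
    (hJ : Tendsto J l (𝓝 J₀)) (hn : Tendsto n l (𝓝 n₀)) (h₁ : Tendsto q₁ l (𝓝 a₁))
    (h₂ : Tendsto q₂ l (𝓝 a₂)) (x : Bool) (y : Fin D.M → Bool) :
    Tendsto (fun i => (D.siteField (J i) (n i) x y, D.amp₁ (γ i) (q₁ i),
      D.amp₂ (γ i) (q₁ i) (q₂ i))) l
      (𝓝 (D.siteField J₀ n₀ x y, D.amp₁ γ₀ a₁, D.amp₂ γ₀ a₁ a₂)) := by
  refine Tendsto.prodMk_nhds ?_ (Tendsto.prodMk_nhds ?_ ?_)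
  · exact (hJ.mul_const _).add ((((hn.pow _).const_mul _).mul_const _).mul_const _)
  · exact (((hγ.mul_const _).mul (h₁.pow _)).sqrt).const_mul _
  · exact (((hγ.mul_const _).mul ((h₂.pow _).sub (h₁.pow _))).sqrt).const_mul _

/-- The average over one site of a continuous function of the local field and its amplitudes
converges with the order parameters. -/
lemma tendsto_siteAvg {f : ℝ × ℝ × ℝ → ℝ} (hf : Continuous f) (c : Bool → (Fin D.M → Bool) → ℝ)
    {γ J n q₁ q₂ : X → ℝ} {γ₀ J₀ n₀ a₁ a₂ : ℝ} (hγ : Tendsto γ l (𝓝 γ₀))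
    (hJ : Tendsto J l (𝓝 J₀)) (hn : Tendsto n l (𝓝 n₀)) (h₁ : Tendsto q₁ l (𝓝 a₁))
    (h₂ : Tendsto q₂ l (𝓝 a₂)) :
    Tendsto (fun i => D.siteAvg fun x y => f (D.siteField (J i) (n i) x y, D.amp₁ (γ i) (q₁ i),
      D.amp₂ (γ i) (q₁ i) (q₂ i)) * c x y) l (𝓝 (D.siteAvg fun x y =>
        f (D.siteField J₀ n₀ x y, D.amp₁ γ₀ a₁, D.amp₂ γ₀ a₁ a₂) * c x y)) :=
  tendsto_finsetSum _ fun x _ => tendsto_finsetSum _ fun y _ =>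
    (((hf.tendsto _).comp (D.tendsto_siteArgs hγ hJ hn h₁ h₂ x y)).mul_const _).const_mul _

variable {γ J n q₁ q₂ : X → ℝ} {γ₀ J₀ n₀ a₁ a₂ : ℝ}

lemma tendsto_siteAvg_sitePress (hθ : 0 ≤ θ) (hγ : Tendsto γ l (𝓝 γ₀))
    (hJ : Tendsto J l (𝓝 J₀)) (hn : Tendsto n l (𝓝 n₀)) (h₁ : Tendsto q₁ l (𝓝 a₁))
    (h₂ : Tendsto q₂ l (𝓝 a₂)) :
    Tendsto (fun i => D.siteAvg fun x y => sitePress θ (D.siteField (J i) (n i) x y)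
      (D.amp₁ (γ i) (q₁ i)) (D.amp₂ (γ i) (q₁ i) (q₂ i))) l (𝓝 (D.siteAvg fun x y =>
        sitePress θ (D.siteField J₀ n₀ x y) (D.amp₁ γ₀ a₁) (D.amp₂ γ₀ a₁ a₂))) := by
  simpa only [mul_one] using
    D.tendsto_siteAvg (continuous_sitePress hθ) (fun _ _ => 1) hγ hJ hn h₁ h₂

lemma tendsto_siteAvg_siteM (hθ : 0 ≤ θ) (c : Bool → (Fin D.M → Bool) → ℝ)
    (hγ : Tendsto γ l (𝓝 γ₀)) (hJ : Tendsto J l (𝓝 J₀)) (hn : Tendsto n l (𝓝 n₀))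
    (h₁ : Tendsto q₁ l (𝓝 a₁)) (h₂ : Tendsto q₂ l (𝓝 a₂)) :
    Tendsto (fun i => D.siteAvg fun x y => siteM θ (D.siteField (J i) (n i) x y)
      (D.amp₁ (γ i) (q₁ i)) (D.amp₂ (γ i) (q₁ i) (q₂ i)) * c x y) l (𝓝 (D.siteAvg fun x y =>
        siteM θ (D.siteField J₀ n₀ x y) (D.amp₁ γ₀ a₁) (D.amp₂ γ₀ a₁ a₂) * c x y)) :=
  D.tendsto_siteAvg (continuous_siteM hθ) c hγ hJ hn h₁ h₂

lemma tendsto_siteAvg_siteQ₁ (hθ : 0 ≤ θ) (hγ : Tendsto γ l (𝓝 γ₀))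
    (hJ : Tendsto J l (𝓝 J₀)) (hn : Tendsto n l (𝓝 n₀)) (h₁ : Tendsto q₁ l (𝓝 a₁))
    (h₂ : Tendsto q₂ l (𝓝 a₂)) :
    Tendsto (fun i => D.siteAvg fun x y => siteQ₁ θ (D.siteField (J i) (n i) x y)
      (D.amp₁ (γ i) (q₁ i)) (D.amp₂ (γ i) (q₁ i) (q₂ i))) l (𝓝 (D.siteAvg fun x y =>
        siteQ₁ θ (D.siteField J₀ n₀ x y) (D.amp₁ γ₀ a₁) (D.amp₂ γ₀ a₁ a₂))) := by
  simpa only [mul_one] using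
    D.tendsto_siteAvg (continuous_siteQ₁ hθ) (fun _ _ => 1) hγ hJ hn h₁ h₂

lemma tendsto_siteAvg_siteQ₂ (hθ : 0 ≤ θ) (hγ : Tendsto γ l (𝓝 γ₀))
    (hJ : Tendsto J l (𝓝 J₀)) (hn : Tendsto n l (𝓝 n₀)) (h₁ : Tendsto q₁ l (𝓝 a₁))
    (h₂ : Tendsto q₂ l (𝓝 a₂)) :
    Tendsto (fun i => D.siteAvg fun x y => siteQ₂ θ (D.siteField (J i) (n i) x y)
      (D.amp₁ (γ i) (q₁ i)) (D.amp₂ (γ i) (q₁ i) (q₂ i))) l (𝓝 (D.siteAvg fun x y =>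
        siteQ₂ θ (D.siteField J₀ n₀ x y) (D.amp₁ γ₀ a₁) (D.amp₂ γ₀ a₁ a₂))) := by
  simpa only [mul_one] using
    D.tendsto_siteAvg (continuous_siteQ₂ hθ) (fun _ _ => 1) hγ hJ hn h₁ h₂

lemma tendsto_pressure (hθ : 0 ≤ θ) (γ : ℝ) (hJ : Tendsto J l (𝓝 J₀)) (hn : Tendsto n l (𝓝 n₀))
    (h₁ : Tendsto q₁ l (𝓝 a₁)) (h₂ : Tendsto q₂ l (𝓝 a₂)) :
    Tendsto (fun i => D.pressure θ γ (J i) (n i) (q₁ i) (q₂ i)) l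
      (𝓝 (D.pressure θ γ J₀ n₀ a₁ a₂)) := by
  simp only [pressure_eq]
  refine Tendsto.sub (Tendsto.sub (Tendsto.add (Tendsto.const_add _
    (Tendsto.const_mul _ (D.tendsto_siteAvg_sitePress hθ tendsto_const_nhds hJ hn h₁ h₂)))
    (Tendsto.const_mul _ (Tendsto.add (Tendsto.const_sub _ ((h₂.pow _).const_mul _))
      ((h₂.pow _).const_mul _)))) ((hn.pow _).const_mul _))
    (((h₂.pow _).sub (h₁.pow _)).const_mul _)

lemma tendsto_mBar (hθ : 0 ≤ θ) (γ : ℝ) (hJ : Tendsto J l (𝓝 J₀)) (hn : Tendsto n l (𝓝 n₀))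
    (h₁ : Tendsto q₁ l (𝓝 a₁)) (h₂ : Tendsto q₂ l (𝓝 a₂)) :
    Tendsto (fun i => D.mBar θ γ (J i) (n i) (q₁ i) (q₂ i)) l (𝓝 (D.mBar θ γ J₀ n₀ a₁ a₂)) := by
  simp only [mBar_eq]
  exact D.tendsto_siteAvg_siteM hθ _ tendsto_const_nhds hJ hn h₁ h₂

/-- The self-consistency equations are closed conditions. -/
lemma SelfConsistent.of_tendsto {D : Model} [l.NeBot] (hθ : 0 ≤ θ) {γ : ℝ}
    (h : ∀ᶠ i in l, D.SelfConsistent θ γ (J i) (n i) (q₁ i) (q₂ i))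
    (hJ : Tendsto J l (𝓝 J₀)) (hn : Tendsto n l (𝓝 n₀)) (h₁ : Tendsto q₁ l (𝓝 a₁))
    (h₂ : Tendsto q₂ l (𝓝 a₂)) : D.SelfConsistent θ γ J₀ n₀ a₁ a₂ := by
  simp only [selfConsistent_iff] at h ⊢
  refine ⟨tendsto_nhds_unique (hn.congr' (h.mono fun i hi => hi.1))
    ((D.tendsto_siteAvg_siteM hθ (fun _ y => D.etaHat y) tendsto_const_nhds hJ hn h₁ h₂).const_mul
      _),
    tendsto_nhds_unique (h₁.congr' (h.mono fun i hi => hi.2.1))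
      (D.tendsto_siteAvg_siteQ₁ hθ tendsto_const_nhds hJ hn h₁ h₂),
    tendsto_nhds_unique (h₂.congr' (h.mono fun i hi => hi.2.2))
      (D.tendsto_siteAvg_siteQ₂ hθ tendsto_const_nhds hJ hn h₁ h₂)⟩

end

lemma SelfConsistent.q₁_nonneg {D : Model} {θ γ J n q₁ q₂ : ℝ}
    (h : D.SelfConsistent θ γ J n q₁ q₂) (hr : 0 ≤ D.r) (hr1 : D.r ≤ 1) : 0 ≤ q₁ := by
  rw [((D.selfConsistent_iff ..).1 h).2.1, ← D.siteAvg_const 0]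
  exact D.siteAvg_mono hr hr1 fun x y => siteQ₁_nonneg _ _ _

lemma SelfConsistent.q₁_le_q₂ {D : Model} {θ γ J n q₁ q₂ : ℝ}
    (h : D.SelfConsistent θ γ J n q₁ q₂) (hθ : 0 ≤ θ) (hr : 0 ≤ D.r) (hr1 : D.r ≤ 1) :
    q₁ ≤ q₂ := by
  have h' := (D.selfConsistent_iff ..).1 h
  calc q₁ = _ := h'.2.1
    _ ≤ _ := D.siteAvg_mono hr hr1 fun x y => siteQ₁_le_siteQ₂ hθ _ _ _
    _ = q₂ := h'.2.2.symm

end Model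

namespace Model

/-! ### Free energy and self-consistency equations -/

variable {D : Model} {θ γ J n q₁ q₂ : ℝ}

lemma avgClassMag_congr (hθ : 0 ≤ θ) {N : ℕ} {t : ℝ} {φ ψ : ℝ → ℝ}
    (h : ∀ x, |x| ≤ |D.r / D.R| → φ x = ψ x) :
    D.avgClassMag N θ n q₁ q₂ J t φ = D.avgClassMag N θ n q₁ q₂ J t ψ := by
  simp only [D.avgClassMag_eq n q₁ q₂ J t hθ, h _ (D.abs_classMag_le _ _)]

lemma OneRSB.tendsto_classMag_pow (h : D.OneRSB θ J n q₁ q₂) (hθ : 0 ≤ θ) {t : ℝ}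
    (ht : t ∈ Set.Icc (0 : ℝ) 1) (k : ℕ) :
    Tendsto (fun N => D.avgClassMag N θ n q₁ q₂ J t fun x => x ^ k) atTop (𝓝 (n ^ k)) :=
  tendsto_pow_of_weak (F := fun N φ => D.avgClassMag N θ n q₁ q₂ J t φ)
    (Eventually.of_forall fun _ _ _ => avgClassMag_congr hθ) (h.classMag_law t ht) k

lemma OneRSB.tendsto_pairAvg₁ (h : D.OneRSB θ J n q₁ q₂) (hθ : 0 ≤ θ) (hr : 0 ≤ D.r)
    (hr1 : D.r ≤ 1) {t : ℝ} (ht : t ∈ Set.Ico (0 : ℝ) 1) (k : ℕ)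
    {G : ∀ N, (Fin N → Bool) → (Fin N → Bool) → ℝ} {δ : ℕ → ℝ} (hδ : Tendsto δ atTop (𝓝 0))
    (hG : ∀ᶠ N in atTop, ∀ σ τ, |G N σ τ - overlap σ τ ^ k| ≤ δ N) :
    Tendsto (fun N => D.pairAvg₁ θ n q₁ q₂ J t (G N)) atTop (𝓝 (q₁ ^ k)) := by
  have h2 := h.overlap_level₁ t ht 2 le_rfl
  simp only [D.avgOverlap₁_eq n q₁ q₂ J t hθ] at h2
  exact D.tendsto_dAvg_pair hr hr1 (m := fun N ξ η σ τ => meanPair₁ θ (D.intC n J t ξ η)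
    (D.intV q₁ t) (D.intZ (N := N) q₁ q₂ t) σ τ) (fun N ξ η σ τ => meanPair₁_nonneg hθ _ _ _ _ _)
    (fun N ξ η => sum_meanPair₁ hθ _ _ _) h2 k hδ hG

lemma OneRSB.tendsto_pairAvg₂ (h : D.OneRSB θ J n q₁ q₂) (hθ : 0 ≤ θ) (hr : 0 ≤ D.r)
    (hr1 : D.r ≤ 1) {t : ℝ} (ht : t ∈ Set.Ico (0 : ℝ) 1) (k : ℕ)
    {G : ∀ N, (Fin N → Bool) → (Fin N → Bool) → ℝ} {δ : ℕ → ℝ} (hδ : Tendsto δ atTop (𝓝 0))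
    (hG : ∀ᶠ N in atTop, ∀ σ τ, |G N σ τ - overlap σ τ ^ k| ≤ δ N) :
    Tendsto (fun N => D.pairAvg₂ θ n q₁ q₂ J t (G N)) atTop (𝓝 (q₂ ^ k)) := by
  have h2 := h.overlap_level₂ t ht 2 le_rfl
  simp only [D.avgOverlap₂_eq n q₁ q₂ J t hθ] at h2
  exact D.tendsto_dAvg_pair hr hr1 (m := fun N ξ η σ τ => meanPair₂ θ (D.intC n J t ξ η)
    (D.intV q₁ t) (D.intZ (N := N) q₁ q₂ t) σ τ) (fun N ξ η σ τ => meanPair₂_nonneg hθ _ _ _ _ _)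
    (fun N ξ η => sum_meanPair₂ hθ _ _ _) h2 k hδ hG

/-- At time `0` the interpolating model factorises over the sites, so the assumed limits of the
order parameters are the one-site averages. -/
lemma OneRSB.selfConsistent (h : D.OneRSB θ J n q₁ q₂) (hM : 1 ≤ D.M) (hr : 0 < D.r)
    (hr1 : D.r ≤ 1) (hθ : 0 ≤ θ) (hγ : Tendsto D.loadN atTop (𝓝 γ)) :
    D.SelfConsistent θ γ J n q₁ q₂ := by
  have ho : ∀ N : ℕ, ∀ σ τ : Fin N → Bool, |overlap σ τ - overlap σ τ ^ 1| ≤ 0 := by simp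
  have l1 := h.tendsto_classMag_pow hθ (t := 0) (by simp) 1
  have l2 := h.tendsto_pairAvg₁ hθ hr.le hr1 (t := 0) (by simp) 1 tendsto_const_nhds
    (Eventually.of_forall ho)
  have l3 := h.tendsto_pairAvg₂ hθ hr.le hr1 (t := 0) (by simp) 1 tendsto_const_nhds
    (Eventually.of_forall ho)
  simp only [pow_one] at l1 l2 l3
  rw [selfConsistent_iff]
  refine ⟨tendsto_nhds_unique l1 (((D.tendsto_siteAvg_siteM hθ (fun _ y => D.etaHat y) hγ
      tendsto_const_nhds tendsto_const_nhds tendsto_const_nhds tendsto_const_nhds).const_mul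
        _).congr' ?_),
    tendsto_nhds_unique l2 ((D.tendsto_siteAvg_siteQ₁ hθ hγ tendsto_const_nhds tendsto_const_nhds
      tendsto_const_nhds tendsto_const_nhds).congr' ?_),
    tendsto_nhds_unique l3 ((D.tendsto_siteAvg_siteQ₂ hθ hγ tendsto_const_nhds tendsto_const_nhds
      tendsto_const_nhds tendsto_const_nhds).congr' ?_)⟩
  all_goals filter_upwards [eventually_gt_atTop 0] with N hN
  · exact (D.avgClassMag_zero n q₁ q₂ J hM hr hr1 hθ hN).symm
  · rw [← D.avgOverlap₁_zero n q₁ q₂ J hM hr hr1 hθ hN, D.avgOverlap₁_eq n q₁ q₂ J 0 hθ, pairAvg₁]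
  · rw [← D.avgOverlap₂_zero n q₁ q₂ J hM hr hr1 hθ hN, D.avgOverlap₂_eq n q₁ q₂ J 0 hθ, pairAvg₂]

lemma avgClassMag_sub_mul (hθ : 0 ≤ θ) (N : ℕ) (t c : ℝ) (φ ψ : ℝ → ℝ) :
    D.avgClassMag N θ n q₁ q₂ J t (fun x => φ x - c * ψ x) =
      D.avgClassMag N θ n q₁ q₂ J t φ - c * D.avgClassMag N θ n q₁ q₂ J t ψ := by
  simp only [D.avgClassMag_eq n q₁ q₂ J t hθ, sub_mul, Finset.sum_sub_distrib, mul_assoc,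
    ← Finset.mul_sum, dAvg_sub, dAvg_const_mul]

lemma pairAvg₁_sub_mul {N : ℕ} (t c : ℝ) (G H : (Fin N → Bool) → (Fin N → Bool) → ℝ) :
    D.pairAvg₁ θ n q₁ q₂ J t (fun σ τ => G σ τ - c * H σ τ) =
      D.pairAvg₁ θ n q₁ q₂ J t G - c * D.pairAvg₁ θ n q₁ q₂ J t H := by
  simp only [pairAvg₁, sub_mul, Finset.sum_sub_distrib, mul_assoc,
    ← Finset.mul_sum, dAvg_sub, dAvg_const_mul]

lemma pairAvg₂_sub_mul {N : ℕ} (t c : ℝ) (G H : (Fin N → Bool) → (Fin N → Bool) → ℝ) :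
    D.pairAvg₂ θ n q₁ q₂ J t (fun σ τ => G σ τ - c * H σ τ) =
      D.pairAvg₂ θ n q₁ q₂ J t G - c * D.pairAvg₂ θ n q₁ q₂ J t H := by
  simp only [pairAvg₂, sub_mul, Finset.sum_sub_distrib, mul_assoc,
    ← Finset.mul_sum, dAvg_sub, dAvg_const_mul]

lemma tendsto_multiOverlap_self (P : ℕ) : Tendsto (fun N : ℕ =>
    multiOverlap P (fun _ : Fin N => true) (fun _ => true)) atTop (𝓝 1) := by
  rw [tendsto_iff_norm_sub_tendsto_zero]
  refine squeeze_zero' (Eventually.of_forall fun _ => norm_nonneg _) ?_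
    (tendsto_one_sub_descFactorial_div P)
  filter_upwards [eventually_gt_atTop 0] with N hN
  have := abs_multiOverlap_sub_le P hN (fun _ => true) (fun _ => true)
  rwa [overlap_self hN, one_pow] at this

/-- Self-averaging of `n₁` and of the overlaps makes the derivative of the interpolating free energy
converge to a limit that does not depend on `t`. -/
lemma OneRSB.tendsto_guerraDeriv (h : D.OneRSB θ J n q₁ q₂) (hr : 0 < D.r)
    (hr1 : D.r ≤ 1) (hθ : 0 ≤ θ) (hγ : Tendsto D.loadN atTop (𝓝 γ)) {t : ℝ}
    (ht : t ∈ Set.Ioo (0 : ℝ) 1) :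
    Tendsto (fun N => D.guerraDeriv θ n q₁ q₂ J N t) atTop
      (𝓝 (D.β' / 2 * (1 + D.ρ) ^ ((D.P : ℝ) / 2) * (n ^ D.P - D.P * n ^ (D.P - 1) * n)
        + D.β' ^ 2 / 4 * γ * (1 - D.P * q₂ ^ (D.P - 1)
          - (1 - θ) * (q₂ ^ D.P - D.P * q₂ ^ (D.P - 1) * q₂)
          - θ * (q₁ ^ D.P - D.P * q₁ ^ (D.P - 1) * q₁)))) := by
  have ho : ∀ N : ℕ, ∀ σ τ : Fin N → Bool, |overlap σ τ - overlap σ τ ^ 1| ≤ 0 := by simp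
  have hm : ∀ᶠ N : ℕ in atTop, ∀ σ τ : Fin N → Bool, |multiOverlap D.P σ τ - overlap σ τ ^ D.P| ≤
      ((N : ℝ) ^ D.P - N.descFactorial D.P) / (N : ℝ) ^ D.P := by
    filter_upwards [eventually_gt_atTop 0] with N hN σ τ using abs_multiOverlap_sub_le _ hN σ τ
  have hδ := tendsto_one_sub_descFactorial_div D.P
  have ht' := Set.Ioo_subset_Ico_self ht
  have c1 := h.tendsto_classMag_pow hθ (Set.Ioo_subset_Icc_self ht) 1
  have o1 := h.tendsto_pairAvg₁ hθ hr.le hr1 ht' 1 tendsto_const_nhds (Eventually.of_forall ho)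
  have o2 := h.tendsto_pairAvg₂ hθ hr.le hr1 ht' 1 tendsto_const_nhds (Eventually.of_forall ho)
  simp only [pow_one] at c1 o1 o2
  unfold guerraDeriv
  simp only [avgClassMag_sub_mul hθ _ _ _ (fun x => x ^ D.P) (fun x => x), pairAvg₁_sub_mul,
    pairAvg₂_sub_mul]
  exact ((((h.tendsto_classMag_pow hθ (Set.Ioo_subset_Icc_self ht) D.P).sub
    (c1.const_mul _)).const_mul _).add ((hγ.const_mul _).mul
      ((((tendsto_multiOverlap_self D.P).sub tendsto_const_nhds).sub
        (((h.tendsto_pairAvg₂ hθ hr.le hr1 ht' D.P hδ hm).sub (o2.const_mul _)).const_mul _)).sub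
        (((h.tendsto_pairAvg₁ hθ hr.le hr1 ht' D.P hδ hm).sub (o1.const_mul _)).const_mul _))))

lemma abs_sum_mul_le {S : Type} [Fintype S] {m G : S → ℝ} {B : ℝ} (hm : ∀ σ, 0 ≤ m σ)
    (hm1 : ∑ σ, m σ = 1) (hG : ∀ σ, |G σ| ≤ B) : |∑ σ, G σ * m σ| ≤ B := by
  calc |∑ σ, G σ * m σ| ≤ ∑ σ, B * m σ := (Finset.abs_sum_le_sum_abs _ _).trans
        (Finset.sum_le_sum fun σ _ => by
          rw [abs_mul, abs_of_nonneg (hm σ)]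
          exact mul_le_mul_of_nonneg_right (hG σ) (hm σ))
    _ = B := by rw [← Finset.mul_sum, hm1, mul_one]

lemma abs_avgClassMag_le (hr : 0 ≤ D.r) (hr1 : D.r ≤ 1) (hθ : 0 ≤ θ) (N : ℕ) (t : ℝ) {φ : ℝ → ℝ}
    {B : ℝ} (hφ : ∀ x, |x| ≤ |D.r / D.R| → |φ x| ≤ B) :
    |D.avgClassMag N θ n q₁ q₂ J t φ| ≤ B := by
  rw [D.avgClassMag_eq n q₁ q₂ J t hθ]
  exact D.abs_dAvg_le hr hr1 fun ξ η => abs_sum_mul_le (fun σ => meanOne_nonneg hθ _ _ _ _)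
    (sum_meanOne hθ _ _ _) fun σ => hφ _ (D.abs_classMag_le η σ)

lemma abs_pairAvg₁_le (hr : 0 ≤ D.r) (hr1 : D.r ≤ 1) (hθ : 0 ≤ θ) {N : ℕ} (t : ℝ)
    {G : (Fin N → Bool) → (Fin N → Bool) → ℝ} {B : ℝ} (hG : ∀ σ τ, |G σ τ| ≤ B) :
    |D.pairAvg₁ θ n q₁ q₂ J t G| ≤ B := by
  refine D.abs_dAvg_le hr hr1 fun ξ η => ?_
  rw [← Fintype.sum_prod_type']
  refine abs_sum_mul_le (S := (Fin N → Bool) × (Fin N → Bool)) (G := fun p => G p.1 p.2)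
    (m := fun p => meanPair₁ θ (D.intC n J t ξ η) (D.intV q₁ t) (D.intZ (N := N) q₁ q₂ t) p.1 p.2)
    (fun p => meanPair₁_nonneg hθ _ _ _ _ _) ?_ fun p => hG _ _
  rw [Fintype.sum_prod_type]
  exact sum_meanPair₁ hθ _ _ _

lemma abs_pairAvg₂_le (hr : 0 ≤ D.r) (hr1 : D.r ≤ 1) (hθ : 0 ≤ θ) {N : ℕ} (t : ℝ)
    {G : (Fin N → Bool) → (Fin N → Bool) → ℝ} {B : ℝ} (hG : ∀ σ τ, |G σ τ| ≤ B) :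
    |D.pairAvg₂ θ n q₁ q₂ J t G| ≤ B := by
  refine D.abs_dAvg_le hr hr1 fun ξ η => ?_
  rw [← Fintype.sum_prod_type']
  refine abs_sum_mul_le (S := (Fin N → Bool) × (Fin N → Bool)) (G := fun p => G p.1 p.2)
    (m := fun p => meanPair₂ θ (D.intC n J t ξ η) (D.intV q₁ t) (D.intZ (N := N) q₁ q₂ t) p.1 p.2)
    (fun p => meanPair₂_nonneg hθ _ _ _ _ _) ?_ fun p => hG _ _
  rw [Fintype.sum_prod_type]
  exact sum_meanPair₂ hθ _ _ _

/-- The derivative of the interpolating free energy per site is bounded uniformly in the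
interpolation time and in the size. -/
lemma exists_abs_guerraDeriv_le (hr : 0 ≤ D.r) (hr1 : D.r ≤ 1) (hθ : 0 ≤ θ) (n q₁ q₂ J : ℝ)
    (hγ : Tendsto D.loadN atTop (𝓝 γ)) :
    ∃ B, ∀ᶠ N in atTop, ∀ t, |D.guerraDeriv θ n q₁ q₂ J N t| ≤ B := by
  set C := |D.r / D.R|
  have hp : ∀ (q : ℝ) {N : ℕ} (σ τ : Fin N → Bool),
      |multiOverlap D.P σ τ - D.P * q ^ (D.P - 1) * overlap σ τ| ≤
        1 + |D.P * q ^ (D.P - 1)| := fun q N σ τ => by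
    refine (abs_sub _ _).trans (add_le_add (abs_multiOverlap_le _ _ _) ?_)
    rw [abs_mul]
    exact mul_le_of_le_one_right (abs_nonneg _) (abs_overlap_le _ _)
  refine ⟨|D.β' / 2 * (1 + D.ρ) ^ ((D.P : ℝ) / 2)| * (C ^ D.P + |D.P * n ^ (D.P - 1)| * C) +
    |D.β' ^ 2 / 4| * (γ + 1) * (1 + |D.P * q₂ ^ (D.P - 1)|
      + |1 - θ| * (1 + |D.P * q₂ ^ (D.P - 1)|) + |θ| * (1 + |D.P * q₁ ^ (D.P - 1)|)), ?_⟩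
  filter_upwards [hγ.eventually (eventually_le_nhds (lt_add_one γ))] with N hN t
  have h0 := D.loadN_nonneg N
  unfold guerraDeriv
  refine (abs_add_le _ _).trans (add_le_add ?_ ?_)
  · rw [abs_mul]
    refine mul_le_mul_of_nonneg_left (abs_avgClassMag_le hr hr1 hθ N t fun x hx => ?_)
      (abs_nonneg _)
    refine (abs_sub _ _).trans (add_le_add ?_ ?_)
    · rw [abs_pow]; exact pow_le_pow_left₀ (abs_nonneg _) hx _
    · rw [abs_mul]; exact mul_le_mul_of_nonneg_left hx (abs_nonneg _)
  · rw [abs_mul, abs_mul, abs_of_nonneg h0]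
    refine mul_le_mul (mul_le_mul_of_nonneg_left hN (abs_nonneg _)) ?_ (abs_nonneg _)
      (mul_nonneg (abs_nonneg _) (h0.trans hN))
    refine (abs_sub _ _).trans (add_le_add ((abs_sub _ _).trans (add_le_add ((abs_sub _ _).trans
      (add_le_add (abs_multiOverlap_le _ _ _) le_rfl)) ?_)) ?_)
    · rw [abs_mul]
      exact mul_le_mul_of_nonneg_left (abs_pairAvg₂_le hr hr1 hθ t (hp q₂)) (abs_nonneg _)
    · rw [abs_mul]
      exact mul_le_mul_of_nonneg_left (abs_pairAvg₁_le hr hr1 hθ t (hp q₁)) (abs_nonneg _)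

lemma tendsto_freeEnergy_of_tendsto (hβ : D.β' ≠ 0) {p : ℝ}
    (h : Tendsto (fun N => -D.β' * D.freeEnergyN N J) atTop (𝓝 p)) :
    Tendsto (fun N => D.freeEnergyN N J) atTop (𝓝 (D.freeEnergy J)) ∧
      -D.β' * D.freeEnergy J = p := by
  have h0 : -D.β' ≠ 0 := neg_ne_zero.2 hβ
  have h1 : Tendsto (fun N => D.freeEnergyN N J) atTop (𝓝 ((-D.β')⁻¹ * p)) :=
    (h.const_mul (-D.β')⁻¹).congr fun N => inv_mul_cancel_left₀ h0 _
  have h2 : D.freeEnergy J = (-D.β')⁻¹ * p := h1.limUnder_eq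
  exact ⟨h2 ▸ h1, by rw [h2, mul_inv_cancel_left₀ h0]⟩

/-- Guerra's sum rule in the thermodynamic limit: the derivative of the interpolating free energy
converges to a constant, so the limit is the one-body free energy plus that constant. -/
lemma OneRSB.tendsto_freeEnergyN (h : D.OneRSB θ J n q₁ q₂) (hP : 1 ≤ D.P) (hM : 1 ≤ D.M)
    (hr : 0 < D.r) (hr1 : D.r ≤ 1) (hβ : D.β' ≠ 0) (hθ : 0 < θ) (hθ1 : θ ≤ 1)
    (hγ : Tendsto D.loadN atTop (𝓝 γ)) :
    Tendsto (fun N => -D.β' * D.freeEnergyN N J) atTop (𝓝 (D.pressure θ γ J n q₁ q₂)) := by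
  have hs := h.selfConsistent hM hr hr1 hθ.le hγ
  have h1 := hs.q₁_nonneg hr.le hr1
  have h2 := hs.q₁_le_q₂ hθ.le hr.le hr1
  obtain ⟨B, hB⟩ := exists_abs_guerraDeriv_le hr.le hr1 hθ.le n q₁ q₂ J hγ
  have hd := tendsto_sub_of_tendsto_deriv (f := D.guerra θ n q₁ q₂ J)
    (f' := D.guerraDeriv θ n q₁ q₂ J) (B := B)
    (Eventually.of_forall fun N => (D.continuous_guerra hθ.le).continuousOn)
    ((eventually_gt_atTop 0).mono fun N hN t ht => D.hasDerivAt_guerra hP hN hθ hθ1 h1 h2 ht)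
    (hB.mono fun N hN t _ => hN t) fun t ht => h.tendsto_guerraDeriv hr hr1 hθ.le hγ ht
  have h0 : Tendsto (fun N => D.guerra θ n q₁ q₂ J N 0) atTop (𝓝 (Real.log 2 + 1 / θ *
      D.siteAvg fun x y =>
        sitePress θ (D.siteField J n x y) (D.amp₁ γ q₁) (D.amp₂ γ q₁ q₂))) := by
    refine (((D.tendsto_siteAvg_sitePress hθ.le hγ tendsto_const_nhds tendsto_const_nhds
      tendsto_const_nhds tendsto_const_nhds).const_mul _).const_add _).congr' ?_
    filter_upwards [eventually_gt_atTop 0] with N hN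
    exact (D.guerra_zero hM hr hr1 hθ hN).symm
  have h3 := hd.add h0
  simp only [sub_add_cancel, D.guerra_one hθ hβ] at h3
  have e : ∀ x : ℝ, x ^ D.P = x ^ (D.P - 1) * x := fun x => (pow_sub_one_mul (by omega) x).symm
  convert h3 using 2
  rw [pressure_eq, e n, e q₁, e q₂]
  ring

lemma OneRSB.tendsto_freeEnergy (h : D.OneRSB θ J n q₁ q₂) (hP : 1 ≤ D.P) (hM : 1 ≤ D.M)
    (hr : 0 < D.r) (hr1 : D.r ≤ 1) (hβ : D.β' ≠ 0) (hθ : 0 < θ) (hθ1 : θ ≤ 1)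
    (hγ : Tendsto D.loadN atTop (𝓝 γ)) :
    Tendsto (fun N => D.freeEnergyN N J) atTop (𝓝 (D.freeEnergy J)) ∧
      -D.β' * D.freeEnergy J = D.pressure θ γ J n q₁ q₂ :=
  tendsto_freeEnergy_of_tendsto hβ (h.tendsto_freeEnergyN hP hM hr hr1 hβ hθ hθ1 hγ)
end Model

/-! ### Convexity in the field -/

/-- The Gibbs mean is a subgradient of the logarithm of the partition function. -/
lemma log_zf_add_sum_gib_le {S : Type} [Fintype S] [Nonempty S] (h a : S → ℝ) :
    Real.log (zf h) + ∑ σ, a σ * gib h σ ≤ Real.log (zf (h + a)) := by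
  have h0 := zf_pos h
  set m := ∑ σ, a σ * gib h σ with hm
  have e : zf h * Real.exp m ≤ zf (h + a) := by
    have h1 : ∀ σ, Real.exp (h σ) * (Real.exp m * (1 + (a σ - m))) ≤ Real.exp ((h + a) σ) := by
      intro σ
      have : Real.exp ((h + a) σ) = Real.exp (h σ) * (Real.exp m * Real.exp (a σ - m)) := by
        rw [← Real.exp_add, ← Real.exp_add, Pi.add_apply]
        congr 1; ring
      rw [this]
      gcongr
      linarith [Real.add_one_le_exp (a σ - m)]
    have h2 : ∑ σ, Real.exp (h σ) * (Real.exp m * (1 + (a σ - m))) = zf h * Real.exp m := by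
      have h3 : ∑ σ, Real.exp (h σ) * a σ = zf h * m := by
        rw [hm, Finset.mul_sum]
        refine Finset.sum_congr rfl fun σ _ => ?_
        unfold gib
        field_simp
      have h4 : ∀ σ, Real.exp (h σ) * (Real.exp m * (1 + (a σ - m))) =
          Real.exp m * (1 - m) * Real.exp (h σ) + Real.exp m * (Real.exp (h σ) * a σ) :=
        fun σ => by ring
      simp only [h4, Finset.sum_add_distrib, ← Finset.mul_sum, h3]
      rw [zf]
      ring
    rw [← h2]
    exact Finset.sum_le_sum fun σ _ => h1 σ
  calc Real.log (zf h) + m = Real.log (zf h * Real.exp m) := by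
        rw [Real.log_mul h0.ne' (Real.exp_pos m).ne', Real.log_exp]
    _ ≤ _ := Real.log_le_log (by positivity) e

lemma integrable_log_zf_lin {S I : Type} [Fintype S] [Nonempty S] [Fintype I] (c : S → ℝ)
    (v : S → I → ℝ) : Integrable (fun x => Real.log (zf (lin c v x))) (stdGaussian I) := by
  -- A level without second-level field and with `θ = 1` is the partition function.
  refine (integrable_log_level (L := Empty) (θ := 1) zero_le_one c v fun _ _ => 0).congr
    (ae_of_all _ fun x => ?_)
  have : ∀ (e : S → ℝ) (y : Empty → ℝ), lin e (fun _ _ => (0 : ℝ)) y = e := fun e y => by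
    ext σ; simp [lin]
  simp [level, this]

lemma abs_mattis_le {N : ℕ} (ξ σ : Fin N → Bool) : |mattis ξ σ| ≤ 1 := abs_overlap_le ξ σ

namespace Model

variable (D : Model)

section

variable {N : ℕ}

lemma dAvg_mono (hr : 0 ≤ D.r) (hr1 : D.r ≤ 1)
    {F G : (Fin N → Bool) → (Fin N → Fin D.M → Bool) → ℝ} (h : ∀ ξ η, F ξ η ≤ G ξ η) :
    D.dAvg F ≤ D.dAvg G :=
  Finset.sum_le_sum fun ξ _ => Finset.sum_le_sum fun η _ =>
    mul_le_mul_of_nonneg_left (h ξ η) (D.wt_nonneg hr hr1 ξ η)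

/-- The exponent of the Boltzmann factor without the noise term. -/
def signalC (J : ℝ) (ξ : Fin N → Bool) (η : Fin N → Fin D.M → Bool) (σ : Fin N → Bool) : ℝ :=
  J * ∑ i, spin (ξ i) * spin (σ i) + D.signal η σ

/-- The coefficients of the Gaussian couplings in the exponent of the Boltzmann factor. -/
def noiseV (σ : Fin N → Bool) (s : Inter D.P N) : ℝ := D.noiseAmp N * ∏ i ∈ s.1, spin (σ i)

lemma boltz_eq (J : ℝ) (ξ : Fin N → Bool) (η : Fin N → Fin D.M → Bool) (l : Inter D.P N → ℝ)
    (σ : Fin N → Bool) : D.boltz J ξ η l σ = Real.exp (lin (D.signalC J ξ η) D.noiseV l σ) := by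
  unfold boltz lin signalC noise noiseV noiseAmp
  congr 2
  rw [Finset.mul_sum]
  exact Finset.sum_congr rfl fun s _ => by ring

lemma Z_eq (J : ℝ) (ξ : Fin N → Bool) (η : Fin N → Fin D.M → Bool) (l : Inter D.P N → ℝ) :
    D.Z J ξ η l = zf (lin (D.signalC J ξ η) D.noiseV l) := by
  simp only [Z, boltz_eq, zf]

lemma meanMattis_eq (J : ℝ) : D.meanMattis N J = D.dAvg fun ξ η =>
    ∫ l, ∑ σ, mattis ξ σ * gib (lin (D.signalC J ξ η) D.noiseV l) σ
      ∂stdGaussian (Inter D.P N) := by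
  simp only [meanMattis, E₀_eq, Z_eq, boltz_eq, gib, Finset.sum_div, mul_div_assoc]

lemma neg_mul_freeEnergyN (hβ : D.β' ≠ 0) (J : ℝ) : -D.β' * D.freeEnergyN N J =
    1 / N * D.dAvg fun ξ η => ∫ l, Real.log (zf (lin (D.signalC J ξ η) D.noiseV l))
      ∂stdGaussian (Inter D.P N) := by
  simp only [freeEnergyN, E₀_eq, Z_eq]
  field_simp

lemma abs_sum_mattis_mul_gib_le (ξ : Fin N → Bool) (h : (Fin N → Bool) → ℝ) :
    |∑ σ, mattis ξ σ * gib h σ| ≤ 1 :=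
  abs_sum_mul_le (fun σ => gib_nonneg h σ) (sum_gib h) fun σ => abs_mattis_le ξ σ

lemma integrable_sum_mattis_mul_gib (ξ : Fin N → Bool) (c : (Fin N → Bool) → ℝ) :
    Integrable (fun l => ∑ σ, mattis ξ σ * gib (lin c D.noiseV l) σ)
      (stdGaussian (Inter D.P N)) := by
  refine Integrable.of_bound (Continuous.aestronglyMeasurable ?_) 1
    (ae_of_all _ fun l => abs_sum_mattis_mul_gib_le ξ _)
  refine continuous_finsetSum _ fun σ _ => continuous_const.mul ((continuous_gib σ).comp
    (f := fun l => lin c D.noiseV l) ?_)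
  unfold lin
  fun_prop

lemma abs_meanMattis_le (hr : 0 ≤ D.r) (hr1 : D.r ≤ 1) (J : ℝ) : |D.meanMattis N J| ≤ 1 := by
  rw [meanMattis_eq]
  refine D.abs_dAvg_le hr hr1 fun ξ η => ?_
  have := norm_integral_le_of_norm_le_const (μ := stdGaussian (Inter D.P N)) (C := 1)
    (f := fun l => ∑ σ, mattis ξ σ * gib (lin (D.signalC J ξ η) D.noiseV l) σ)
    (ae_of_all _ fun l => abs_sum_mattis_mul_gib_le ξ _)
  simpa using this

/-- The mean magnetization is a subgradient of the free energy with respect to the field. -/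
lemma add_meanMattis_mul_le (hr : 0 ≤ D.r) (hr1 : D.r ≤ 1) (hβ : D.β' ≠ 0) (hN : 0 < N)
    (J x : ℝ) :
    -D.β' * D.freeEnergyN N J + D.meanMattis N J * (x - J) ≤ -D.β' * D.freeEnergyN N x := by
  have hN' : (0 : ℝ) < N := by positivity
  rw [D.neg_mul_freeEnergyN hβ, D.neg_mul_freeEnergyN hβ, meanMattis_eq]
  have key : (D.dAvg fun ξ η => (∫ l, Real.log (zf (lin (D.signalC J ξ η) D.noiseV l))
      ∂stdGaussian (Inter D.P N)) + (N * (x - J)) *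
      ∫ l, ∑ σ, mattis ξ σ * gib (lin (D.signalC J ξ η) D.noiseV l) σ
        ∂stdGaussian (Inter D.P N)) ≤
      D.dAvg fun ξ η => ∫ l, Real.log (zf (lin (D.signalC x ξ η) D.noiseV l))
        ∂stdGaussian (Inter D.P N) := by
    refine D.dAvg_mono hr hr1 fun ξ η => ?_
    rw [← integral_const_mul, ← integral_add (integrable_log_zf_lin _ _)
      ((D.integrable_sum_mattis_mul_gib ξ _).const_mul _)]
    refine integral_mono ((integrable_log_zf_lin _ _).add
      ((D.integrable_sum_mattis_mul_gib ξ _).const_mul _)) (integrable_log_zf_lin _ _) fun l => ?_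
    have h := log_zf_add_sum_gib_le (lin (D.signalC J ξ η) D.noiseV l)
      fun σ => N * (x - J) * mattis ξ σ
    have e : lin (D.signalC J ξ η) D.noiseV l + (fun σ => N * (x - J) * mattis ξ σ) =
        lin (D.signalC x ξ η) D.noiseV l := by
      ext σ
      have : (N : ℝ) * mattis ξ σ = ∑ i, spin (ξ i) * spin (σ i) := natCast_mul_overlap ξ σ
      simp only [Pi.add_apply, lin, signalC, ← this]
      ring
    rw [e] at h
    simpa only [Finset.mul_sum, mul_assoc] using h
  rw [dAvg_add, dAvg_const_mul] at key
  have := mul_le_mul_of_nonneg_left key (by positivity : (0 : ℝ) ≤ 1 / N)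
  refine le_trans (le_of_eq ?_) this
  field_simp

/-- The free energy is `1`-Lipschitz in the field, as its subgradients are magnetizations. -/
lemma abs_freeEnergyN_sub_le (hr : 0 ≤ D.r) (hr1 : D.r ≤ 1) (hβ : D.β' ≠ 0) (hN : 0 < N)
    (J x : ℝ) : |-D.β' * D.freeEnergyN N x - -D.β' * D.freeEnergyN N J| ≤ |x - J| := by
  have h1 := D.add_meanMattis_mul_le hr hr1 hβ hN J x
  have h2 := D.add_meanMattis_mul_le hr hr1 hβ hN x J
  have hb : ∀ y : ℝ, |D.meanMattis N y * (x - J)| ≤ |x - J| := fun y => by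
    rw [abs_mul]
    exact mul_le_of_le_one_left (abs_nonneg _) (D.abs_meanMattis_le hr hr1 y)
  have h3 := (abs_le.1 (hb J)).1
  have h4 := (abs_le.1 (hb x)).2
  rw [abs_le]
  constructor <;> nlinarith

end

/-! ### Stationarity of the free energy in the order parameters -/

section

variable {D} {θ γ : ℝ}

lemma amp₁_eq (hβ : 0 ≤ D.β') (γ q₁ : ℝ) :
    D.amp₁ γ q₁ = √(D.β' ^ 2 * (γ * ((D.P : ℝ) / 2) * q₁ ^ (D.P - 1))) := by
  rw [amp₁, Real.sqrt_mul (sq_nonneg _), Real.sqrt_sq hβ]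

lemma amp₂_eq (hβ : 0 ≤ D.β') (γ q₁ q₂ : ℝ) : D.amp₂ γ q₁ q₂ =
    √(D.β' ^ 2 * (γ * ((D.P : ℝ) / 2) * (q₂ ^ (D.P - 1) - q₁ ^ (D.P - 1)))) := by
  rw [amp₂, Real.sqrt_mul (sq_nonneg _), Real.sqrt_sq hβ]

lemma siteAvg_add (f g : Bool → (Fin D.M → Bool) → ℝ) :
    D.siteAvg (fun x y => f x y + g x y) = D.siteAvg f + D.siteAvg g := by
  simp only [siteAvg, mul_add, Finset.sum_add_distrib]

lemma siteAvg_const_mul (c : ℝ) (f : Bool → (Fin D.M → Bool) → ℝ) :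
    D.siteAvg (fun x y => c * f x y) = c * D.siteAvg f := by
  simp only [siteAvg, Finset.mul_sum]
  exact Finset.sum_congr rfl fun x _ => Finset.sum_congr rfl fun y _ => by ring

lemma hasDerivAt_siteAvg {f : ℝ → Bool → (Fin D.M → Bool) → ℝ}
    {f' : Bool → (Fin D.M → Bool) → ℝ} {J : ℝ}
    (h : ∀ x y, HasDerivAt (fun J => f J x y) (f' x y) J) :
    HasDerivAt (fun J => D.siteAvg (f J)) (D.siteAvg f') J :=
  HasDerivAt.fun_sum fun x _ => HasDerivAt.fun_sum fun y _ => (h x y).const_mul _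

/-- The self-consistency equations make the pressure stationary in `n, q₁, q₂`, so only the explicit
dependence on the field contributes to the derivative. -/
lemma hasDerivAt_pressure (hP : 2 ≤ D.P) (hρ : 0 < 1 + D.ρ) (hβ : 0 ≤ D.β')
    (hθ : 0 < θ) (hθ1 : θ ≤ 1) (hγ : 0 ≤ γ) {n q₁ q₂ : ℝ → ℝ} {J : ℝ}
    (hn : DifferentiableAt ℝ n J) (h₁ : DifferentiableAt ℝ q₁ J) (h₂ : DifferentiableAt ℝ q₂ J)
    (h0 : ∀ᶠ x in 𝓝 J, 0 ≤ q₁ x) (h12 : ∀ᶠ x in 𝓝 J, q₁ x ≤ q₂ x)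
    (hs : D.SelfConsistent θ γ J (n J) (q₁ J) (q₂ J)) :
    HasDerivAt (fun x => D.pressure θ γ x (n x) (q₁ x) (q₂ x))
      (D.mBar θ γ J (n J) (q₁ J) (q₂ J)) J := by
  have dn := hn.hasDerivAt
  have d₁ := h₁.hasDerivAt
  have d₂ := h₂.hasDerivAt
  set n' := deriv n J
  set q₁' := deriv q₁ J
  set q₂' := deriv q₂ J
  obtain ⟨s1, s2, s3⟩ := (D.selfConsistent_iff ..).1 hs
  have hA := ((d₁.pow (D.P - 1)).const_mul (γ * ((D.P : ℝ) / 2))).const_mul (D.β' ^ 2)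
  have hB := (((d₂.pow (D.P - 1)).sub (d₁.pow (D.P - 1))).const_mul
    (γ * ((D.P : ℝ) / 2))).const_mul (D.β' ^ 2)
  have hsite := hasDerivAt_siteAvg (D := D) (J := J) fun x y =>
    hasDerivAt_sitePress_sqrt hθ.le hθ1
    (u := fun J => D.siteField J (n J) x y)
    (((hasDerivAt_id J).mul_const (spin x)).add ((((dn.pow (D.P - 1)).const_mul
      (D.β' * ((D.P : ℝ) / 2))).mul_const ((1 + D.ρ) ^ ((D.P : ℝ) / 2 - 1))).mul_const
        (D.etaHat y))) hA hB
    (h0.mono fun x hx => by simp only [Pi.pow_apply]; positivity)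
    ((h0.and h12).mono fun x hx => by
      have := sub_nonneg.2 (pow_le_pow_left₀ hx.1 hx.2 (D.P - 1))
      simp only [Pi.pow_apply, Pi.sub_apply]
      positivity)
  simp only [Pi.pow_apply, Pi.sub_apply, ← amp₁_eq hβ, ← amp₂_eq hβ] at hsite
  simp only [pressure_eq]
  have hF := (((hsite.const_mul (1 / θ)).const_add (Real.log 2)).add
    ((((d₂.pow (D.P - 1)).const_mul (D.P : ℝ)).const_sub 1).add
      ((d₂.pow D.P).const_mul ((D.P : ℝ) - 1)) |>.const_mul (D.β' ^ 2 / 4 * γ))).sub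
    ((dn.pow D.P).const_mul (D.β' / 2 * ((D.P : ℝ) - 1) * (1 + D.ρ) ^ ((D.P : ℝ) / 2))) |>.sub
    (((d₂.pow D.P).sub (d₁.pow D.P)).const_mul (D.β' ^ 2 / 4 * γ * ((D.P : ℝ) - 1) * θ))
  refine hF.congr_deriv ?_
  rw [mBar_eq]
  have hlin : ∀ (M Q₁ Q₂ : Bool → (Fin D.M → Bool) → ℝ) (a b c : ℝ),
      D.siteAvg (fun x y => θ * ((1 * spin x + a * D.etaHat y) * M x y
        + b * (1 - (1 - θ) * Q₂ x y) - c * (θ * Q₁ x y))) =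
      θ * (D.siteAvg (fun x y => M x y * spin x) + a * D.siteAvg (fun x y => M x y * D.etaHat y)
        + b * (1 - (1 - θ) * D.siteAvg Q₂) - c * (θ * D.siteAvg Q₁)) := by
    intro M Q₁ Q₂ a b c
    have e : ∀ x y, θ * ((1 * spin x + a * D.etaHat y) * M x y
        + b * (1 - (1 - θ) * Q₂ x y) - c * (θ * Q₁ x y)) =
        θ * (M x y * spin x) + θ * a * (M x y * D.etaHat y) + θ * b
          + -(θ * b * (1 - θ)) * Q₂ x y + -(θ * c * θ) * Q₁ x y := fun x y => by ring
    simp only [e, siteAvg_add, siteAvg_const_mul, siteAvg_const]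
    ring
  have s1' : D.siteAvg (fun x y => siteM θ (D.siteField J (n J) x y) (D.amp₁ γ (q₁ J))
      (D.amp₂ γ (q₁ J) (q₂ J)) * D.etaHat y) = (1 + D.ρ) * n J := by
    rw [← mul_right_inj' (one_div_ne_zero hρ.ne'), ← s1, ← mul_assoc,
      one_div_mul_cancel hρ.ne', one_mul]
  rw [hlin, s1', ← s2, ← s3]
  have hκ : (1 + D.ρ) ^ ((D.P : ℝ) / 2) = (1 + D.ρ) ^ ((D.P : ℝ) / 2 - 1) * (1 + D.ρ) := by
    rw [Real.rpow_sub_one hρ.ne', div_mul_cancel₀ _ hρ.ne']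
  rw [hκ]
  obtain ⟨p, hp⟩ : ∃ p, D.P = p + 2 := ⟨D.P - 2, by omega⟩
  -- What remains is the cancellation of the derivatives of the order parameters.
  generalize (1 + D.ρ) ^ ((D.P : ℝ) / 2 - 1) = κ
  generalize D.siteAvg _ = m
  simp only [hp, show p + 2 - 1 = p + 1 from rfl, Nat.add_sub_cancel]
  push_cast
  field_simp
  ring

end

end Model

/-! ### Magnetization and the vanishing field -/

/-- A sequence of uniformly Lipschitz functions converges at `a` when its limits at nearby points
have a limit at `a`. -/
lemma tendsto_of_abs_sub_le {f : ℕ → ℝ → ℝ} {F : ℝ → ℝ} {a p : ℝ} {l : Filter ℝ} [l.NeBot]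
    (hl : l ≤ 𝓝 a) (hf : ∀ᶠ N in atTop, ∀ x, |f N x - f N a| ≤ |x - a|)
    (hF : ∀ᶠ x in l, Tendsto (fun N => f N x) atTop (𝓝 (F x))) (hp : Tendsto F l (𝓝 p)) :
    Tendsto (fun N => f N a) atTop (𝓝 p) := by
  rw [Metric.tendsto_nhds]
  intro ε hε
  have h3 : 0 < ε / 3 := by positivity
  obtain ⟨x, hx, hxp, hxa⟩ := (hF.and ((Metric.tendsto_nhds.1 hp _ h3).and
    (hl (Metric.ball_mem_nhds a h3)))).exists
  filter_upwards [hf, Metric.tendsto_nhds.1 hx _ h3] with N h1 h2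
  have h1' := h1 x
  rw [Real.dist_eq] at hxp h2 ⊢
  rw [Real.dist_eq] at hxa
  rw [abs_lt] at hxp h2 ⊢
  have := abs_le.1 (h1'.trans hxa.le)
  constructor <;> linarith

lemma eventually_eventually_nhds_of_nhdsGT {p : ℝ → Prop} (h : ∀ᶠ x in 𝓝[>] (0 : ℝ), p x) :
    ∀ᶠ x in 𝓝[>] (0 : ℝ), ∀ᶠ y in 𝓝 x, p y := by
  filter_upwards [eventually_eventually_nhdsWithin.2 h, self_mem_nhdsWithin] with x hx hx0
  rwa [isOpen_Ioi.nhdsWithin_eq hx0] at hx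

namespace Model

variable {D : Model} {θ γ : ℝ}

lemma β'_pos (hβ : 0 < D.β) : 0 < D.β' := by unfold β'; positivity

/-- Where the assumptions hold near `J` with differentiable order parameters, the free energy is
differentiable, and by convexity in the field its derivative is the limit of the magnetizations. -/
lemma hasDerivAt_freeEnergy (hP : 2 ≤ D.P) (hM : 1 ≤ D.M) (hr : 0 < D.r) (hr1 : D.r ≤ 1)
    (hβ : 0 < D.β') (hθ : 0 < θ) (hθ1 : θ ≤ 1) (hγ : Tendsto D.loadN atTop (𝓝 γ)) {J : ℝ}
    {n q₁ q₂ : ℝ → ℝ} (h : ∀ᶠ x in 𝓝 J, D.OneRSB θ x (n x) (q₁ x) (q₂ x))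
    (hn : DifferentiableAt ℝ n J) (h₁ : DifferentiableAt ℝ q₁ J) (h₂ : DifferentiableAt ℝ q₂ J) :
    HasDerivAt (fun x => -D.β' * D.freeEnergy x) (D.mBar θ γ J (n J) (q₁ J) (q₂ J)) J ∧
      Tendsto (fun N => D.meanMattis N J) atTop (𝓝 (D.mBar θ γ J (n J) (q₁ J) (q₂ J))) := by
  have hs : ∀ᶠ x in 𝓝 J, D.SelfConsistent θ γ x (n x) (q₁ x) (q₂ x) :=
    h.mono fun x hx => hx.selfConsistent hM hr hr1 hθ.le hγ
  have hf := fun x (hx : D.OneRSB θ x (n x) (q₁ x) (q₂ x)) =>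
    hx.tendsto_freeEnergy (by omega) hM hr hr1 hβ.ne' hθ hθ1 hγ
  have hd : HasDerivAt (fun x => -D.β' * D.freeEnergy x)
      (D.mBar θ γ J (n J) (q₁ J) (q₂ J)) J :=
    (hasDerivAt_pressure hP (D.one_add_ρ_pos hM hr hr1) hβ.le hθ hθ1
      (ge_of_tendsto' hγ D.loadN_nonneg) hn h₁ h₂ (hs.mono fun x hx => hx.q₁_nonneg hr.le hr1)
      (hs.mono fun x hx => hx.q₁_le_q₂ hθ.le hr.le hr1) hs.self_of_nhds).congr_of_eventuallyEq
      (h.mono fun x hx => (hf x hx).2)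
  exact ⟨hd, tendsto_subgradient (f := fun N x => -D.β' * D.freeEnergyN N x)
    ((eventually_gt_atTop 0).mono fun N hN x =>
      D.add_meanMattis_mul_le hr.le hr1 hβ.ne' hN J x)
    (h.mono fun x hx => (hf x hx).1.const_mul _) hd⟩

end Model

end SupDAM

end

theorem proposition2 (D : SupDAM.Model) (hP : 2 ≤ D.P) (hM : 1 ≤ D.M)
    (hr : 0 < D.r) (hr1 : D.r ≤ 1) (hβ : 0 < D.β)
    (θ : ℝ) (hθ : 0 < θ) (hθ1 : θ ≤ 1) (γ : ℝ)
    (hK : Tendsto (fun N : ℕ => (D.K N : ℝ) / (N : ℝ) ^ (D.P - 1)) atTop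
      (𝓝 (γ * (2 / (D.P.factorial : ℝ))))) :
    -- free energy and self-consistency equations at every field where the assumptions hold
    (∀ J n q₁ q₂ : ℝ, D.OneRSB θ J n q₁ q₂ →
      Tendsto (fun N => D.freeEnergyN N J) atTop (𝓝 (D.freeEnergy J)) ∧
      -D.β' * D.freeEnergy J = D.pressure θ γ J n q₁ q₂ ∧
      D.SelfConsistent θ γ J n q₁ q₂) ∧
    -- the magnetization is the gradient of the free energy with respect to the field
    (∀ (J : ℝ) (n q₁ q₂ : ℝ → ℝ),
      (∀ᶠ J' in 𝓝 J, D.OneRSB θ J' (n J') (q₁ J') (q₂ J')) →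
      DifferentiableAt ℝ n J → DifferentiableAt ℝ q₁ J → DifferentiableAt ℝ q₂ J →
      HasDerivAt (fun J' => -D.β' * D.freeEnergy J') (D.mBar θ γ J (n J) (q₁ J) (q₂ J)) J ∧
      Tendsto (fun N => D.meanMattis N J) atTop (𝓝 (D.mBar θ γ J (n J) (q₁ J) (q₂ J)))) ∧
    -- vanishing field: `n₀, a₁, a₂` are the limits of the order parameters as `J` decreases to `0`
    (∀ (n q₁ q₂ : ℝ → ℝ) (n₀ a₁ a₂ : ℝ),
      (∀ᶠ J in 𝓝[>] (0 : ℝ), D.OneRSB θ J (n J) (q₁ J) (q₂ J)) →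
      Tendsto n (𝓝[>] 0) (𝓝 n₀) → Tendsto q₁ (𝓝[>] 0) (𝓝 a₁) → Tendsto q₂ (𝓝[>] 0) (𝓝 a₂) →
      Tendsto (fun N => D.freeEnergyN N 0) atTop (𝓝 (D.freeEnergy 0)) ∧
      -D.β' * D.freeEnergy 0 = D.pressure θ γ 0 n₀ a₁ a₂ ∧
      D.SelfConsistent θ γ 0 n₀ a₁ a₂ ∧
      ((∀ᶠ J in 𝓝[>] (0 : ℝ),
          DifferentiableAt ℝ n J ∧ DifferentiableAt ℝ q₁ J ∧ DifferentiableAt ℝ q₂ J) →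
        HasDerivWithinAt (fun J => -D.β' * D.freeEnergy J) (D.mBar θ γ 0 n₀ a₁ a₂)
          (Set.Ici 0) 0 ∧
        Tendsto D.magnetization (𝓝[>] 0) (𝓝 (D.mBar θ γ 0 n₀ a₁ a₂)))) := by
  have hγ := D.tendsto_loadN hK
  have hβ' := SupDAM.Model.β'_pos hβ
  refine ⟨fun J n q₁ q₂ h => ?_, fun J n q₁ q₂ h hn h₁ h₂ =>
    SupDAM.Model.hasDerivAt_freeEnergy hP hM hr hr1 hβ' hθ hθ1 hγ h hn h₁ h₂,
    fun n q₁ q₂ n₀ a₁ a₂ h hn h₁ h₂ => ?_⟩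
  · obtain ⟨h1, h2⟩ := h.tendsto_freeEnergy (by omega) hM hr hr1 hβ'.ne' hθ hθ1 hγ
    exact ⟨h1, h2, h.selfConsistent hM hr hr1 hθ.le hγ⟩
  have h0 : Tendsto (fun J : ℝ => J) (𝓝[>] 0) (𝓝 0) :=
    tendsto_nhdsWithin_of_tendsto_nhds tendsto_id
  have hp := D.tendsto_pressure hθ.le γ h0 hn h₁ h₂
  have hF : Tendsto (fun J => -D.β' * D.freeEnergy J) (𝓝[>] 0)
      (𝓝 (D.pressure θ γ 0 n₀ a₁ a₂)) := hp.congr' <| h.mono fun J hJ =>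
    (hJ.tendsto_freeEnergy (by omega) hM hr hr1 hβ'.ne' hθ hθ1 hγ).2.symm
  obtain ⟨f1, f2⟩ := SupDAM.Model.tendsto_freeEnergy_of_tendsto hβ'.ne'
    (SupDAM.tendsto_of_abs_sub_le (f := fun N x => -D.β' * D.freeEnergyN N x)
      (F := fun J => -D.β' * D.freeEnergy J) (a := 0) nhdsWithin_le_nhds
      ((eventually_gt_atTop 0).mono fun N hN x =>
        D.abs_freeEnergyN_sub_le hr.le hr1 hβ'.ne' hN 0 x)
      (h.mono fun J hJ => (hJ.tendsto_freeEnergy (by omega) hM hr hr1 hβ'.ne' hθ hθ1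
        hγ).1.const_mul _) hF)
  refine ⟨f1, f2, SupDAM.Model.SelfConsistent.of_tendsto hθ.le
    (h.mono fun J hJ => hJ.selfConsistent hM hr hr1 hθ.le hγ) h0 hn h₁ h₂, fun hd => ?_⟩
  have hm := D.tendsto_mBar hθ.le γ h0 hn h₁ h₂
  have hJ : ∀ᶠ J in 𝓝[>] (0 : ℝ),
      HasDerivAt (fun J => -D.β' * D.freeEnergy J) (D.mBar θ γ J (n J) (q₁ J) (q₂ J)) J ∧
      Tendsto (fun N => D.meanMattis N J) atTop (𝓝 (D.mBar θ γ J (n J) (q₁ J) (q₂ J))) := by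
    filter_upwards [SupDAM.eventually_eventually_nhds_of_nhdsGT h, hd] with J hJ hdJ
    exact SupDAM.Model.hasDerivAt_freeEnergy hP hM hr hr1 hβ' hθ hθ1 hγ hJ hdJ.1 hdJ.2.1 hdJ.2.2
  refine ⟨?_, hm.congr' (hJ.mono fun J h => h.2.limUnder_eq.symm)⟩
  -- Extension of the derivative to the endpoint of the interval.
  refine hasDerivWithinAt_Ici_of_tendsto_deriv
    (s := {J | DifferentiableAt ℝ (fun J => -D.β' * D.freeEnergy J) J} ∩ Set.Ioi 0)
    (fun J hJ => DifferentiableAt.differentiableWithinAt hJ.1) ?_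
    (inter_mem (hJ.mono fun J h => h.1.differentiableAt) self_mem_nhdsWithin)
    (hm.congr' (hJ.mono fun J h => h.1.deriv.symm))
  rw [ContinuousWithinAt, f2]
  exact hF.mono_left (nhdsWithin_mono _ Set.inter_subset_right)
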